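/- **Setting.** Let $N$ be a smooth $(2m+1)$-dimensional Riemannian manifold with metric $g$, Levi-Civita connection $\widehat{\overline\nabla}$ and curvature $\widehat{\overline R}$, carrying a smooth almost contact metric structure $(\varphi,\xi,\eta)$: $\varphi^2X=-X+\eta(X)\xi$, $\eta(\xi)=1$, $\varphi\xi=0$, $\eta\circ\varphi=0$, $g(X,\varphi Y)=-g(\varphi X,Y)$, $g(X,\xi)=\eta(X)$. Curvatures of connections are $R(X,Y)Z=\nabla_X\nabla_YZ-\nabla_Y\nabla_XZ-\nabla_{[X,Y]}Z$, and $R(X,Y,Z,W)=g(R(X,Y)Z,W)$. Let $h'=\tfrac12\mathcal L_\xi\varphi$ and let $\kappa,\mu,c$ be real constants. $N=N(c)$ is a $(\kappa,\mu)$-contact space form if * $g(X,\varphi Y)=d\eta(X,Y)$, where $2\,d\eta(X,Y)=X\eta(Y)-Y\eta(X)-\eta([X,Y])$; * $\widehat{\overline R}(X,Y)\xi=\kappa[g(Y,\xi)X-g(X,\xi)Y]+\mu[g(Y,\xi)h'X-g(X,\xi)h'Y]$; * $\widehat{\overline R}(X,\varphi X,\varphi X,X)=c$ for every unit vector $X\perp\xi$.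 Let $P$ be a smooth vector field on $N$, $\pi(X)=g(P,X)$, let $\lambda_1,\lambda_2$ be real constants, and let $$\overline\nabla_XY=\widehat{\overline\nabla}_XY+\lambda_1\pi(Y)X-\lambda_2g(X,Y)P .$$ Put $\alpha(X,Y)=(\widehat{\overline\nabla}_X\pi)(Y)-\lambda_1\pi(X)\pi(Y)+\tfrac{\lambda_2}{2}g(X,Y)\pi(P)$ and $\beta(X,Y)=\tfrac{\pi(P)}2g(X,Y)+\pi(X)\pi(Y)$. Let $M$ be an $n$-dimensional (immersed) submanifold of $N$ with the induced metric. The induced connection $\nabla$ and the normal-valued form $h$ are defined by $\overline\nabla_XY=\nabla_XY+h(X,Y)$, with $\nabla_XY$ tangent and $h(X,Y)$ normal to $M$; $R$ denotes the curvature of $\nabla$. The symbol $^\top$ denotes the part tangent to $M$; for $X$ tangent to $M$, $\widehat PX=(\varphi X)^\top$, $(h')^\top X=(h'X)^\top$ and $(\varphi h')^\top X=(\varphi h'X)^\top$. Let $x\in M$, let $\{e_1,\dots,e_n\}$ be an orthonormal basis of $T_xM$, and let $\Pi\subset T_xM$ be a plane with orthonormal basis $\{p_1,p_2\}$. Put $$K(\Pi)=\tfrac12[R(p_1,p_2,p_2,p_1)-R(p_1,p_2,p_1,p_2)],\qquad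 \tau(x)=\sum_{i<j}K(e_i\wedge e_j),\qquad H=\tfrac1n\sum_ih(e_i,e_i),$$ $$\gamma(\Pi)=\eta(p_1)^2+\eta(p_2)^2,\qquad \beta(\Pi)=g(\widehat Pp_1,p_2)^2,$$ $$\theta(\Pi)=\eta(p_1)^2g((h')^\top p_2,p_2)+\eta(p_2)^2g((h')^\top p_1,p_1)-2\eta(p_1)\eta(p_2)g((h')^\top p_1,p_2),$$ and $\|\vartheta\|^2=\sum_{i,j}g(e_i,\vartheta e_j)^2$ for $\vartheta\in\{\widehat P,(\varphi h')^\top,(h')^\top\}$. For an operator $A$, $\operatorname{tr}(A|_\Pi)=\sum_i g(Ap_i,p_i)$ and $\det(A|_\Pi)=\det\big(g(Ap_i,p_j)\big)_{i,j=1,2}$. The traces of $\alpha,\beta$ are $\operatorname{tr}\alpha=\sum_{i=1}^n\alpha(e_i,e_i)$, $\operatorname{tr}(\alpha|_\Pi)=\alpha(p_1,p_1)+\alpha(p_2,p_2)$, and likewise for $\beta$; $\operatorname{tr}(h|_\Pi)=h(p_1,p_1)+h(p_2,p_2)$. **Theorem 3.1.** If $n\ge 3$, then for every $x\in M$ and every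 plane $\Pi\subset T_xM$, $$\begin{aligned} \tau(x)-K(\Pi)\le{}&\frac{(n+1)(n-2)}{2}\,\frac{c+3}{4}+\frac{c+3-4\kappa}{4}\big[-(n-1)\|\xi^\top\|^2+\gamma(\Pi)\big]+\frac{c-1}{8}\big[3\|\widehat P\|^2-6\beta(\Pi)\big]\\ &+\frac14\big[\|(\varphi h')^\top\|^2-\|(h')^\top\|^2+|\operatorname{tr}((h')^\top)|^2-|\operatorname{tr}((\varphi h')^\top)|^2\big]\\ &-\frac12\big[\det(h'|_\Pi)-\det((\varphi h')|_\Pi)\big]+(n-1)\operatorname{tr}((h')^\top)-\operatorname{tr}(h'|_\Pi)\\ &+(1-\mu)\big[g(\xi^\top,h'\xi^\top)-\operatorname{tr}((h')^\top)\|\xi^\top\|^2+\theta(\Pi)\big]\\ &-\frac{\lambda_1+\lambda_2}{2}(n-1)\operatorname{tr}\alpha-\frac{\lambda_2}{2}(\lambda_1-\lambda_2)(n-1)\operatorname{tr}\beta-\frac{\lambda_1-\lambda_2}{2}(n-1)n\,\pi(H)\\ &+\frac{\lambda_1+\lambda_2}{2}\operatorname{tr}(\alpha|_\Pi)+\frac{\lambda_2(\lambda_1-\lambda_2)}{2}\operatorname{tr}(\beta|_\Pi)+\frac{\lambda_1-\lambda_2}{2}\,g(\operatorname{tr}(h|_\Pi),P)+\frac{n^2(n-2)}{2(n-1)}\|H\|^2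 . \end{aligned}$$ -/

import Mathlib

open scoped Manifold ContDiff

noncomputable section

namespace ContactChen

/-! ## Tensor calculus in a coordinate domain

`E` is the model vector space of a chart.  A vector field in the chart is a map `E → E`, the tangent
vectors at a point `y` are the elements of `E`, and a Riemannian metric is a map
`G : E → E →L[ℝ] E →L[ℝ] ℝ`.  All notions depend only on germs at the point considered. -/

section Local

variable {E E' : Type*} [NormedAddCommGroup E] [NormedSpace ℝ E]
  [NormedAddCommGroup E'] [NormedSpace ℝ E']

/-- The Christoffel symbols of the metric `G` at `y`: the vector `Γ_y(u, v)` with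
`G_y (Γ_y(u, v), w) = (1/2) (∂_u G(v, w) + ∂_v G(u, w) - ∂_w G(u, v))` for all `w`. -/
def christoffel (G : E → E →L[ℝ] E →L[ℝ] ℝ) (y u v : E) : E :=
  (G y).inverse ((1 / 2 : ℝ) •
    (fderiv ℝ G y u v + fderiv ℝ G y v u - ((fderiv ℝ G y).flip u).flip v))

/-- The covariant derivative `∇_X Y = DY(X) + C(X, Y)` of the linear connection with
coefficients `C`.  For `C = christoffel G` it is the Levi-Civita connection of `G`. -/
def covDeriv (C : E → E → E → E) (X Y : E → E) (y : E) : E :=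
  fderiv ℝ Y y (X y) + C y (X y) (Y y)

/-- The covariant derivative of a field `Z : E' → E` along a map `F : E' → E` (the connection with
coefficients `C` pulled back by `F`) in the direction of the vector field `X` on `E'`. -/
def covDerivAlong (C : E → E → E → E) (F : E' → E) (X : E' → E') (Z : E' → E) (s : E') : E :=
  fderiv ℝ Z s (X s) + C (F s) (fderiv ℝ F s (X s)) (Z s)

/-- The curvature `R(X, Y) Z = ∇_X ∇_Y Z - ∇_Y ∇_X Z - ∇_[X, Y] Z` of a connection `nabla`. -/
def curvature (nabla : (E → E) → (E → E) → (E → E)) (X Y Z : E → E) (y : E) : E :=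
  nabla X (nabla Y Z) y - nabla Y (nabla X Z) y - nabla (VectorField.lieBracket ℝ X Y) Z y

/-- The curvature tensor at `y` on the vectors `u, v, w`, extended by constant vector fields. -/
def curvatureAt (nabla : (E → E) → (E → E) → (E → E)) (y u v w : E) : E :=
  curvature nabla (fun _ => u) (fun _ => v) (fun _ => w) y

/-- The exterior derivative of a one-form, in the convention
`2 dη(X, Y) = X η(Y) - Y η(X) - η([X, Y])`. -/
def dOneForm (η : E → E →L[ℝ] ℝ) (y u v : E) : ℝ :=
  (1 / 2 : ℝ) * (fderiv ℝ η y u v - fderiv ℝ η y v u)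

/-- The tensor `h'` with `2 h' X = (L_ξ φ) X = [ξ, φ X] - φ [ξ, X]`. -/
def hPrime (φ : E → E →L[ℝ] E) (ξ : E → E) (y u : E) : E :=
  (1 / 2 : ℝ) • (VectorField.lieBracket ℝ ξ (fun z => φ z u) y
    - φ y (VectorField.lieBracket ℝ ξ (fun _ => u) y))

/-- The almost contact metric structure `(φ, ξ, η, G)` is, on the coordinate domain `U`, a
`(κ, μ)`-contact metric structure of constant `φ`-sectional curvature `c`. -/
structure IsKappaMuSpaceFormOn (U : Set E) (G : E → E →L[ℝ] E →L[ℝ] ℝ) (φ : E → E →L[ℝ] E)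
    (ξ : E → E) (η : E → E →L[ℝ] ℝ) (κ μ c : ℝ) : Prop where
  /-- The structure is contact metric: `Φ = dη` for `Φ(X, Y) = g(X, φ Y)`. -/
  contact : ∀ y ∈ U, ∀ u v : E, G y u (φ y v) = dOneForm η y u v
  /-- `ξ` belongs to the `(κ, μ)`-nullity distribution. -/
  nullity : ∀ y ∈ U, ∀ u v : E,
    curvatureAt (covDeriv (christoffel G)) y u v (ξ y) =
      κ • (G y v (ξ y) • u - G y u (ξ y) • v)
        + μ • (G y v (ξ y) • hPrime φ ξ y u - G y u (ξ y) • hPrime φ ξ y v)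
  /-- The plane spanned by `u` and `φ u`, for a unit vector `u` orthogonal to `ξ`, has sectional
  curvature `c`. -/
  phi_sectional : ∀ y ∈ U, ∀ u : E, G y u u = 1 → G y u (ξ y) = 0 →
    G y (curvatureAt (covDeriv (christoffel G)) y u (φ y u) (φ y u)) u = c

/-- The coordinate expression of a submanifold `F` of an almost contact metric manifold with
metric `G` and tensors `φ`, `ξ`, `η`, together with the vector field `P` and the constants
`l₁`, `l₂` that determine the connection `∇̄_X Y = ∇̂_X Y + l₁ g(P, Y) X - l₂ g(X, Y) P`. -/
structure ChartData (E' E : Type*) [NormedAddCommGroup E] [NormedSpace ℝ E]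
    [NormedAddCommGroup E'] [NormedSpace ℝ E'] where
  G : E → E →L[ℝ] E →L[ℝ] ℝ
  φ : E → E →L[ℝ] E
  ξ : E → E
  η : E → E →L[ℝ] ℝ
  P : E → E
  l₁ : ℝ
  l₂ : ℝ
  F : E' → E

namespace ChartData

variable (D : ChartData E' E)

/-- The coefficients of the connection `∇̄_X Y = ∇̂_X Y + l₁ π(Y) X - l₂ g(X, Y) P`, where
`∇̂` is the Levi-Civita connection of the ambient space and `π(Y) = g(P, Y)`. -/
def ambientCoeff (y u v : E) : E :=
  christoffel D.G y u v + (D.l₁ * D.G y (D.P y) v) • u - (D.l₂ * D.G y u v) • D.P y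

/-- The tensor `α(X, Y) = (∇̂_X π)(Y) - l₁ π(X) π(Y) + (l₂ / 2) g(X, Y) π(P)`, where
`(∇̂_X π)(Y) = X(π(Y)) - π(∇̂_X Y)`. -/
def α (y u v : E) : ℝ :=
  (fderiv ℝ (fun z => D.G z (D.P z) v) y u
      - D.G y (D.P y) (covDeriv (christoffel D.G) (fun _ => u) (fun _ => v) y))
    - D.l₁ * (D.G y (D.P y) u * D.G y (D.P y) v)
    + D.l₂ / 2 * (D.G y u v * D.G y (D.P y) (D.P y))

/-- The tensor `β(X, Y) = (π(P) / 2) g(X, Y) + π(X) π(Y)`. -/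
def β (y u v : E) : ℝ :=
  D.G y (D.P y) (D.P y) / 2 * D.G y u v + D.G y (D.P y) u * D.G y (D.P y) v

/-- The tensor `h'` of the ambient space. -/
def h' (y u : E) : E := hPrime D.φ D.ξ y u

/-- The differential of the immersion at `s`. -/
def d (s : E') : E' →L[ℝ] E := fderiv ℝ D.F s

/-- The induced metric of the submanifold. -/
def gInd (s : E') : E' →L[ℝ] E' →L[ℝ] ℝ := (D.G (D.F s)).bilinearComp (D.d s) (D.d s)

/-- The tangential component of an ambient vector `z` at `F s`, as a tangent vector of the
submanifold: the vector `t` with `g(dF t, dF w) = g(z, dF w)` for all `w`. -/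
def tan (s : E') (z : E) : E' := (D.gInd s).inverse ((D.G (D.F s) z).comp (D.d s))

/-- The normal component of an ambient vector `z` at `F s`. -/
def nor (s : E') (z : E) : E := z - D.d s (D.tan s z)

/-- The induced connection `∇` of the submanifold: the tangential component of `∇̄_X Y`. -/
def inducedNabla (X Y : E' → E') (s : E') : E' :=
  D.tan s (covDerivAlong D.ambientCoeff D.F X (fun t => D.d t (Y t)) s)

/-- The form `h(X, Y)`: the normal component of `∇̄_X Y`, so that `∇̄_X Y = ∇_X Y + h(X, Y)`. -/
def h (s u v : E') : E :=
  D.nor s (covDerivAlong D.ambientCoeff D.F (fun _ => u) (fun t => D.d t v) s)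

/-- The curvature `R(X, Y, Z, W) = g(R(X, Y) Z, W)` of the induced connection `∇`. -/
def R (s u v w z : E') : ℝ := D.gInd s (curvatureAt D.inducedNabla s u v w) z

/-- The sectional curvature `K(Π)` of the induced connection for the plane `Π` with
orthonormal basis `u, v`. -/
def K (s u v : E') : ℝ := (1 / 2 : ℝ) * (D.R s u v v u - D.R s u v u v)

/-- The scalar curvature `τ = ∑_{i < j} K(e_i ∧ e_j)` of the induced connection. -/
def τ {n : ℕ} (s : E') (e : Fin n → E') : ℝ :=
  ∑ i, ∑ j ∈ Finset.Ioi i, D.K s (e i) (e j)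

/-- The mean curvature vector `H = (1 / n) ∑ h(e_i, e_i)`. -/
def H {n : ℕ} (s : E') (e : Fin n → E') : E := (1 / (n : ℝ)) • ∑ i, D.h s (e i) (e i)

/-- The one-form `π(z) = g(P, z)` at `F s`. -/
def π (s : E') (z : E) : ℝ := D.G (D.F s) (D.P (D.F s)) z

/-- `ξ^⊤`, the tangential component of `ξ`. -/
def ξT (s : E') : E' := D.tan s (D.ξ (D.F s))

/-- `P̂ X`, the tangential component of `φ X`. -/
def Phat (s u : E') : E' := D.tan s (D.φ (D.F s) (D.d s u))

/-- `(h')^⊤ X`, the tangential component of `h' X`. -/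
def h'T (s u : E') : E' := D.tan s (D.h' (D.F s) (D.d s u))

/-- `(φ h')^⊤ X`, the tangential component of `φ h' X`. -/
def φh'T (s u : E') : E' := D.tan s (D.φ (D.F s) (D.h' (D.F s) (D.d s u)))

/-- `‖ϑ‖² = ∑_{i, j} g(e_i, ϑ e_j)²` for an operator `ϑ` on the tangent space. -/
def normSq {n : ℕ} (s : E') (e : Fin n → E') (A : E' → E') : ℝ :=
  ∑ i, ∑ j, (D.gInd s (e i) (A (e j))) ^ 2

/-- The trace `∑_i g(A e_i, e_i)` of an operator over the span of the orthonormal vectors `e_i`. -/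
def tr {k : ℕ} (s : E') (e : Fin k → E') (A : E' → E') : ℝ := ∑ i, D.gInd s (A (e i)) (e i)

/-- The determinant of the compression of an operator to the plane with orthonormal basis
`p 0, p 1`. -/
def det₂ (s : E') (p : Fin 2 → E') (A : E' → E') : ℝ :=
  Matrix.det (Matrix.of fun i j => D.gInd s (A (p i)) (p j))

/-- The trace of an ambient bilinear form over the span of the orthonormal vectors `e_i` tangent
to the submanifold. -/
def trForm {k : ℕ} (s : E') (e : Fin k → E') (B : E → E → E → ℝ) : ℝ :=
  ∑ i, B (D.F s) (D.d s (e i)) (D.d s (e i))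

/-- `η` on vectors tangent to the submanifold. -/
def ηM (s u : E') : ℝ := D.η (D.F s) (D.d s u)

/-- `γ(Π) = η(e₁)² + η(e₂)²`. -/
def γ (s : E') (p : Fin 2 → E') : ℝ := D.ηM s (p 0) ^ 2 + D.ηM s (p 1) ^ 2

/-- `β(Π) = g(P̂ e₁, e₂)²`. -/
def βPlane (s : E') (p : Fin 2 → E') : ℝ := (D.gInd s (D.Phat s (p 0)) (p 1)) ^ 2

/-- `θ(Π) = η(e₁)² g((h')^⊤ e₂, e₂) + η(e₂)² g((h')^⊤ e₁, e₁)
- 2 η(e₁) η(e₂) g((h')^⊤ e₁, e₂)`. -/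
def θ (s : E') (p : Fin 2 → E') : ℝ :=
  D.ηM s (p 0) ^ 2 * D.gInd s (D.h'T s (p 1)) (p 1)
    + D.ηM s (p 1) ^ 2 * D.gInd s (D.h'T s (p 0)) (p 0)
    - 2 * D.ηM s (p 0) * D.ηM s (p 1) * D.gInd s (D.h'T s (p 0)) (p 1)

end ChartData

end Local

/-! ## Almost contact metric manifolds -/

section Global

/-- The model space of `d`-dimensional manifolds. -/
abbrev Model (d : ℕ) := EuclideanSpace ℝ (Fin d)

/-- An almost contact metric structure on a `(2m+1)`-dimensional manifold `N`: a Riemannian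
metric, a `(1,1)`-tensor field `φ`, a vector field `ξ` and a one-form `η`, all smooth. -/
structure AlmostContactMetric (m : ℕ) (N : Type*) [TopologicalSpace N]
    [ChartedSpace (Model (2 * m + 1)) N] [IsManifold (𝓡 (2 * m + 1)) ∞ N] where
  g : Bundle.ContMDiffRiemannianMetric (𝓡 (2 * m + 1)) ∞ (Model (2 * m + 1))
    (fun x : N => TangentSpace (𝓡 (2 * m + 1)) x)
  φ : ∀ x : N, TangentSpace (𝓡 (2 * m + 1)) x →L[ℝ] TangentSpace (𝓡 (2 * m + 1)) x
  ξ : ∀ x : N, TangentSpace (𝓡 (2 * m + 1)) x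
  η : ∀ x : N, TangentSpace (𝓡 (2 * m + 1)) x →L[ℝ] ℝ
  smooth_φ : ContMDiff (𝓡 (2 * m + 1))
    ((𝓡 (2 * m + 1)).prod 𝓘(ℝ, Model (2 * m + 1) →L[ℝ] Model (2 * m + 1))) ∞
    (fun x => Bundle.TotalSpace.mk' (Model (2 * m + 1) →L[ℝ] Model (2 * m + 1))
      (E := fun x : N =>
        TangentSpace (𝓡 (2 * m + 1)) x →L[ℝ] TangentSpace (𝓡 (2 * m + 1)) x) x (φ x))
  smooth_ξ : ContMDiff (𝓡 (2 * m + 1)) (𝓡 (2 * m + 1)).tangent ∞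
    (fun x => (⟨x, ξ x⟩ : TangentBundle (𝓡 (2 * m + 1)) N))
  smooth_η : ContMDiff (𝓡 (2 * m + 1))
    ((𝓡 (2 * m + 1)).prod 𝓘(ℝ, Model (2 * m + 1) →L[ℝ] ℝ)) ∞
    (fun x => Bundle.TotalSpace.mk' (Model (2 * m + 1) →L[ℝ] ℝ)
      (E := fun x : N => TangentSpace (𝓡 (2 * m + 1)) x →L[ℝ] ℝ) x (η x))
  φ_sq : ∀ x v, φ x (φ x v) = -v + η x v • ξ x
  η_ξ : ∀ x, η x (ξ x) = 1
  φ_ξ : ∀ x, φ x (ξ x) = 0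
  η_φ : ∀ x v, η x (φ x v) = 0
  skew : ∀ x u v, g.inner x u (φ x v) = -g.inner x (φ x u) v
  g_ξ : ∀ x v, g.inner x v (ξ x) = η x v

variable {d : ℕ} {N : Type*} [TopologicalSpace N] [ChartedSpace (Model d) N]

/-- The coordinate frame of the chart `e` at the point with coordinates `y`. -/
def frame (e : OpenPartialHomeomorph N (Model d)) (y : Model d) :
    Model d →L[ℝ] TangentSpace (𝓡 d) (e.symm y) :=
  mfderiv (𝓡 d) (𝓡 d) e.symm y

/-- The differential of the chart `e` at `p`: it maps a tangent vector to its coordinates. -/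
def coord (e : OpenPartialHomeomorph N (Model d)) (p : N) :
    TangentSpace (𝓡 d) p →L[ℝ] Model d :=
  mfderiv (𝓡 d) (𝓡 d) e p

/-- Coordinate expression of a vector field. -/
def vectorIn (e : OpenPartialHomeomorph N (Model d)) (X : ∀ p : N, TangentSpace (𝓡 d) p)
    (y : Model d) : Model d :=
  coord e (e.symm y) (X (e.symm y))

/-- Coordinate expression of a one-form. -/
def oneFormIn (e : OpenPartialHomeomorph N (Model d))
    (a : ∀ p : N, TangentSpace (𝓡 d) p →L[ℝ] ℝ) (y : Model d) : Model d →L[ℝ] ℝ :=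
  (a (e.symm y)).comp (frame e y)

/-- Coordinate expression of a `(1,1)`-tensor field. -/
def endoIn (e : OpenPartialHomeomorph N (Model d))
    (A : ∀ p : N, TangentSpace (𝓡 d) p →L[ℝ] TangentSpace (𝓡 d) p) (y : Model d) :
    Model d →L[ℝ] Model d :=
  (coord e (e.symm y)).comp ((A (e.symm y)).comp (frame e y))

/-- Coordinate expression `G_y(u, v) = g(∂_u, ∂_v)` of a field of bilinear forms. -/
def metricIn (e : OpenPartialHomeomorph N (Model d))
    (g : ∀ p : N, TangentSpace (𝓡 d) p →L[ℝ] TangentSpace (𝓡 d) p →L[ℝ] ℝ) (y : Model d) :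
    Model d →L[ℝ] Model d →L[ℝ] ℝ :=
  (ContinuousLinearMap.precomp ℝ (frame e y)).comp ((g (e.symm y)).comp (frame e y))

/-- `N` with the almost contact metric structure `S` is a `(κ, μ)`-contact space form `N(c)`: in
every chart, `S` is contact metric, `ξ` lies in the `(κ, μ)`-nullity distribution, and the
`φ`-sectional curvature is constantly `c`. -/
def IsKappaMuSpaceForm {m : ℕ} {N : Type*} [TopologicalSpace N]
    [ChartedSpace (Model (2 * m + 1)) N] [IsManifold (𝓡 (2 * m + 1)) ∞ N]
    (S : AlmostContactMetric m N) (κ μ c : ℝ) : Prop :=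
  ∀ e ∈ atlas (Model (2 * m + 1)) N,
    IsKappaMuSpaceFormOn e.target (metricIn e S.g.inner) (endoIn e S.φ) (vectorIn e S.ξ)
      (oneFormIn e S.η) κ μ c

/-- The coordinate expression near `x` of the submanifold `f : M → N`, of the ambient structure and
of the connection given by `P`, `l₁`, `l₂`, in the preferred charts at `x` and `f x`. -/
def chartData {m n : ℕ} {N : Type*} [TopologicalSpace N]
    [ChartedSpace (Model (2 * m + 1)) N] [IsManifold (𝓡 (2 * m + 1)) ∞ N]
    (S : AlmostContactMetric m N) (P : ∀ p : N, TangentSpace (𝓡 (2 * m + 1)) p) (l₁ l₂ : ℝ)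
    {M : Type*} [TopologicalSpace M] [ChartedSpace (Model n) M] (f : M → N) (x : M) :
    ChartData (Model n) (Model (2 * m + 1)) where
  G := metricIn (chartAt (Model (2 * m + 1)) (f x)) S.g.inner
  φ := endoIn (chartAt (Model (2 * m + 1)) (f x)) S.φ
  ξ := vectorIn (chartAt (Model (2 * m + 1)) (f x)) S.ξ
  η := oneFormIn (chartAt (Model (2 * m + 1)) (f x)) S.η
  P := vectorIn (chartAt (Model (2 * m + 1)) (f x)) P
  l₁ := l₁
  l₂ := l₂
  F := chartAt (Model (2 * m + 1)) (f x) ∘ f ∘ (chartAt (Model n) x).symm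

/-- The vectors `e_i ∈ T_x M` are orthonormal for the metric induced by `f`. -/
def IsOrthonormal {m n k : ℕ} {N : Type*} [TopologicalSpace N]
    [ChartedSpace (Model (2 * m + 1)) N] [IsManifold (𝓡 (2 * m + 1)) ∞ N]
    (S : AlmostContactMetric m N)
    {M : Type*} [TopologicalSpace M] [ChartedSpace (Model n) M] (f : M → N) (x : M)
    (e : Fin k → TangentSpace (𝓡 n) x) : Prop :=
  ∀ i j, S.g.inner (f x) (mfderiv (𝓡 n) (𝓡 (2 * m + 1)) f x (e i))
    (mfderiv (𝓡 n) (𝓡 (2 * m + 1)) f x (e j)) = if i = j then 1 else 0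

end Global

end ContactChen

end

set_option maxSynthPendingDepth 3

/-! Everything except one elementary estimate is an equality: the sectional curvature of the induced
connection is computed exactly, summed over pairs of a frame, and the only term that is estimated is
the one quadratic in the form `h`.

Ambient curvature. At a point put B = ∇ξ, T = ∇φ and S = B + φ, so that h' = φS and φh' = -S. The
contact condition makes S symmetric and anticommuting with φ, and gives ∇_ξ φ = 0. Through the Ricci
identity for ξ, the nullity condition yields S² = 1 - κ on ξ^⊥ (`S_sq`) and, which is the harder
point, the vanishing of the part of T with all three slots in ξ^⊥ (`τ_eq_zero`); hence T is an
explicit expression in B and φ (`T_eq`). The Ricci identity for φ then determines the commutator of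
R(u, v) with φ on ξ^⊥. The explicit tensor `modelCurv` has the same commutator there, the same value
R(u, v)ξ and the same φ-sectional curvature. The difference of the two is thus an algebraic
curvature tensor killed by ξ, of Kähler type on ξ^⊥, with zero holomorphic sectional curvature, and
polarization shows that all its sectional curvatures vanish (`sectional_eq_zero`). This gives
`IsAlmostContactOn.sectional`.

Submanifold. Differentiating the definition of the induced connection gives a Gauss equation
(`gauss`) with correction terms in α, β and π(h). The connection is not metric, so R(u, v, v, u) and
-R(u, v, u, v) differ; their mean K has corrections of the form b(u) + b(v) (`K_eq`), and each
b(e_i) is counted n - 1 times in τ.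

Estimate. What remains of τ - K(Π) is half of |∑ h_ii|² - ∑ |h_ij|², minus ⟨h_11, h_22⟩ - |h_12|² in
a frame whose first two vectors span Π. Cauchy–Schwarz for the n - 1 vectors h_11 + h_22, h_33, …,
h_nn bounds it (`IsFrame.chen`). Coordinates transfer the manifold statement to open sets of vector
spaces, where all of this takes place. -/

namespace ContactChen

/-! ### The Levi-Civita connection of a coordinate domain and the symmetries of its curvature. -/

section LeviCivita

variable {E E' : Type*} [NormedAddCommGroup E] [NormedSpace ℝ E]
  [NormedAddCommGroup E'] [NormedSpace ℝ E']

/-- `G` is a smooth Riemannian metric on the open set `U`. -/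
structure IsMetricOn (U : Set E) (G : E → E →L[ℝ] E →L[ℝ] ℝ) : Prop where
  isOpen : IsOpen U
  smooth : ∀ y ∈ U, ContDiffAt ℝ ∞ G y
  symm : ∀ y ∈ U, ∀ u v, G y u v = G y v u
  pos : ∀ y ∈ U, ∀ u, u ≠ 0 → 0 < G y u u

/-- `christoffel` and `tan` are defined with `ContinuousLinearMap.inverse`, which is zero on maps
that are not invertible; definiteness in finite dimension rules that default out. -/
theorem isInvertible_of_pos [FiniteDimensional ℝ E] {g : E →L[ℝ] E →L[ℝ] ℝ}
    (h : ∀ u, u ≠ 0 → 0 < g u u) : g.IsInvertible := by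
  have hinj : Function.Injective (g : E →ₗ[ℝ] E →L[ℝ] ℝ) := by
    rw [injective_iff_map_eq_zero]
    intro u hu
    by_contra hne
    have := h u hne
    have h0 : g u = 0 := hu
    simp [h0] at this
  have hdim : Module.finrank ℝ E = Module.finrank ℝ (E →L[ℝ] ℝ) := by
    rw [← LinearEquiv.finrank_eq (LinearMap.toContinuousLinearMap (𝕜 := ℝ) (E := E) (F' := ℝ))]
    exact (Subspace.dual_finrank_eq (K := ℝ) (V := E)).symm
  refine ⟨(LinearEquiv.ofInjectiveOfFinrankEq (g : E →ₗ[ℝ] E →L[ℝ] ℝ) hinj hdim).toContinuousLinearEquiv, ?_⟩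
  ext u v
  rfl

theorem contDiffAt_clm_of_apply [FiniteDimensional ℝ E] {F : Type*} [NormedAddCommGroup F]
    [NormedSpace ℝ F] {n : ℕ∞ω} {A : E' → E →L[ℝ] F} {y : E'}
    (h : ∀ v, ContDiffAt ℝ n (fun z => A z v) y) : ContDiffAt ℝ n A y := by
  let d := Module.finrank ℝ E
  have hd : d = Module.finrank ℝ (Fin d → ℝ) := (Module.finrank_fin_fun ℝ).symm
  let e₁ := ContinuousLinearEquiv.ofFinrankEq hd
  let e₂ := (e₁.arrowCongr (1 : F ≃L[ℝ] F)).trans (ContinuousLinearEquiv.piRing (Fin d))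
  rw [← Function.id_comp A, ← e₂.symm_comp_self]
  exact e₂.symm.contDiff.contDiffAt.comp y (contDiffAt_pi.mpr fun i => h _)

theorem contDiffAt_fderiv {F : Type*} [NormedAddCommGroup F] [NormedSpace ℝ F] {A : E' → F} {y : E'}
    (h : ContDiffAt ℝ ∞ A y) : ContDiffAt ℝ ∞ (fderiv ℝ A) y :=
  h.fderiv_right (m := ∞) (by simp)

theorem fderiv_clm_apply_apply {F : Type*} [NormedAddCommGroup F] [NormedSpace ℝ F]
    {A : E' → E →L[ℝ] F} {X : E' → E} {s : E'} (hA : DifferentiableAt ℝ A s)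
    (hX : DifferentiableAt ℝ X s) (u : E') :
    fderiv ℝ (fun t => A t (X t)) s u = fderiv ℝ A s u (X s) + A s (fderiv ℝ X s u) := by
  rw [fderiv_clm_apply hA hX]
  simp [add_comm]

theorem fderiv_clm_apply_const {F : Type*} [NormedAddCommGroup F] [NormedSpace ℝ F]
    {A : E' → E →L[ℝ] F} {s : E'} (hA : DifferentiableAt ℝ A s) (u : E') (v : E) :
    fderiv ℝ (fun t => A t v) s u = fderiv ℝ A s u v := by
  rw [fderiv_clm_apply_apply hA (differentiableAt_const v)]
  simp

theorem fderiv_bilin_apply {F : Type*} [NormedAddCommGroup F] [NormedSpace ℝ F]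
    {A : E' → E →L[ℝ] E →L[ℝ] F} {X Y : E' → E} {s : E'} (hA : DifferentiableAt ℝ A s)
    (hX : DifferentiableAt ℝ X s) (hY : DifferentiableAt ℝ Y s) (u : E') :
    fderiv ℝ (fun t => A t (X t) (Y t)) s u
      = fderiv ℝ A s u (X s) (Y s) + A s (fderiv ℝ X s u) (Y s) + A s (X s) (fderiv ℝ Y s u) := by
  rw [fderiv_clm_apply_apply (hA.clm_apply hX) hY, fderiv_clm_apply_apply hA hX]
  simp

theorem fderiv_fderiv_comm {F : Type*} [NormedAddCommGroup F] [NormedSpace ℝ F] {A : E' → F} {s : E'}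
    (h : ContDiffAt ℝ ∞ A s) (u v : E') :
    fderiv ℝ (fderiv ℝ A) s u v = fderiv ℝ (fderiv ℝ A) s v u :=
  (h.isSymmSndFDerivAt (by simpa using (WithTop.coe_le_coe.2 (le_top : (2 : ℕ∞) ≤ ⊤)))).eq u v

theorem fderiv_congr_on {F : Type*} [NormedAddCommGroup F] [NormedSpace ℝ F] {A B : E' → F}
    {U : Set E'} (hU : IsOpen U) (h : ∀ z ∈ U, A z = B z) {s : E'} (hs : s ∈ U) :
    fderiv ℝ A s = fderiv ℝ B s :=
  Filter.EventuallyEq.fderiv_eq (Filter.eventually_of_mem (hU.mem_nhds hs) h)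

theorem christoffel_add_left (G : E → E →L[ℝ] E →L[ℝ] ℝ) (y u u' v : E) :
    christoffel G y (u + u') v = christoffel G y u v + christoffel G y u' v := by
  simp only [christoffel, ← map_add]
  congr 1
  ext w
  simp
  ring

theorem christoffel_smul_left (G : E → E →L[ℝ] E →L[ℝ] ℝ) (a : ℝ) (y u v : E) :
    christoffel G y (a • u) v = a • christoffel G y u v := by
  simp only [christoffel, ← map_smul]
  congr 1
  ext w
  simp
  ring

theorem christoffel_add_right (G : E → E →L[ℝ] E →L[ℝ] ℝ) (y u v v' : E) :
    christoffel G y u (v + v') = christoffel G y u v + christoffel G y u v' := by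
  simp only [christoffel, ← map_add]
  congr 1
  ext w
  simp
  ring

theorem christoffel_smul_right (G : E → E →L[ℝ] E →L[ℝ] ℝ) (a : ℝ) (y u v : E) :
    christoffel G y u (a • v) = a • christoffel G y u v := by
  simp only [christoffel, ← map_smul]
  congr 1
  ext w
  simp
  ring

/-- The Christoffel symbols as a field of bilinear maps. -/
noncomputable def Gam [FiniteDimensional ℝ E] (G : E → E →L[ℝ] E →L[ℝ] ℝ) (y : E) :
    E →L[ℝ] E →L[ℝ] E :=
  LinearMap.toContinuousLinearMap
    { toFun := fun u => LinearMap.toContinuousLinearMap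
        { toFun := fun v => christoffel G y u v
          map_add' := fun v v' => christoffel_add_right G y u v v'
          map_smul' := fun a v => christoffel_smul_right G a y u v }
      map_add' := fun u u' => by
        ext v
        exact christoffel_add_left G y u u' v
      map_smul' := fun a u => by
        ext v
        exact christoffel_smul_left G a y u v }

theorem Gam_apply [FiniteDimensional ℝ E] (G : E → E →L[ℝ] E →L[ℝ] ℝ) (y u v : E) :
    Gam G y u v = christoffel G y u v := rfl

namespace IsMetricOn

variable {U : Set E} {G : E → E →L[ℝ] E →L[ℝ] ℝ} (hG : IsMetricOn U G)
include hG

theorem nondeg {y : E} (hy : y ∈ U) {u v : E} (h : ∀ w, G y u w = G y v w) : u = v := by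
  by_contra hne
  have := hG.pos y hy (u - v) (sub_ne_zero.2 hne)
  have h' := h (u - v)
  rw [map_sub (G y)] at this
  change 0 < G y u (u - v) - G y v (u - v) at this
  linarith

theorem differentiableAt {y : E} (hy : y ∈ U) : DifferentiableAt ℝ G y :=
  (hG.smooth y hy).differentiableAt (by simp)

theorem fderiv_symm {y : E} (hy : y ∈ U) (u v w : E) :
    fderiv ℝ G y u v w = fderiv ℝ G y u w v := by
  have h1 : ∀ v w, fderiv ℝ (fun z => G z v w) y u = fderiv ℝ G y u v w := fun v w => by
    rw [fderiv_bilin_apply (hG.differentiableAt hy) (differentiableAt_const v)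
      (differentiableAt_const w)]
    simp
  rw [← h1, ← h1, fderiv_congr_on hG.isOpen (fun z hz => hG.symm z hz v w) hy]

variable [FiniteDimensional ℝ E]

theorem two_mul_christoffel {y : E} (hy : y ∈ U) (u v w : E) :
    2 * G y (Gam G y u v) w
      = fderiv ℝ G y u v w + fderiv ℝ G y v u w - fderiv ℝ G y w u v := by
  rw [Gam_apply, christoffel, (isInvertible_of_pos (hG.pos y hy)).self_apply_inverse]
  simp

theorem Gam_symm {y : E} (hy : y ∈ U) (u v : E) : Gam G y u v = Gam G y v u := by
  refine hG.nondeg hy fun w => ?_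
  have h1 := hG.two_mul_christoffel hy u v w
  have h2 := hG.two_mul_christoffel hy v u w
  have h3 := hG.fderiv_symm hy w u v
  linarith

/-- Metric compatibility, ∇G = 0: add two Koszul formulas and use the symmetry of G. -/
theorem fderiv_eq {y : E} (hy : y ∈ U) (u v w : E) :
    fderiv ℝ G y u v w = G y (Gam G y u v) w + G y v (Gam G y u w) := by
  have h1 := hG.two_mul_christoffel hy u v w
  have h2 := hG.two_mul_christoffel hy u w v
  have h3 := hG.fderiv_symm hy u v w
  have h4 := hG.symm y hy v (Gam G y u w)
  linarith

theorem contDiffAt_Gam {y : E} (hy : y ∈ U) : ContDiffAt ℝ ∞ (Gam G) y := by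
  refine contDiffAt_clm_of_apply fun u => contDiffAt_clm_of_apply fun v => ?_
  have hG0 := hG.smooth y hy
  have hD := contDiffAt_fderiv hG0
  have hinv : ContDiffAt ℝ ∞ (fun z => (G z).inverse) y :=
    (isInvertible_of_pos (hG.pos y hy)).contDiffAt_map_inverse.comp y hG0
  have h1 : ∀ u v, ContDiffAt ℝ ∞ (fun z => fderiv ℝ G z u v) y := fun u v =>
    (hD.clm_apply contDiffAt_const).clm_apply contDiffAt_const
  have h2 : ContDiffAt ℝ ∞ (fun z => ((fderiv ℝ G z).flip u).flip v) y :=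
    contDiffAt_clm_of_apply fun w =>
      ((hD.clm_apply contDiffAt_const).clm_apply contDiffAt_const).clm_apply contDiffAt_const
  have h3 := ContDiffAt.const_smul (1 / 2 : ℝ) (((h1 u v).add (h1 v u)).sub h2)
  exact hinv.clm_apply h3

theorem differentiableAt_Gam {y : E} (hy : y ∈ U) : DifferentiableAt ℝ (Gam G) y :=
  (hG.contDiffAt_Gam hy).differentiableAt (by simp)

/-- The Levi-Civita connection along a map is metric. -/
theorem fderiv_inner_along {F : E' → E} {X Y : E' → E} {s : E'} (hs : F s ∈ U)
    (hF : DifferentiableAt ℝ F s) (hX : DifferentiableAt ℝ X s) (hY : DifferentiableAt ℝ Y s)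
    (u : E') :
    fderiv ℝ (fun t => G (F t) (X t) (Y t)) s u
      = G (F s) (fderiv ℝ X s u + Gam G (F s) (fderiv ℝ F s u) (X s)) (Y s)
        + G (F s) (X s) (fderiv ℝ Y s u + Gam G (F s) (fderiv ℝ F s u) (Y s)) := by
  have hGF : HasFDerivAt (fun t => G (F t)) ((fderiv ℝ G (F s)).comp (fderiv ℝ F s)) s :=
    (hG.differentiableAt hs).hasFDerivAt.comp s hF.hasFDerivAt
  rw [fderiv_bilin_apply (A := fun t => G (F t)) hGF.differentiableAt hX hY, hGF.fderiv]
  simp only [ContinuousLinearMap.comp_apply, hG.fderiv_eq hs, map_add,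
    add_apply]
  ring

theorem fderiv_inner {X Y : E → E} {y : E} (hy : y ∈ U)
    (hX : DifferentiableAt ℝ X y) (hY : DifferentiableAt ℝ Y y) (u : E) :
    fderiv ℝ (fun z => G z (X z) (Y z)) y u
      = G y (fderiv ℝ X y u + Gam G y u (X y)) (Y y)
        + G y (X y) (fderiv ℝ Y y u + Gam G y u (Y y)) := by
  have := hG.fderiv_inner_along (F := id) (s := y) hy differentiableAt_id hX hY u
  simpa using this

end IsMetricOn

/-- The curvature of the connection with coefficients `Γ`. -/
noncomputable def curv (Γ : E → E →L[ℝ] E →L[ℝ] E) (y u v w : E) : E :=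
  fderiv ℝ Γ y u v w - fderiv ℝ Γ y v u w + (Γ y u (Γ y v w) - Γ y v (Γ y u w))

theorem curvatureAt_covDeriv {Γ : E → E →L[ℝ] E →L[ℝ] E} {y : E} (hΓ : DifferentiableAt ℝ Γ y)
    (u v w : E) :
    curvatureAt (covDeriv fun z a b => Γ z a b) y u v w = curv Γ y u v w := by
  have h : ∀ u v w : E, fderiv ℝ (fun z => Γ z v w) y u = fderiv ℝ Γ y u v w := fun u v w => by
    rw [fderiv_bilin_apply hΓ (differentiableAt_const v) (differentiableAt_const w)]
    simp
  have h0 : ∀ u v : E, covDeriv (fun z a b => Γ z a b) (fun _ => u) (fun _ => v)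
      = fun z => Γ z u v := fun u v => by
    funext z
    simp [covDeriv]
  have hb : VectorField.lieBracket ℝ (fun _ : E => u) (fun _ => v) = fun _ => 0 := by
    funext z
    simp [VectorField.lieBracket]
  simp only [curvatureAt, curvature, h0, hb]
  simp only [covDeriv, h, curv, map_zero, zero_apply]
  abel

theorem curv_swap (Γ : E → E →L[ℝ] E →L[ℝ] E) (y u v w : E) :
    curv Γ y u v w = - curv Γ y v u w := by
  simp only [curv]
  abel

theorem curv_add_left (Γ : E → E →L[ℝ] E →L[ℝ] E) (y u u' v w : E) :
    curv Γ y (u + u') v w = curv Γ y u v w + curv Γ y u' v w := by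
  simp only [curv, map_add, add_apply]
  abel

theorem curv_smul_left (Γ : E → E →L[ℝ] E →L[ℝ] E) (a : ℝ) (y u v w : E) :
    curv Γ y (a • u) v w = a • curv Γ y u v w := by
  simp only [curv, map_smul, smul_apply, smul_sub, smul_add]

namespace IsMetricOn

variable [FiniteDimensional ℝ E] {U : Set E} {G : E → E →L[ℝ] E →L[ℝ] ℝ} (hG : IsMetricOn U G)
include hG

theorem fderiv_Gam_symm {y : E} (hy : y ∈ U) (u v w : E) :
    fderiv ℝ (Gam G) y u v w = fderiv ℝ (Gam G) y u w v := by
  have h1 : ∀ v w, fderiv ℝ (fun z => Gam G z v w) y u = fderiv ℝ (Gam G) y u v w := fun v w => by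
    rw [fderiv_bilin_apply (hG.differentiableAt_Gam hy) (differentiableAt_const v)
      (differentiableAt_const w)]
    simp
  rw [← h1, ← h1, fderiv_congr_on hG.isOpen (fun z hz => hG.Gam_symm hz v w) hy]

theorem curv_bianchi {y : E} (hy : y ∈ U) (u v w : E) :
    curv (Gam G) y u v w + curv (Gam G) y v w u + curv (Gam G) y w u v = 0 := by
  simp only [curv]
  rw [hG.fderiv_Gam_symm hy u v w, hG.fderiv_Gam_symm hy v u w, hG.fderiv_Gam_symm hy w v u,
    hG.Gam_symm hy v w, hG.Gam_symm hy u w, hG.Gam_symm hy v u]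
  abel

/-- For constant w and z the second derivative of G(w, z) is symmetric. Expanded by metric
compatibility, its skew part is G(R(u, v)w, z) + G(w, R(u, v)z). -/
theorem curv_skew {y : E} (hy : y ∈ U) (u v w z : E) :
    G y (curv (Gam G) y u v w) z = - G y w (curv (Gam G) y u v z) := by
  have hs : ContDiffAt ℝ ∞ (fun x => G x w z) y :=
    ((hG.smooth y hy).clm_apply contDiffAt_const).clm_apply contDiffAt_const
  have hΓ : ∀ v w, DifferentiableAt ℝ (fun x => Gam G x v w) y := fun v w =>
    ((hG.differentiableAt_Gam hy).clm_apply (differentiableAt_const v)).clm_apply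
      (differentiableAt_const w)
  have hΓd : ∀ u v w, fderiv ℝ (fun x => Gam G x v w) y u = fderiv ℝ (Gam G) y u v w :=
    fun u v w => by
      rw [fderiv_bilin_apply (hG.differentiableAt_Gam hy) (differentiableAt_const v)
        (differentiableAt_const w)]
      simp
  have key : ∀ u v, fderiv ℝ (fderiv ℝ (fun x => G x w z)) y u v
      = G y (fderiv ℝ (Gam G) y u v w + Gam G y u (Gam G y v w)) z
        + G y (Gam G y v w) (Gam G y u z) + (G y (Gam G y u w) (Gam G y v z)
        + G y w (fderiv ℝ (Gam G) y u v z + Gam G y u (Gam G y v z))) := by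
    intro u v
    rw [← fderiv_clm_apply_const ((contDiffAt_fderiv hs).differentiableAt (by simp)) u v]
    have : ∀ x ∈ U, fderiv ℝ (fun x => G x w z) x v
        = G x (Gam G x v w) z + G x w (Gam G x v z) := fun x hx => by
      rw [hG.fderiv_inner hx (differentiableAt_const w) (differentiableAt_const z)]
      simp
    have hd : ∀ X Y : E → E, DifferentiableAt ℝ X y → DifferentiableAt ℝ Y y →
        DifferentiableAt ℝ (fun x => G x (X x) (Y x)) y := fun X Y hX hY =>
      ((hG.differentiableAt hy).clm_apply hX).clm_apply hY
    rw [fderiv_congr_on hG.isOpen this hy, fderiv_fun_add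
      (hd _ _ (hΓ v w) (differentiableAt_const z)) (hd _ _ (differentiableAt_const w) (hΓ v z))]
    rw [add_apply, hG.fderiv_inner hy (hΓ v w) (differentiableAt_const z),
      hG.fderiv_inner hy (differentiableAt_const w) (hΓ v z), hΓd, hΓd]
    simp
  have h := fderiv_fderiv_comm hs u v
  rw [key, key] at h
  simp only [curv, map_add, map_sub, add_apply, sub_apply] at h ⊢
  linarith

/-- The octahedron argument: four Bianchi identities combined with skew symmetry in each pair. -/
theorem curv_pair {y : E} (hy : y ∈ U) (u v w z : E) :
    G y (curv (Gam G) y u v w) z = G y (curv (Gam G) y w z u) v := by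
  have B : ∀ a b c d, G y (curv (Gam G) y a b c) d + G y (curv (Gam G) y b c a) d
      + G y (curv (Gam G) y c a b) d = 0 := fun a b c d => by
    have := congrArg (fun t => G y t d) (hG.curv_bianchi hy a b c)
    simpa using this
  have S : ∀ a b c d, G y (curv (Gam G) y a b c) d = - G y (curv (Gam G) y a b d) c :=
    fun a b c d => by rw [hG.curv_skew hy, hG.symm y hy]
  have A : ∀ a b c d, G y (curv (Gam G) y a b c) d = - G y (curv (Gam G) y b a c) d :=
    fun a b c d => by rw [curv_swap]; simp
  linarith [B u v w z, B v w z u, B w z u v, B z u v w, S u v w z, S v w u z, S w u v z,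
    S v w z u, S w z v u, S z v w u, S w z u v, S z u w v, S u w z v, S z u v w, S u v z w, S v z u w,
    A u w v z, A v z w u, A z v w u, A u w z v, A w u z v, A w u v z, A v z u w, A z v u w]

end IsMetricOn

end LeviCivita

end ContactChen

namespace ContactChen

/-! ### Linear algebra of the 1-jet and 2-jet of a contact metric structure at a point. -/

section PointwiseAlgebra

variable {E : Type*} [NormedAddCommGroup E] [NormedSpace ℝ E]

/-- An almost contact metric structure on a vector space; the one-form is `g · ξ`. -/
structure AlmostContactAt (g : E →L[ℝ] E →L[ℝ] ℝ) (φ : E →L[ℝ] E) (ξ : E) : Prop where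
  symm : ∀ u v, g u v = g v u
  pos : ∀ u, u ≠ 0 → 0 < g u u
  φ_sq : ∀ v, φ (φ v) = -v + g v ξ • ξ
  unit : g ξ ξ = 1
  φ_ξ : φ ξ = 0
  skew : ∀ u v, g u (φ v) = -g (φ u) v

namespace AlmostContactAt

variable {g : E →L[ℝ] E →L[ℝ] ℝ} {φ : E →L[ℝ] E} {ξ : E} (hA : AlmostContactAt g φ ξ)
include hA

theorem ext {u v : E} (h : ∀ w, g u w = g v w) : u = v := by
  by_contra hne
  have := hA.pos (u - v) (sub_ne_zero.2 hne)
  have h' := h (u - v)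
  rw [map_sub g] at this
  change 0 < g u (u - v) - g v (u - v) at this
  linarith

theorem φ_perp (v : E) : g (φ v) ξ = 0 := by
  have := hA.skew v ξ
  rw [hA.φ_ξ, map_zero] at this
  linarith

theorem φ_sq_of_perp {v : E} (hv : g v ξ = 0) : φ (φ v) = -v := by
  rw [hA.φ_sq, hv, zero_smul, add_zero]

theorem perp_part (v : E) : g (v - g v ξ • ξ) ξ = 0 := by
  simp [hA.unit]

end AlmostContactAt

/-- The first covariant derivatives `B = ∇ ξ` and `T = ∇ φ` of a contact metric structure at a
point satisfy these identities. -/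
structure ContactJetAt (g : E →L[ℝ] E →L[ℝ] ℝ) (φ : E →L[ℝ] E) (ξ : E) (B : E →L[ℝ] E)
    (T : E →L[ℝ] E →L[ℝ] E) : Prop extends AlmostContactAt g φ ξ where
  contact : ∀ u v, g (B u) v - g (B v) u = 2 * g u (φ v)
  B_perp : ∀ u, g (B u) ξ = 0
  T_φ : ∀ u v, T u (φ v) + φ (T u v) = g (B u) v • ξ + g v ξ • B u
  T_skew : ∀ u v w, g (T u v) w = - g v (T u w)
  T_ξ : ∀ u, T u ξ = - φ (B u)
  -- Closedness of the fundamental form, which holds because Φ = dη.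
  cyclic : ∀ u v w, g v (T u w) + g w (T v u) + g u (T w v) = 0

namespace ContactJetAt

variable {g : E →L[ℝ] E →L[ℝ] ℝ} {φ : E →L[ℝ] E} {ξ : E} {B : E →L[ℝ] E}
  {T : E →L[ℝ] E →L[ℝ] E} (hJ : ContactJetAt g φ ξ B T)
include hJ

theorem B_ξ : B ξ = 0 := by
  refine hJ.ext fun w => ?_
  have h1 := hJ.contact ξ w
  rw [hJ.B_perp, hJ.symm ξ, hJ.φ_perp] at h1
  simpa using h1

/-- This is `cyclic` with one slot equal to ξ, where T is known through `T_ξ`. -/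
theorem B_φ_comm (v w : E) : g v (T ξ w) = g (B w) (φ v) - g (B v) (φ w) := by
  have h1 := hJ.cyclic ξ v w
  rw [hJ.T_ξ, map_neg, hJ.skew] at h1
  have h2 := hJ.T_skew w ξ v
  rw [hJ.T_ξ, map_neg, neg_apply, hJ.symm _ v, hJ.skew] at h2
  rw [hJ.symm (B w), hJ.symm (B v)]
  linarith

/-- The form g(φv, (∇_ξ φ)w) is skew in v, w, because ∇_ξ φ is skew and anticommutes with φ; it is
symmetric by `B_φ_comm` and the contact condition. So it vanishes, and only the ξ-component of ∇_ξ φ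
is left, which is zero since Bξ = 0. -/
theorem T_of_ξ : T ξ = 0 := by
  have hφ : ∀ v w, g (φ v) (T ξ w) = 0 := by
    intro v w
    have e1 : ∀ v w, g (φ v) (T ξ w) = - g (B w) v - g (B (φ v)) (φ w) := fun v w => by
      rw [hJ.B_φ_comm, hJ.φ_sq]
      simp only [map_add, map_neg, map_smul, hJ.B_perp]
      simp
    have e2 : g (φ v) (T ξ w) = - g (φ w) (T ξ v) := by
      have h1 := hJ.skew v (T ξ w)
      have h2 := hJ.T_φ ξ w
      rw [hJ.B_ξ] at h2
      have h3 : T ξ (φ w) = - φ (T ξ w) := by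
        rw [eq_neg_iff_add_eq_zero, h2]
        simp
      have h4 := hJ.T_skew ξ v (φ w)
      rw [h3, map_neg, hJ.symm] at h4
      linarith
    have h1 := hJ.contact w v
    have h2 := hJ.contact (φ v) (φ w)
    have h3 := hJ.φ_sq w
    rw [h3] at h2
    simp only [map_add, map_neg, map_smul, hJ.φ_perp] at h2
    have h4 := hJ.symm (φ v) w
    have h5 := e1 v w
    have h6 := e1 w v
    simp only [smul_eq_mul, mul_zero, add_zero] at h2
    linarith
  ext w
  refine hJ.ext fun v => ?_
  have h1 := hφ (φ v) w
  rw [hJ.φ_sq] at h1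
  simp only [map_add, map_neg, map_smul, add_apply, neg_apply, smul_apply, smul_eq_mul] at h1
  have h2 := hJ.T_skew ξ ξ w
  rw [hJ.T_ξ, hJ.B_ξ] at h2
  simp only [map_zero, neg_zero, zero_apply] at h2
  have h3 : g ξ (T ξ w) = 0 := by linarith
  rw [h3] at h1
  rw [hJ.symm]
  simp only [zero_apply, map_zero]
  linarith

/-- The contact condition says that the skew part of ∇ξ is -φ; adding φ leaves the symmetric part.
-/
theorem S_symm (u v : E) : g (B u + φ u) v = g u (B v + φ v) := by
  have h1 := hJ.contact u v
  have h2 := hJ.skew u v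
  have h3 := hJ.symm (B v) u
  simp only [map_add, add_apply]
  linarith

/-- Once ∇_ξ φ = 0, `B_φ_comm` says that g(Bw, φv) is symmetric in v and w; in terms of S this is
anticommutation with φ. -/
theorem S_φ (u : E) : B (φ u) + φ (φ u) = - φ (B u + φ u) := by
  refine hJ.ext fun v => ?_
  have h1 := hJ.S_symm (φ u) v
  have h2 := hJ.B_φ_comm u v
  have h3 := hJ.skew (B u + φ u) v
  have h4 := hJ.symm (B v) (φ u)
  rw [hJ.T_of_ξ] at h2
  simp only [map_add, add_apply, zero_apply, map_zero, map_neg, neg_apply] at h1 h2 h3 ⊢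
  linarith

theorem S_ξ : B ξ + φ ξ = 0 := by
  rw [hJ.B_ξ, hJ.φ_ξ, add_zero]

theorem S_perp (u : E) : g (B u + φ u) ξ = 0 := by
  rw [hJ.S_symm, hJ.S_ξ, map_zero]

/-- The left side is L_ξ φ written with a torsion-free connection, so this is what identifies h'
with φS. -/
theorem two_φS (u : E) : T ξ u - B (φ u) + φ (B u) = (2 : ℝ) • φ (B u + φ u) := by
  have h := hJ.S_φ u
  rw [hJ.T_of_ξ, eq_sub_of_add_eq h]
  simp only [map_add, zero_apply, two_smul]
  abel

/-- With τ(u, v, w) = g(v, T u w) restricted to ξ^⊥ in v and w, the derivative of φ² = -1 + η ⊗ ξ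
lets φ move between the last two slots. The next lemma also lets it move into the first one. -/
theorem τ_φ_right {u v w : E} (hv : g v ξ = 0) (hw : g w ξ = 0) :
    g (φ v) (T u w) = g v (T u (φ w)) := by
  have h1 := hJ.skew v (T u w)
  have h2 := congrArg (g v) (hJ.T_φ u w)
  simp only [map_add, map_smul, hv, hw, smul_eq_mul] at h2
  linarith

theorem τ_φ_left {u v w : E} (hu : g u ξ = 0) (hv : g v ξ = 0) (hw : g w ξ = 0) :
    g v (T (φ u) w) = g v (T u (φ w)) := by
  have p := hJ.φ_perp
  have q : ∀ {x}, g x ξ = 0 → φ (φ x) = -x := fun h => hJ.φ_sq_of_perp h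
  -- As for almost Kähler structures: combine closedness at (u, v, w), (φu, φv, w), (u, φv, φw) and
  -- (φu, v, φw).
  have key : ∀ {u v w : E}, g u ξ = 0 → g v ξ = 0 → g w ξ = 0 →
      g (φ v) (T (φ u) w) = - g v (T u w) := by
    intro u v w hu hv hw
    have c1 := hJ.cyclic u v w
    have c2 := hJ.cyclic (φ u) (φ v) w
    have c3 := hJ.cyclic u (φ v) (φ w)
    have c4 := hJ.cyclic (φ u) v (φ w)
    have a2 : g (φ u) (T w (φ v)) = - g u (T w v) := by
      rw [hJ.τ_φ_right hu (p v), q hv, map_neg, map_neg]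
    have a3 : g (φ v) (T u (φ w)) = - g v (T u w) := by
      rw [hJ.τ_φ_right hv (p w), q hw, map_neg, map_neg]
    have a4 : g (φ w) (T v (φ u)) = - g w (T v u) := by
      rw [hJ.τ_φ_right hw (p u), q hu, map_neg, map_neg]
    have b1 := hJ.τ_φ_right (u := φ u) hv hw
    have b2 := hJ.τ_φ_right (u := φ v) hw hu
    have b3 := hJ.τ_φ_right (u := φ w) hu hv
    linarith
  have h := key (p u) hv hw
  have h' := key hu (p v) hw
  rw [q hv] at h'
  simp only [map_neg, neg_apply] at h'
  rw [hJ.τ_φ_right hv hw] at h'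
  linarith

/-- Second order data: `C = ∇ S` for `S = ∇ ξ + φ`, on a contact metric structure whose
characteristic field belongs to a `(κ, μ)`-nullity distribution. -/
theorem S_sq {C : E →L[ℝ] E →L[ℝ] E} {κ μ : ℝ}
    (hC : ∀ u v, C u (φ v) + (B (T u v) + φ (T u v)) + T u (B v + φ v) + φ (C u v) = 0)
    (hCξ : ∀ u, C u ξ + (B (B u) + φ (B u)) = 0)
    (hN : ∀ u v, C u v - T u v - (C v u - T v u) = κ • (g v ξ • u - g u ξ • v)
      + μ • (g v ξ • φ (B u + φ u) - g u ξ • φ (B v + φ v))) {u : E} (hu : g u ξ = 0) :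
    B (B u + φ u) + φ (B u + φ u) = (1 - κ) • u := by
  -- The nullity identity at (u, ξ) determines ∇_ξ S on ξ^⊥.
  have L : ∀ u, g u ξ = 0 → C ξ u = (1 - κ) • u - (B (B u + φ u) + φ (B u + φ u))
      - μ • φ (B u + φ u) := by
    intro u hu
    have h1 := hN u ξ
    rw [hJ.T_of_ξ, hu, hJ.unit, hJ.T_ξ, eq_neg_of_add_eq_zero_left (hCξ u)] at h1
    have h2 := hJ.S_φ u
    have h3 := hJ.φ_sq_of_perp hu
    rw [h3] at h2
    simp only [zero_apply, sub_zero, one_smul, zero_smul] at h1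
    have h4 : B (φ u) = u - φ (B u) - φ (φ u) := by
      rw [map_add] at h2
      linear_combination (norm := module) h2
    rw [h3] at h4
    simp only [map_add, h3, h4, smul_add, sub_smul, one_smul] at h1 ⊢
    linear_combination (norm := module) -h1
  have h0 := hC ξ u
  rw [hJ.T_of_ξ] at h0
  simp only [zero_apply, map_zero, add_zero] at h0
  rw [L u hu, L (φ u) (hJ.φ_perp u)] at h0
  have s1 : ∀ x, B (φ x) = -φ (B x + φ x) - φ (φ x) := fun x => eq_sub_of_add_eq (hJ.S_φ x)
  set w := B u + φ u with hw
  have hwp : g w ξ = 0 := hJ.S_perp u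
  have s2 : B (φ u) + φ (φ u) = - φ w := hJ.S_φ u
  rw [s2] at h0
  set z := B w + φ w with hz
  have s3 : B (φ w) + φ (φ w) = - φ z := hJ.S_φ w
  have s3' : B (φ w) = - φ z - φ (φ w) := eq_sub_of_add_eq s3
  -- Since ∇_ξ φ = 0, the operator ∇_ξ S anticommutes with φ. In the formula for ∇_ξ S the μ-term φS
  -- anticommutes with φ and drops out, while 1 - κ - S² commutes with it and is therefore counted
  -- twice.
  have h5 : φ ((1 - κ) • u - z) = 0 := by
    have : (2 : ℝ) • φ ((1 - κ) • u - z) = 0 := by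
      simp only [map_sub, map_neg, map_smul, s3'] at h0 ⊢
      rw [← h0]
      module
    simpa using this
  have h6 := hJ.φ_sq ((1 - κ) • u - z)
  have hzp : g z ξ = 0 := hJ.S_perp w
  rw [h5] at h6
  simp only [map_zero, map_sub, map_smul, sub_apply, smul_apply, hu, hzp] at h6
  simp only [smul_zero, sub_zero, zero_smul, add_zero] at h6
  have h7 := neg_eq_zero.1 h6.symm
  exact (sub_eq_zero.1 h7).symm

/-- On ξ^⊥ the Codazzi defect of C = ∇S equals τ (`N` below). If κ = 1 then C = 0 and τ vanishes at
once. Otherwise τ vanishes when its first slot lies in the image of φS, and φS is invertible on ξ^⊥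
because (φS)² = S² = 1 - κ there. -/
theorem τ_eq_zero {C : E →L[ℝ] E →L[ℝ] E} {κ μ : ℝ}
    (hC : ∀ u v, C u (φ v) + (B (T u v) + φ (T u v)) + T u (B v + φ v) + φ (C u v) = 0)
    (hCs : ∀ u v w, g (C u v) w = g v (C u w))
    (hCξ : ∀ u, C u ξ + (B (B u) + φ (B u)) = 0)
    (hN : ∀ u v, C u v - T u v - (C v u - T v u) = κ • (g v ξ • u - g u ξ • v)
      + μ • (g v ξ • φ (B u + φ u) - g u ξ • φ (B v + φ v)))
    (hκ : κ = 1 → C = 0) {x y z : E} (hx : g x ξ = 0) (hy : g y ξ = 0) (hz : g z ξ = 0) :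
    g y (T x z) = 0 := by
  have N : ∀ {u v : E} (w : E), g u ξ = 0 → g v ξ = 0 →
      g (C u v) w - g (C v u) w = g u (T w v) := by
    intro u v w hu hv
    have h1 := congrArg (fun t => g t w) (hN u v)
    simp only [hu, hv, map_sub, map_add, zero_smul, sub_zero, smul_zero, add_zero,
      map_zero, zero_apply, sub_apply] at h1
    have h2 := hJ.cyclic w u v
    have h3 := hJ.T_skew u v w
    have h4 := hJ.symm (T v u) w
    linarith
  by_cases hk : κ = 1
  · have := N x hy hz
    rw [hκ hk] at this
    simpa using this.symm
  have main : ∀ {x y z : E}, g x ξ = 0 → g y ξ = 0 → g z ξ = 0 →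
      g y (T (φ (B x + φ x)) z) = 0 := by
    intro x y z hx hy hz
    -- The defect is taken at (y, z) and (φy, φz) against x, and at (y, φz) and (φy, z) against φx.
    -- The derivative of Sφ + φS = 0 and the symmetry of C eliminate all C-terms; what is left is a
    -- combination of τ-terms with one factor S, and these reduce to a multiple of τ(φSx, y, z).
    have p := hJ.φ_perp
    have Cφ : ∀ u v w, g (C u (φ v)) w = g (C u v) (φ w) + g v (T u (B w + φ w))
        + g (B v + φ v) (T u w) := by
      intro u v w
      have h1 := congrArg (fun t => g t w) (hC u v)
      have h2 := hJ.S_symm (T u v) w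
      have h3 := hJ.T_skew u v (B w + φ w)
      have h4 := hJ.T_skew u (B v + φ v) w
      have h5 := hJ.skew (C u v) w
      simp only [map_add, add_apply, map_zero, zero_apply] at h1 h2 h3 h4 ⊢
      linarith
    have n1 := N x hy hz
    have n2 := N x (p y) (p z)
    have n3 := N (φ x) hy (p z)
    have n4 := N (φ x) (p y) hz
    have cs : ∀ u v w, g (C u v) w = g (C u w) v := fun u v w => by rw [hCs, hJ.symm]
    have k1 := Cφ y z (φ x)
    have k2 := Cφ (φ y) z x
    have k3 := Cφ z y (φ x)
    have k4 := Cφ (φ z) y x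
    have ha : g (φ (B x + φ x)) ξ = 0 := p _
    have hSp := hJ.S_perp
    have t1 : g (φ y) (T x (φ z)) = - g y (T x z) := by
      rw [hJ.τ_φ_right hy (p z), hJ.φ_sq_of_perp hz, map_neg, map_neg]
    have t2 := hJ.τ_φ_right (u := φ x) hy hz
    have t2' : g y (T (φ x) (φ z)) = - g y (T x z) := by
      rw [hJ.τ_φ_left hx hy (p z), hJ.φ_sq_of_perp hz, map_neg, map_neg]
    have e1 : B (φ x) + φ (φ x) = - φ (B x + φ x) := hJ.S_φ x
    rw [e1, hJ.φ_sq_of_perp hx] at k1 k3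
    have r1 := hJ.τ_φ_left hy hz (hSp x)
    have r2 := hJ.τ_φ_left hz hy (hSp x)
    have r3 := hJ.τ_φ_left hy (hSp z) hx
    have r4 := hJ.τ_φ_left hz (hSp y) hx
    have cyc := hJ.cyclic (φ (B x + φ x)) y z
    have sk := hJ.T_skew z y (φ (B x + φ x))
    have sy := hJ.symm (T z y) (φ (B x + φ x))
    simp only [map_neg] at k1 k3
    -- All identities are linear in the values of g on C and T.
    linarith
  have h1 := main (x := φ (B x + φ x)) (hJ.φ_perp _) hy hz
  have h2 := hJ.S_φ (B x + φ x)
  have h3 := hJ.S_sq hC hCξ hN hx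
  rw [h2, h3, map_neg, map_smul, map_smul, hJ.φ_sq_of_perp hx] at h1
  simp only [map_smul, smul_apply, smul_eq_mul, smul_neg, neg_neg] at h1
  rcases mul_eq_zero.1 h1 with h | h
  · exact absurd (by linarith) hk
  · exact h

/-- Split v and the test vector into ξ^⊥ and ξ components: the purely horizontal part is zero by
`τ_eq_zero`, and the rest is determined by ∇_ξ φ = 0, by (∇_u φ)ξ = -φBu and by skewness. -/
theorem T_eq {C : E →L[ℝ] E →L[ℝ] E} {κ μ : ℝ}
    (hC : ∀ u v, C u (φ v) + (B (T u v) + φ (T u v)) + T u (B v + φ v) + φ (C u v) = 0)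
    (hCs : ∀ u v w, g (C u v) w = g v (C u w))
    (hCξ : ∀ u, C u ξ + (B (B u) + φ (B u)) = 0)
    (hN : ∀ u v, C u v - T u v - (C v u - T v u) = κ • (g v ξ • u - g u ξ • v)
      + μ • (g v ξ • φ (B u + φ u) - g u ξ • φ (B v + φ v)))
    (hκ : κ = 1 → C = 0) (u v : E) :
    T u v = g (φ (B u)) v • ξ - g v ξ • φ (B u) := by
  refine hJ.ext fun z => ?_
  have h := hJ.τ_eq_zero hC hCs hCξ hN hκ (hJ.perp_part u) (hJ.perp_part z) (hJ.perp_part v)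
  have h1 := hJ.T_skew u ξ v
  have h2 := hJ.T_skew u z ξ
  simp only [map_sub, map_smul, sub_apply, smul_apply, smul_eq_mul, hJ.T_of_ξ, hJ.T_ξ, map_neg,
    neg_apply, sub_zero, smul_zero, hJ.φ_perp, mul_zero, smul_neg,
    hJ.symm ξ (φ _)] at h h1 h2 ⊢
  have h3 := hJ.symm (T u v) z
  have h4 := hJ.symm (φ (B u)) z
  have h5 := hJ.symm ξ z
  rw [h5, h4]
  rw [h3]
  linear_combination h + g z ξ * h1
end ContactJetAt

end PointwiseAlgebra

end ContactChen

namespace ContactChen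

/-! ### Algebraic curvature tensors of Kähler type. -/

section CurvatureLike

variable {E : Type*} [NormedAddCommGroup E] [NormedSpace ℝ E]

/-- A `4`-tensor with the symmetries of a Riemannian curvature tensor. -/
structure IsCurvatureLike (R : E → E → E → E → ℝ) : Prop where
  add : ∀ u u' v w z, R (u + u') v w z = R u v w z + R u' v w z
  smul : ∀ (a : ℝ) u v w z, R (a • u) v w z = a * R u v w z
  swap : ∀ u v w z, R u v w z = - R v u w z
  pair : ∀ u v w z, R u v w z = R w z u v
  bianchi : ∀ u v w z, R u v w z + R v w u z + R w u v z = 0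

namespace IsCurvatureLike

variable {R R' : E → E → E → E → ℝ}

theorem sub (h : IsCurvatureLike R) (h' : IsCurvatureLike R') :
    IsCurvatureLike fun u v w z => R u v w z - R' u v w z where
  add u u' v w z := by rw [h.add, h'.add]; ring
  smul a u v w z := by rw [h.smul, h'.smul]; ring
  swap u v w z := by rw [h.swap u v, h'.swap u v]; ring
  pair u v w z := by rw [h.pair u v, h'.pair u v]
  bianchi u v w z := by linarith [h.bianchi u v w z, h'.bianchi u v w z]

variable (h : IsCurvatureLike R)
include h

theorem swap' (u v w z : E) : R u v w z = - R u v z w := by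
  rw [h.pair, h.swap, h.pair]

theorem add₂ (u v v' w z : E) : R u (v + v') w z = R u v w z + R u v' w z := by
  rw [h.swap, h.add, h.swap v, h.swap v']; ring

theorem add₃ (u v w w' z : E) : R u v (w + w') z = R u v w z + R u v w' z := by
  rw [h.pair, h.add, h.pair w, h.pair w']

theorem add₄ (u v w z z' : E) : R u v w (z + z') = R u v w z + R u v w z' := by
  rw [h.pair, h.add₂, h.pair w, h.pair w]

theorem smul₂ (a : ℝ) (u v w z : E) : R u (a • v) w z = a * R u v w z := by
  rw [h.swap, h.smul, h.swap v]; ring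

theorem smul₃ (a : ℝ) (u v w z : E) : R u v (a • w) z = a * R u v w z := by
  rw [h.pair, h.smul, h.pair w]

theorem smul₄ (a : ℝ) (u v w z : E) : R u v w (a • z) = a * R u v w z := by
  rw [h.pair, h.smul₂, h.pair w]

theorem neg₁ (u v w z : E) : R (-u) v w z = - R u v w z := by
  rw [← neg_one_smul ℝ u, h.smul]; ring

theorem neg₂ (u v w z : E) : R u (-v) w z = - R u v w z := by
  rw [← neg_one_smul ℝ v, h.smul₂]; ring

theorem neg₃ (u v w z : E) : R u v (-w) z = - R u v w z := by
  rw [← neg_one_smul ℝ w, h.smul₃]; ring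

theorem neg₄ (u v w z : E) : R u v w (-z) = - R u v w z := by
  rw [← neg_one_smul ℝ z, h.smul₄]; ring

/-- A curvature-like tensor of Kähler type with vanishing holomorphic sectional curvature has
vanishing sectional curvature. -/
theorem sectional_eq_zero_of_kaehler {V : Submodule ℝ E} {φ : E → E} (hφV : ∀ u ∈ V, φ u ∈ V)
    (hφadd : ∀ u v, φ (u + v) = φ u + φ v)
    (hφφ : ∀ u ∈ V, φ (φ u) = -u)
    (hK : ∀ u ∈ V, ∀ v ∈ V, ∀ w ∈ V, ∀ z ∈ V, R u v (φ w) z = - R u v w (φ z))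
    (h0 : ∀ u ∈ V, R u (φ u) (φ u) u = 0) {u v : E} (hu : u ∈ V) (hv : v ∈ V) :
    R u v v u = 0 := by
  have hneg : ∀ u, φ (-u) = - φ u := fun u => by
    have h0 : φ 0 = 0 := by
      have := hφadd 0 0
      rw [add_zero] at this
      exact (left_eq_add.1 this)
    have := hφadd u (-u)
    rw [add_neg_cancel, h0] at this
    exact eq_neg_of_add_eq_zero_right this.symm
  have K2 : ∀ u ∈ V, ∀ v ∈ V, ∀ w ∈ V, ∀ z ∈ V, R u v (φ w) (φ z) = R u v w z := by
    intro u hu v hv w hw z hz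
    rw [hK u hu v hv w hw (φ z) (hφV z hz), hφφ z hz, h.neg₄, neg_neg]
  have K1 : ∀ u ∈ V, ∀ v ∈ V, ∀ w ∈ V, ∀ z ∈ V, R (φ u) v w z = - R u (φ v) w z := by
    intro u hu v hv w hw z hz
    rw [h.pair, hK w hw z hz u hu v hv, h.pair]
  have main : ∀ u ∈ V, ∀ v ∈ V, 3 * R u (φ v) u (φ v) + R u v u v = 0 := by
    intro u hu v hv
    have hu' := hφV u hu
    have hv' := hφV v hv
    -- The sum of the two quartic expressions keeps the terms of bidegree (2, 2) in u, v; Bianchi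
    -- and the Kähler identities reduce these to two sectional values.
    have p1 := h0 (u + v) (V.add_mem hu hv)
    have p2 := h0 (u + -v) (V.add_mem hu (V.neg_mem hv))
    have q1 := h0 u hu
    have q2 := h0 v hv
    simp only [hφadd, hneg, h.add, h.add₂, h.add₃, h.add₄, h.neg₁, h.neg₂, h.neg₃, h.neg₄] at p1 p2
    have b := h.bianchi u (φ u) v (φ v)
    -- the six mixed terms
    have m1 : R u (φ v) (φ u) v = - R u (φ v) u (φ v) := by rw [hK u hu _ hv' u hu v hv]
    have m2 : R v (φ u) (φ u) v = - R u (φ v) u (φ v) := by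
      rw [h.swap, K1 u hu v hv _ hu' v hv, m1]; ring
    have m3 : R v (φ u) (φ v) u = - R u (φ v) u (φ v) := by
      rw [h.swap' v (φ u), h.swap v (φ u), K1 u hu v hv u hu _ hv']; ring
    have m4 : R u (φ v) (φ v) u = - R u (φ v) u (φ v) := h.swap' _ _ _ _
    have m5 : R u (φ u) (φ v) v = - R u (φ u) v (φ v) := h.swap' _ _ _ _
    have m6 : R v (φ v) (φ u) u = - R u (φ u) v (φ v) := by
      rw [h.pair v, h.swap]
    have n1 : R (φ u) v u (φ v) = - R u (φ v) u (φ v) := K1 u hu v hv u hu _ hv'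
    have n2 : R v u (φ u) (φ v) = - R u v u v := by
      rw [K2 v hv u hu u hu v hv, h.swap]
    linarith
  -- Exchanging v and φv gives 3a + b = 0 and 3b + a = 0, hence both sectional values are zero.
  have e1 := main u hu v hv
  have e2 := main u hu (φ v) (hφV v hv)
  rw [hφφ v hv, h.neg₂, h.neg₄, neg_neg] at e2
  have e3 := h.swap' u v v u
  linarith

/-- By the symmetries a tensor that kills ξ in the third slot kills it in every slot, so u and v may
be replaced by their projections to ξ^⊥, where φ is a complex structure. -/
theorem sectional_eq_zero {g : E →L[ℝ] E →L[ℝ] ℝ} {φ : E →L[ℝ] E} {ξ : E}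
    (hA : AlmostContactAt g φ ξ)
    (hK : ∀ u v w z, g u ξ = 0 → g v ξ = 0 → g w ξ = 0 → g z ξ = 0 →
      R u v (φ w) z = - R u v w (φ z))
    (h0 : ∀ u, g u ξ = 0 → R u (φ u) (φ u) u = 0)
    (hξ : ∀ u v w, R u v ξ w = 0) (u v : E) : R u v v u = 0 := by
  let V : Submodule ℝ E := LinearMap.ker ((g.flip ξ : E →L[ℝ] ℝ) : E →ₗ[ℝ] ℝ)
  have hV : ∀ u, u ∈ V ↔ g u ξ = 0 := fun u => by simp [V]
  have key := h.sectional_eq_zero_of_kaehler (V := V) (φ := φ)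
    (fun u _ => (hV _).2 (hA.φ_perp u)) (fun u v => map_add _ u v)
    (fun u hu => hA.φ_sq_of_perp ((hV u).1 hu))
    (fun u hu v hv w hw z hz => hK u v w z ((hV u).1 hu) ((hV v).1 hv) ((hV w).1 hw) ((hV z).1 hz))
    (fun u hu => h0 u ((hV u).1 hu)) ((hV _).2 (hA.perp_part u)) ((hV _).2 (hA.perp_part v))
  have x4 : ∀ u v w, R u v w ξ = 0 := fun u v w => by rw [h.swap', hξ, neg_zero]
  have x1 : ∀ u v w, R ξ u v w = 0 := fun u v w => by rw [h.pair, hξ]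
  have x2 : ∀ u v w, R u ξ v w = 0 := fun u v w => by rw [h.pair, x4]
  set u₀ := u - g u ξ • ξ with hu₀
  set v₀ := v - g v ξ • ξ with hv₀
  have eu : u = u₀ + g u ξ • ξ := by rw [hu₀, sub_add_cancel]
  have ev : v = v₀ + g v ξ • ξ := by rw [hv₀, sub_add_cancel]
  clear_value u₀ v₀
  rw [eu, ev]
  simp only [h.add, h.add₂, h.add₃, h.add₄, h.smul, h.smul₂, h.smul₃, h.smul₄, hξ, x1, x2, x4, key]
  ring

end IsCurvatureLike

end CurvatureLike

/-! ### The model curvature tensor of a (κ, μ)-contact space form. -/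

section Model

variable {E : Type*} [NormedAddCommGroup E] [NormedSpace ℝ E]

/-- The curvature tensor of a `(κ, μ)`-contact space form, for the tensors `S = φ h'` up to sign:
`h' = φ S` and `φ h' = - S`. -/
noncomputable def modelCurv (g : E →L[ℝ] E →L[ℝ] ℝ) (φ : E →L[ℝ] E) (ξ : E) (S : E →L[ℝ] E)
    (κ μ c : ℝ) (u v w z : E) : ℝ :=
  (c + 3) / 4 * (g v w * g u z - g u w * g v z)
  + (c - 1) / 4 * (g u (φ w) * g (φ v) z - g v (φ w) * g (φ u) z + 2 * (g u (φ v) * g (φ w) z))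
  + (c + 3 - 4 * κ) / 4 * (g u ξ * g w ξ * g v z - g v ξ * g w ξ * g u z
      + g u w * g v ξ * g z ξ - g v w * g u ξ * g z ξ)
  + (g v w * g (φ (S u)) z - g u w * g (φ (S v)) z + g (φ (S v)) w * g u z - g (φ (S u)) w * g v z)
  + 1 / 2 * (g (φ (S v)) w * g (φ (S u)) z - g (φ (S u)) w * g (φ (S v)) z
      + g (S u) w * g (S v) z - g (S v) w * g (S u) z)
  + (1 - μ) * (g u ξ * g w ξ * g (φ (S v)) z - g v ξ * g w ξ * g (φ (S u)) z
      + g (φ (S u)) w * g v ξ * g z ξ - g (φ (S v)) w * g u ξ * g z ξ)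

variable {g : E →L[ℝ] E →L[ℝ] ℝ} {φ : E →L[ℝ] E} {ξ : E} {S : E →L[ℝ] E} {κ μ c : ℝ}

theorem φS_symm (hA : AlmostContactAt g φ ξ) (hS : ∀ u v, g (S u) v = g u (S v))
    (hSφ : ∀ u, S (φ u) = - φ (S u)) (u v : E) : g (φ (S u)) v = g (φ (S v)) u := by
  have h1 := hA.skew (S u) v
  rw [hS, hSφ, map_neg, hA.symm] at h1
  linarith

theorem modelCurv_isCurvatureLike (hA : AlmostContactAt g φ ξ) (hS : ∀ u v, g (S u) v = g u (S v))
    (hSφ : ∀ u, S (φ u) = - φ (S u)) : IsCurvatureLike (modelCurv g φ ξ S κ μ c) := by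
  have sk : ∀ u v, g u (φ v) = - g (φ u) v := hA.skew
  have sk' : ∀ u v, g (φ u) v = - g (φ v) u := fun u v => by
    rw [hA.symm, hA.skew]
  have sH := φS_symm hA hS hSφ
  have sS : ∀ u v, g (S u) v = g (S v) u := fun u v => by rw [hS, hA.symm]
  refine ⟨?_, ?_, ?_, ?_, ?_⟩
  · intro u u' v w z
    simp only [modelCurv, map_add, add_apply]
    ring
  · intro a u v w z
    simp only [modelCurv, map_smul, smul_apply, smul_eq_mul]
    ring
  · intro u v w z
    simp only [modelCurv, sk]
    rw [sk' v u]
    ring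
  · intro u v w z
    simp only [modelCurv, sk]
    rw [hA.symm w u, hA.symm w v, hA.symm z u, hA.symm z v, sk' w u, sk' w v, sk' z u, sk' z v,
      sH w u, sH w v, sH z u, sH z v, sS w u, sS w v, sS z u, sS z v]
    ring
  · intro u v w z
    simp only [modelCurv, sk]
    rw [hA.symm w u, hA.symm w v, hA.symm v u, sk' w u, sk' w v, sk' v u,
      sH w u, sH w v, sH v u, sS w u, sS w v, sS v u]
    ring

theorem modelCurv_ξ (hA : AlmostContactAt g φ ξ) (hS : ∀ u v, g (S u) v = g u (S v))
    (hSξ : S ξ = 0) (u v w : E) :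
    modelCurv g φ ξ S κ μ c u v ξ w = g (κ • (g v ξ • u - g u ξ • v)
      + μ • (g v ξ • φ (S u) - g u ξ • φ (S v))) w := by
  have h1 : ∀ u, g (S u) ξ = 0 := fun u => by rw [hS, hSξ, map_zero]
  simp only [modelCurv, hA.φ_ξ, hA.φ_perp, hA.unit, h1, map_add, map_sub, map_smul,
    add_apply, sub_apply, smul_apply, smul_eq_mul, map_zero, zero_apply]
  ring

/-- The left side measures the failure of the Kähler identity on ξ^⊥. With ∇ξ = S - φ the right side
is the value that the Ricci identity for φ forces on the true curvature, so this failure cancels in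
the difference. -/
theorem modelCurv_φ (hA : AlmostContactAt g φ ξ) {u v w z : E} (hu : g u ξ = 0) (hv : g v ξ = 0)
    (hw : g w ξ = 0) (hz : g z ξ = 0) :
    modelCurv g φ ξ S κ μ c u v (φ w) z + modelCurv g φ ξ S κ μ c u v w (φ z)
      = g (φ (S v - φ v)) w * g (S u - φ u) z - g (S u - φ u) w * g (φ (S v - φ v)) z
        - (g (φ (S u - φ u)) w * g (S v - φ v) z - g (S v - φ v) w * g (φ (S u - φ u)) z) := by
  have sk : ∀ u v, g u (φ v) = - g (φ u) v := hA.skew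
  have q : ∀ {x}, g x ξ = 0 → φ (φ x) = -x := fun h => hA.φ_sq_of_perp h
  have qS : ∀ x y, g y ξ = 0 → g (φ (φ (S x))) y = - g (S x) y := fun x y hy => by
    rw [hA.φ_sq]
    simp [hA.symm ξ y, hy]
  simp only [modelCurv, hA.φ_perp, hu, hv, hw, hz, map_sub, sub_apply, sk, q hu, q hv, q hw,
    qS _ _ hw, qS _ _ hz, map_neg, neg_apply]
  ring

/-- The terms in S cancel because S anticommutes with φ; the square of g(u, u) accounts for vectors
that are not of unit length. -/
theorem modelCurv_φ_sectional (hA : AlmostContactAt g φ ξ)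
    (hSφ : ∀ u, S (φ u) = - φ (S u)) {u : E} (hu : g u ξ = 0) :
    modelCurv g φ ξ S κ μ c u (φ u) (φ u) u = c * g u u ^ 2 := by
  have sk : ∀ u v, g u (φ v) = - g (φ u) v := hA.skew
  have q : φ (φ u) = -u := hA.φ_sq_of_perp hu
  have qS : g (φ (φ (S u))) u = - g (S u) u := by
    rw [hA.φ_sq]
    simp [hA.symm ξ u, hu]
  have a1 : g (φ u) u = 0 := by
    have := hA.skew u u
    rw [hA.symm] at this
    linarith
  simp only [modelCurv, hA.φ_perp, hu, hSφ, map_neg, neg_apply, sk, q,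
    hA.φ_sq_of_perp (hA.φ_perp (S u)), qS, a1]
  ring

end Model

end ContactChen

namespace ContactChen

/-! ### Covariant derivatives of vector fields and endomorphism fields, and their Ricci identities.
-/

section CovariantDerivatives

variable {E : Type*} [NormedAddCommGroup E] [NormedSpace ℝ E]

/-- The covariant derivative of a vector field, as a field of endomorphisms. -/
noncomputable def covVec (Γ : E → E →L[ℝ] E →L[ℝ] E) (X : E → E) (y : E) : E →L[ℝ] E :=
  fderiv ℝ X y + (Γ y).flip (X y)

/-- The covariant derivative of a field of endomorphisms. -/
noncomputable def covEnd (Γ : E → E →L[ℝ] E →L[ℝ] E) (A : E → E →L[ℝ] E) (y : E) :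
    E →L[ℝ] E →L[ℝ] E :=
  fderiv ℝ A y + ((ContinuousLinearMap.compL ℝ E E E).flip (A y)).comp (Γ y)
    - (ContinuousLinearMap.compL ℝ E E E (A y)).comp (Γ y)

variable {Γ : E → E →L[ℝ] E →L[ℝ] E} {A A' : E → E →L[ℝ] E} {X : E → E} {y : E}

theorem covVec_apply (u : E) : covVec Γ X y u = fderiv ℝ X y u + Γ y u (X y) := rfl

theorem covEnd_apply (u v : E) :
    covEnd Γ A y u v = fderiv ℝ A y u v + Γ y u (A y v) - A y (Γ y u v) := rfl

theorem covEnd_comp (hA : DifferentiableAt ℝ A y) (hA' : DifferentiableAt ℝ A' y) (u v : E) :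
    covEnd Γ (fun z => (A z).comp (A' z)) y u v
      = covEnd Γ A y u (A' y v) + A y (covEnd Γ A' y u v) := by
  have h : fderiv ℝ (fun z => (A z).comp (A' z)) y u v
      = fderiv ℝ A y u (A' y v) + A y (fderiv ℝ A' y u v) := by
    rw [← fderiv_clm_apply_const (hA.clm_comp hA') u v]
    simp only [ContinuousLinearMap.comp_apply]
    rw [fderiv_clm_apply_apply hA (hA'.clm_apply (differentiableAt_const v)),
      fderiv_clm_apply_const hA']
  simp only [covEnd_apply, h, ContinuousLinearMap.comp_apply, map_add, map_sub]
  abel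

theorem covEnd_add (hA : DifferentiableAt ℝ A y) (hA' : DifferentiableAt ℝ A' y) (u v : E) :
    covEnd Γ (fun z => A z + A' z) y u v = covEnd Γ A y u v + covEnd Γ A' y u v := by
  simp only [covEnd_apply, fderiv_fun_add hA hA', add_apply, map_add]
  abel

theorem covEnd_zero : covEnd Γ (fun _ => (0 : E →L[ℝ] E)) y = 0 := by
  ext u v
  simp [covEnd_apply]

theorem covEnd_congr_on {U : Set E} (hU : IsOpen U) (h : ∀ z ∈ U, A z = A' z) (hy : y ∈ U) :
    covEnd Γ A y = covEnd Γ A' y := by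
  simp only [covEnd, h y hy, fderiv_congr_on hU h hy]

theorem fderiv_end_apply (hA : DifferentiableAt ℝ A y) (hX : DifferentiableAt ℝ X y) (u : E) :
    fderiv ℝ (fun z => A z (X z)) y u
      = covEnd Γ A y u (X y) + A y (covVec Γ X y u) - Γ y u (A y (X y)) := by
  rw [fderiv_clm_apply_apply hA hX]
  simp only [covEnd_apply, covVec_apply, map_add]
  abel

theorem fderiv_comm_apply {F : Type*} [NormedAddCommGroup F] [NormedSpace ℝ F]
    {A : E → E →L[ℝ] F} {X : E → E →L[ℝ] E} (u v : E) (hA : DifferentiableAt ℝ A y)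
    (hX : DifferentiableAt ℝ X y) :
    fderiv ℝ (fun z => A z (X z v)) y u = fderiv ℝ A y u (X y v) + A y (fderiv ℝ X y u v) := by
  rw [fderiv_clm_apply_apply hA (hX.clm_apply (differentiableAt_const v)),
    fderiv_clm_apply_const hX]

/-- The Ricci identity for vector fields. -/
theorem covEnd_covVec_comm (hΓ : DifferentiableAt ℝ Γ y) (hs : ∀ u v, Γ y u v = Γ y v u)
    (hX : ContDiffAt ℝ ∞ X y) (u v : E) :
    covEnd Γ (covVec Γ X) y u v - covEnd Γ (covVec Γ X) y v u = curv Γ y u v (X y) := by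
  have hX1 : DifferentiableAt ℝ X y := hX.differentiableAt (by simp)
  have hX2 : DifferentiableAt ℝ (fderiv ℝ X) y := (contDiffAt_fderiv hX).differentiableAt (by simp)
  have hflip : DifferentiableAt ℝ (fun z => (Γ z).flip (X z)) y :=
    ((ContinuousLinearMap.flipₗᵢ ℝ E E E).toContinuousLinearEquiv.differentiableAt.comp y
      hΓ).clm_apply hX1
  have key : ∀ u v, fderiv ℝ (covVec Γ X) y u v
      = fderiv ℝ (fderiv ℝ X) y u v + (fderiv ℝ Γ y u v (X y) + Γ y v (fderiv ℝ X y u)) := by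
    intro u v
    have hd : DifferentiableAt ℝ (covVec Γ X) y := hX2.add hflip
    rw [← fderiv_clm_apply_const hd u v]
    simp only [covVec_apply]
    rw [fderiv_fun_add (hX2.clm_apply (differentiableAt_const v))
      ((hΓ.clm_apply (differentiableAt_const v)).clm_apply hX1), add_apply,
      fderiv_clm_apply_const hX2, fderiv_bilin_apply hΓ (differentiableAt_const v) hX1]
    simp
  simp only [covEnd_apply, key, covVec_apply, curv, map_add]
  rw [fderiv_fderiv_comm hX u v, hs u v]
  abel

/-- The Ricci identity for fields of endomorphisms. -/
theorem covEnd_covEnd_comm (hΓ : DifferentiableAt ℝ Γ y)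
    (hA : ContDiffAt ℝ ∞ A y) (u v w : E) :
    covEnd Γ (fun z => covEnd Γ A z v) y u w - covEnd Γ (fun z => covEnd Γ A z u) y v w
      = curv Γ y u v (A y w) - A y (curv Γ y u v w) := by
  have hA1 : DifferentiableAt ℝ A y := hA.differentiableAt (by simp)
  have hA2 : DifferentiableAt ℝ (fderiv ℝ A) y := (contDiffAt_fderiv hA).differentiableAt (by simp)
  have hΓv : ∀ v, DifferentiableAt ℝ (fun z => Γ z v) y := fun v =>
    hΓ.clm_apply (differentiableAt_const v)
  have hd : ∀ v, DifferentiableAt ℝ (fun z => covEnd Γ A z v) y := fun v =>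
    ((hA2.clm_apply (differentiableAt_const v)).add ((hΓv v).clm_comp hA1)).sub
      (hA1.clm_comp (hΓv v))
  have key : ∀ u v w, fderiv ℝ (fun z => covEnd Γ A z v) y u w
      = fderiv ℝ (fderiv ℝ A) y u v w + (fderiv ℝ Γ y u v (A y w) + Γ y v (fderiv ℝ A y u w))
        - (fderiv ℝ A y u (Γ y v w) + A y (fderiv ℝ Γ y u v w)) := by
    intro u v w
    rw [← fderiv_clm_apply_const (hd v) u w]
    simp only [covEnd_apply]
    have d1 : DifferentiableAt ℝ (fun z => fderiv ℝ A z v w) y :=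
      (hA2.clm_apply (differentiableAt_const v)).clm_apply (differentiableAt_const w)
    have d2 : DifferentiableAt ℝ (fun z => Γ z v (A z w)) y :=
      (hΓv v).clm_apply (hA1.clm_apply (differentiableAt_const w))
    have d3 : DifferentiableAt ℝ (fun z => A z (Γ z v w)) y :=
      hA1.clm_apply ((hΓv v).clm_apply (differentiableAt_const w))
    rw [fderiv_fun_sub (d1.fun_add d2) d3, fderiv_fun_add d1 d2]
    simp only [sub_apply, add_apply]
    rw [fderiv_comm_apply u w (hΓv v) hA1, fderiv_comm_apply u w hA1 (hΓv v),
      fderiv_clm_apply_const hΓ, fderiv_clm_apply_const (hA2.clm_apply (differentiableAt_const v)),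
      fderiv_clm_apply_const hA2]
  simp only [covEnd_apply, key, curv, map_add, map_sub]
  rw [fderiv_fderiv_comm hA u v]
  abel

/-- Covariant differentiation for the Levi-Civita connection commutes with adjoints. -/
theorem IsMetricOn.covEnd_adjoint [FiniteDimensional ℝ E] {U : Set E}
    {G : E → E →L[ℝ] E →L[ℝ] ℝ} (hG : IsMetricOn U G) (hy : y ∈ U)
    (hA : DifferentiableAt ℝ A y) (hA' : DifferentiableAt ℝ A' y)
    (h : ∀ z ∈ U, ∀ v w, G z (A z v) w = G z v (A' z w)) (u v w : E) :
    G y (covEnd (Gam G) A y u v) w = G y v (covEnd (Gam G) A' y u w) := by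
  have h1 := congrArg (fun L => L u) (fderiv_congr_on hG.isOpen (fun z hz => h z hz v w) hy)
  rw [hG.fderiv_inner hy (hA.clm_apply (differentiableAt_const v)) (differentiableAt_const w),
    hG.fderiv_inner hy (differentiableAt_const v) (hA'.clm_apply (differentiableAt_const w)),
    fderiv_clm_apply_const hA, fderiv_clm_apply_const hA'] at h1
  have h2 := h y hy (Gam G y u v) w
  have h3 := h y hy v (Gam G y u w)
  simp only [covEnd_apply, map_add, map_sub, add_apply, sub_apply, fderiv_fun_const,
    Pi.zero_apply, zero_apply, map_zero] at h1 ⊢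
  linarith

end CovariantDerivatives

/-! ### Contact metric structures on a coordinate domain and their first covariant derivatives. -/

section ContactFields

variable {E : Type*} [NormedAddCommGroup E] [NormedSpace ℝ E]

/-- A smooth almost contact metric structure on an open subset of a vector space. -/
structure IsAlmostContactOn (U : Set E) (G : E → E →L[ℝ] E →L[ℝ] ℝ) (φ : E → E →L[ℝ] E)
    (ξ : E → E) (η : E → E →L[ℝ] ℝ) : Prop extends IsMetricOn U G where
  smooth_φ : ∀ y ∈ U, ContDiffAt ℝ ∞ φ y
  smooth_ξ : ∀ y ∈ U, ContDiffAt ℝ ∞ ξ y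
  smooth_η : ∀ y ∈ U, ContDiffAt ℝ ∞ η y
  φ_sq : ∀ y ∈ U, ∀ v, φ y (φ y v) = -v + η y v • ξ y
  η_ξ : ∀ y ∈ U, η y (ξ y) = 1
  φ_ξ : ∀ y ∈ U, φ y (ξ y) = 0
  skew : ∀ y ∈ U, ∀ u v, G y u (φ y v) = -G y (φ y u) v
  g_ξ : ∀ y ∈ U, ∀ v, G y v (ξ y) = η y v

variable {U : Set E} {G : E → E →L[ℝ] E →L[ℝ] ℝ} {φ : E → E →L[ℝ] E}
    {ξ : E → E} {η : E → E →L[ℝ] ℝ} {κ μ c : ℝ} {y : E}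

namespace IsAlmostContactOn

variable (hA : IsAlmostContactOn U G φ ξ η)
include hA

theorem almostContactAt (hy : y ∈ U) : AlmostContactAt (G y) (φ y) (ξ y) where
  symm := hA.symm y hy
  pos := hA.pos y hy
  φ_sq v := by rw [hA.φ_sq y hy, hA.g_ξ y hy]
  unit := by rw [hA.g_ξ y hy, hA.η_ξ y hy]
  φ_ξ := hA.φ_ξ y hy
  skew := hA.skew y hy

theorem diff_φ (hy : y ∈ U) : DifferentiableAt ℝ φ y := (hA.smooth_φ y hy).differentiableAt (by simp)

theorem diff_ξ (hy : y ∈ U) : DifferentiableAt ℝ ξ y := (hA.smooth_ξ y hy).differentiableAt (by simp)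

theorem diff_η (hy : y ∈ U) : DifferentiableAt ℝ η y := (hA.smooth_η y hy).differentiableAt (by simp)

variable [FiniteDimensional ℝ E]

theorem fderiv_η (hy : y ∈ U) (u v : E) :
    fderiv ℝ η y u v = G y (Gam G y u v) (ξ y) + G y v (covVec (Gam G) ξ y u) := by
  rw [← fderiv_clm_apply_const (hA.diff_η hy),
    ← fderiv_congr_on hA.isOpen (fun z hz => hA.g_ξ z hz v) hy,
    hA.fderiv_inner hy (differentiableAt_const v) (hA.diff_ξ hy)]
  simp [covVec_apply]

theorem diff_covVec_ξ (hy : y ∈ U) : DifferentiableAt ℝ (covVec (Gam G) ξ) y := by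
  refine ContDiffAt.differentiableAt (n := ∞) (contDiffAt_clm_of_apply fun v => ?_) (by simp)
  change ContDiffAt ℝ ∞ (fun z => fderiv ℝ ξ z v + Gam G z v (ξ z)) y
  exact ((contDiffAt_fderiv (hA.smooth_ξ y hy)).clm_apply contDiffAt_const).add
    (((hA.contDiffAt_Gam hy).clm_apply contDiffAt_const).clm_apply (hA.smooth_ξ y hy))

/-- This is ddη = 0: second derivatives of η cancel by symmetry and the Christoffel terms cancel
because the connection is torsion-free. -/
theorem cyclic (hc : ∀ y ∈ U, ∀ u v : E, G y u (φ y v) = dOneForm η y u v) (hy : y ∈ U)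
    (u v w : E) : G y v (covEnd (Gam G) φ y u w) + G y w (covEnd (Gam G) φ y v u)
      + G y u (covEnd (Gam G) φ y w v) = 0 := by
  have hη2 : DifferentiableAt ℝ (fderiv ℝ η) y :=
    (contDiffAt_fderiv (hA.smooth_η y hy)).differentiableAt (by simp)
  have key : ∀ w u v, G y (Gam G y w u) (φ y v)
      + G y u (fderiv ℝ φ y w v + Gam G y w (φ y v))
      = 1 / 2 * (fderiv ℝ (fderiv ℝ η) y w u v - fderiv ℝ (fderiv ℝ η) y w v u) := by
    intro w u v
    have h1 := congrArg (fun L => L w) (fderiv_congr_on hA.isOpen (fun z hz => hc z hz u v) hy)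
    simp only [dOneForm] at h1
    have d : ∀ u v, DifferentiableAt ℝ (fun z => fderiv ℝ η z u v) y := fun u v =>
      (hη2.clm_apply (differentiableAt_const u)).clm_apply (differentiableAt_const v)
    rw [hA.fderiv_inner hy (differentiableAt_const u)
      ((hA.diff_φ hy).clm_apply (differentiableAt_const v)), fderiv_clm_apply_const (hA.diff_φ hy),
      fderiv_const_mul ((d u v).fun_sub (d v u)), fderiv_fun_sub (d u v) (d v u)] at h1
    have e : ∀ u v, fderiv ℝ (fun z => fderiv ℝ η z u v) y w = fderiv ℝ (fderiv ℝ η) y w u v :=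
      fun u v => by
        rw [fderiv_bilin_apply hη2 (differentiableAt_const u) (differentiableAt_const v)]
        simp
    simpa [e] using h1
  have s := fderiv_fderiv_comm (hA.smooth_η y hy)
  have k1 := key u v w
  have k2 := key v w u
  have k3 := key w u v
  rw [s u v] at k1
  rw [s v w] at k2
  rw [s w u] at k3
  have sk := hA.skew y hy
  simp only [covEnd_apply, map_sub, map_add, sk v (Gam G y u w), sk w (Gam G y v u),
    sk u (Gam G y w v)] at k1 k2 k3 ⊢
  rw [hA.symm y hy (φ y v), hA.symm y hy (φ y w), hA.symm y hy (φ y u), hA.Gam_symm hy u w,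
    hA.Gam_symm hy v u, hA.Gam_symm hy w v]
  linarith

/-- Each field is a structure equation or its covariant derivative: Φ = dη, g(ξ, ξ) = 1, φ² = -1 + η
⊗ ξ, skewness of φ, φξ = 0 and closedness of Φ. -/
theorem contactJetAt (hc : ∀ y ∈ U, ∀ u v : E, G y u (φ y v) = dOneForm η y u v) (hy : y ∈ U) :
    ContactJetAt (G y) (φ y) (ξ y) (covVec (Gam G) ξ y) (covEnd (Gam G) φ y) where
  toAlmostContactAt := hA.almostContactAt hy
  contact u v := by
    have h1 := hc y hy u v
    rw [dOneForm, hA.fderiv_η hy, hA.fderiv_η hy, hA.Gam_symm hy u v, hA.symm y hy v,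
      hA.symm y hy u (covVec _ _ _ _)] at h1
    linarith
  B_perp u := by
    have h1 := congrArg (fun L => L u) (fderiv_congr_on hA.isOpen (B := fun _ => (1 : ℝ))
      (fun z hz => (hA.almostContactAt hz).unit) hy)
    simp only [hA.fderiv_inner hy (hA.diff_ξ hy) (hA.diff_ξ hy)] at h1
    rw [hA.symm y hy (ξ y)] at h1
    simp only [fderiv_fun_const, Pi.zero_apply, zero_apply, ← covVec_apply] at h1
    linarith
  T_φ u v := by
    have dφ := hA.diff_φ hy
    have dv : DifferentiableAt ℝ (fun _ : E => v) y := differentiableAt_const v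
    have dφv : DifferentiableAt ℝ (fun z => φ z v) y := dφ.clm_apply dv
    have dG : DifferentiableAt ℝ (fun z => G z v (ξ z)) y :=
      ((hA.differentiableAt hy).clm_apply dv).clm_apply (hA.diff_ξ hy)
    have sq := fun z (hz : z ∈ U) => (hA.almostContactAt hz).φ_sq
    have h1 := congrArg (fun L => L u) (fderiv_congr_on hA.isOpen
      (A := fun z => φ z (φ z v)) (B := fun z => -v + G z v (ξ z) • ξ z)
      (fun z hz => sq z hz v) hy)
    rw [fderiv_end_apply (Γ := Gam G) dφ dφv, covVec_apply, fderiv_clm_apply_const dφ, fderiv_const_add,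
      fderiv_fun_smul dG (hA.diff_ξ hy), sq y hy] at h1
    simp only [add_apply, smul_apply, ContinuousLinearMap.smulRight_apply] at h1
    rw [hA.fderiv_inner hy dv (hA.diff_ξ hy)] at h1
    simp only [fderiv_fun_const, Pi.zero_apply, zero_apply, zero_add, ← covVec_apply] at h1
    have h2 := sq y hy (Gam G y u v)
    have h3 : fderiv ℝ φ y u v + Gam G y u (φ y v) = covEnd (Gam G) φ y u v + φ y (Gam G y u v) := by
      rw [covEnd_apply]; abel
    rw [h3, map_add, h2] at h1
    simp only [map_add, map_neg, map_smul] at h1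
    rw [hA.symm y hy (covVec _ _ _ _) v, covVec_apply (X := ξ)]
    rw [covVec_apply (X := ξ)] at h1
    linear_combination (norm := module) h1
  T_skew u v w := by
    have h1 := hA.covEnd_adjoint hy (hA.diff_φ hy) (hA.diff_φ hy).neg
      (fun z hz v w => by
        have := hA.skew z hz v w
        simp only [Pi.neg_apply, neg_apply, map_neg]
        linarith) u v w
    rw [h1]
    simp only [covEnd_apply, Pi.neg_apply, neg_apply, map_neg, fderiv_neg]
    simp only [map_sub, map_add, map_neg]
    ring
  T_ξ u := by
    have h1 := congrArg (fun L => L u) (fderiv_congr_on hA.isOpen (B := fun _ => (0 : E))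
      (fun z hz => hA.φ_ξ z hz) hy)
    simp only [fderiv_end_apply (Γ := Gam G) (hA.diff_φ hy) (hA.diff_ξ hy), hA.φ_ξ y hy] at h1
    simp only [fderiv_fun_const, Pi.zero_apply, zero_apply, map_zero, sub_zero] at h1
    exact eq_neg_of_add_eq_zero_left h1
  cyclic := hA.cyclic hc hy

end IsAlmostContactOn

end ContactFields

end ContactChen

namespace ContactChen

/-! ### Sectional curvature of a (κ, μ)-contact space form. -/

section SpaceForm

variable {E : Type*} [NormedAddCommGroup E] [NormedSpace ℝ E] [FiniteDimensional ℝ E]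

namespace IsMetricOn

variable {U : Set E} {G : E → E →L[ℝ] E →L[ℝ] ℝ} (hG : IsMetricOn U G) {y : E}
include hG

theorem curvatureAt_christoffel (hy : y ∈ U) (u v w : E) :
    curvatureAt (covDeriv (christoffel G)) y u v w = curv (Gam G) y u v w :=
  curvatureAt_covDeriv (hG.differentiableAt_Gam hy) u v w

theorem curv_isCurvatureLike (hy : y ∈ U) :
    IsCurvatureLike fun u v w z => G y (curv (Gam G) y u v w) z where
  add u u' v w z := by simp [curv_add_left]
  smul a u v w z := by simp [curv_smul_left]
  swap u v w z := by rw [curv_swap]; simp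
  pair u v w z := hG.curv_pair hy u v w z
  bianchi u v w z := by
    have := congrArg (fun t => G y t z) (hG.curv_bianchi hy u v w)
    simpa using this

end IsMetricOn

variable {U : Set E} {G : E → E →L[ℝ] E →L[ℝ] ℝ} {φ : E → E →L[ℝ] E}
    {ξ : E → E} {η : E → E →L[ℝ] ℝ} {κ μ c : ℝ} {y : E}

/-- The tensor `S = ∇ ξ + φ`, which equals `- φ h'`. -/
noncomputable def shapeS (G : E → E →L[ℝ] E →L[ℝ] ℝ) (φ : E → E →L[ℝ] E) (ξ : E → E) (y : E) :
    E →L[ℝ] E :=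
  covVec (Gam G) ξ y + φ y

namespace IsAlmostContactOn

variable (hA : IsAlmostContactOn U G φ ξ η)
include hA

theorem diff_shapeS (hy : y ∈ U) : DifferentiableAt ℝ (shapeS G φ ξ) y :=
  (hA.diff_covVec_ξ hy).add (hA.diff_φ hy)

theorem covEnd_shapeS (hy : y ∈ U) (u v : E) : covEnd (Gam G) (shapeS G φ ξ) y u v
    = covEnd (Gam G) (covVec (Gam G) ξ) y u v + covEnd (Gam G) φ y u v :=
  covEnd_add (hA.diff_covVec_ξ hy) (hA.diff_φ hy) u v

variable (hF : IsKappaMuSpaceFormOn U G φ ξ η κ μ c)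
include hF

theorem shapeS_symm (hy : y ∈ U) (u v : E) : G y (shapeS G φ ξ y u) v = G y u (shapeS G φ ξ y v) :=
  (hA.contactJetAt hF.contact hy).S_symm u v

theorem shapeS_φ (hy : y ∈ U) (u : E) : shapeS G φ ξ y (φ y u) = - φ y (shapeS G φ ξ y u) :=
  (hA.contactJetAt hF.contact hy).S_φ u

theorem shapeS_ξ (hy : y ∈ U) : shapeS G φ ξ y (ξ y) = 0 :=
  (hA.contactJetAt hF.contact hy).S_ξ

theorem hPrime_eq (hy : y ∈ U) (u : E) : hPrime φ ξ y u = φ y (shapeS G φ ξ y u) := by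
  have h := (hA.contactJetAt hF.contact hy).two_φS u
  have h2 : hPrime φ ξ y u = (1 / 2 : ℝ) • (covEnd (Gam G) φ y (ξ y) u
      - covVec (Gam G) ξ y (φ y u) + φ y (covVec (Gam G) ξ y u)) := by
    simp only [hPrime, VectorField.lieBracket, covEnd_apply, covVec_apply, map_add, map_sub,
      fderiv_clm_apply_const (hA.diff_φ hy), fderiv_fun_const, Pi.zero_apply, zero_apply]
    rw [hA.Gam_symm hy (ξ y) (φ y u), hA.Gam_symm hy u (ξ y)]
    simp only [map_zero]
    congr 1
    abel
  rw [h2, h, smul_smul, one_div, inv_mul_cancel₀ two_ne_zero, one_smul]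
  rfl

theorem covEnd_shapeS_φ (hy : y ∈ U) (u v : E) :
    covEnd (Gam G) (shapeS G φ ξ) y u (φ y v) + shapeS G φ ξ y (covEnd (Gam G) φ y u v)
      + covEnd (Gam G) φ y u (shapeS G φ ξ y v) + φ y (covEnd (Gam G) (shapeS G φ ξ) y u v) = 0 := by
  have dS := hA.diff_shapeS hy
  have dφ := hA.diff_φ hy
  have h1 := covEnd_congr_on (Γ := Gam G) hA.isOpen
    (A := fun z => (shapeS G φ ξ z).comp (φ z) + (φ z).comp (shapeS G φ ξ z)) (A' := fun _ => 0)
    (fun z hz => by ext v; simp [hA.shapeS_φ hF hz]) hy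
  have h2 := congrArg (fun L => L u v) h1
  simp only [covEnd_zero, covEnd_add (dS.clm_comp dφ) (dφ.clm_comp dS), covEnd_comp dS dφ,
    covEnd_comp dφ dS] at h2
  rw [add_assoc (_ + _)]
  exact h2

theorem covEnd_shapeS_ξ (hy : y ∈ U) (u : E) :
    covEnd (Gam G) (shapeS G φ ξ) y u (ξ y) + shapeS G φ ξ y (covVec (Gam G) ξ y u) = 0 := by
  have h1 := congrArg (fun L => L u) (fderiv_congr_on hA.isOpen (B := fun _ => (0 : E))
    (fun z hz => hA.shapeS_ξ hF hz) hy)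
  simp only [fderiv_end_apply (Γ := Gam G) (hA.diff_shapeS hy) (hA.diff_ξ hy),
    hA.shapeS_ξ hF hy] at h1
  simpa using h1

/-- Since ∇ξ = S - φ, the left side is the skew part of ∇²ξ, which the Ricci identity equates with
R(u, v)ξ. -/
theorem nullity_eq (hy : y ∈ U) (u v : E) :
    covEnd (Gam G) (shapeS G φ ξ) y u v - covEnd (Gam G) φ y u v
      - (covEnd (Gam G) (shapeS G φ ξ) y v u - covEnd (Gam G) φ y v u)
      = κ • (G y v (ξ y) • u - G y u (ξ y) • v) + μ • (G y v (ξ y) • φ y (shapeS G φ ξ y u)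
        - G y u (ξ y) • φ y (shapeS G φ ξ y v)) := by
  rw [hA.covEnd_shapeS hy, hA.covEnd_shapeS hy, add_sub_cancel_right, add_sub_cancel_right,
    covEnd_covVec_comm (hA.differentiableAt_Gam hy) (hA.Gam_symm hy) (hA.smooth_ξ y hy),
    ← hA.curvatureAt_christoffel hy, hF.nullity y hy, hA.hPrime_eq hF hy, hA.hPrime_eq hF hy]

theorem shapeS_sq (hy : y ∈ U) {u : E} (hu : G y u (ξ y) = 0) :
    shapeS G φ ξ y (shapeS G φ ξ y u) = (1 - κ) • u :=
  (hA.contactJetAt hF.contact hy).S_sq (hA.covEnd_shapeS_φ hF hy) (hA.covEnd_shapeS_ξ hF hy)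
    (hA.nullity_eq hF hy) hu

/-- For κ = 1 the symmetric operator S has square zero on ξ^⊥, so it vanishes there because the
metric is definite; this is the Sasakian case. -/
theorem shapeS_eq_zero (hκ : κ = 1) (hy : y ∈ U) : shapeS G φ ξ y = 0 := by
  have hC := hA.almostContactAt hy
  have h0 : ∀ u, G y u (ξ y) = 0 → shapeS G φ ξ y u = 0 := by
    intro u hu
    by_contra hne
    have h1 := hC.pos _ hne
    rw [hA.shapeS_symm hF hy, hA.shapeS_sq hF hy hu, hκ] at h1
    simp at h1
  ext u
  have h2 := h0 _ (hC.perp_part u)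
  rw [map_sub, map_smul, hA.shapeS_ξ hF hy, smul_zero, sub_zero] at h2
  simpa using h2

theorem covEnd_φ_eq (hy : y ∈ U) (u v : E) :
    covEnd (Gam G) φ y u v = G y (φ y (covVec (Gam G) ξ y u)) v • ξ y
      - G y v (ξ y) • φ y (covVec (Gam G) ξ y u) := by
  refine (hA.contactJetAt hF.contact hy).T_eq (hA.covEnd_shapeS_φ hF hy)
    (hA.covEnd_adjoint hy (hA.diff_shapeS hy) (hA.diff_shapeS hy)
      fun z hz => hA.shapeS_symm hF hz) (hA.covEnd_shapeS_ξ hF hy)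
    (hA.nullity_eq hF hy) (fun hκ => ?_) u v
  rw [covEnd_congr_on hA.isOpen (fun z hz => hA.shapeS_eq_zero hF hκ hz) hy, covEnd_zero]

/-- The formula for ∇φ holds on all of U and can be differentiated. For w and z in ξ^⊥ only the
terms in which the derivative falls on ξ survive. -/
theorem covEnd_covEnd_φ (hy : y ∈ U) {u v w z : E} (hw : G y w (ξ y) = 0) (hz : G y z (ξ y) = 0) :
    G y (covEnd (Gam G) (fun x => covEnd (Gam G) φ x v) y u w) z
      = G y (φ y (covVec (Gam G) ξ y v)) w * G y (covVec (Gam G) ξ y u) z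
        - G y (covVec (Gam G) ξ y u) w * G y (φ y (covVec (Gam G) ξ y v)) z := by
  set b : E → E := fun x => φ x (covVec (Gam G) ξ x v) with hb
  have db : DifferentiableAt ℝ b y :=
    (hA.diff_φ hy).clm_apply ((hA.diff_covVec_ξ hy).clm_apply (differentiableAt_const v))
  have dξ := hA.diff_ξ hy
  have dw : DifferentiableAt ℝ (fun _ : E => w) y := differentiableAt_const w
  have dG : ∀ {X Y : E → E}, DifferentiableAt ℝ X y → DifferentiableAt ℝ Y y →
      DifferentiableAt ℝ (fun x => G x (X x) (Y x)) y := fun hX hY =>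
    ((hA.differentiableAt hy).clm_apply hX).clm_apply hY
  have h1 : fderiv ℝ (fun x => covEnd (Gam G) φ x v) y u w
      = fderiv ℝ (fun x => G x (b x) w • ξ x - G x w (ξ x) • b x) y u := by
    rw [← fderiv_congr_on hA.isOpen (fun x hx => hA.covEnd_φ_eq hF hx v w) hy]
    have dφ := hA.smooth_φ y hy
    have dT : DifferentiableAt ℝ (fun x => covEnd (Gam G) φ x v) y := by
      have dΓv : DifferentiableAt ℝ (fun x => Gam G x v) y :=
        (hA.differentiableAt_Gam hy).clm_apply (differentiableAt_const v)
      exact ((((contDiffAt_fderiv dφ).differentiableAt (by simp)).clm_apply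
        (differentiableAt_const v)).add (dΓv.clm_comp (hA.diff_φ hy))).sub
          ((hA.diff_φ hy).clm_comp dΓv)
    rw [fderiv_clm_apply_const dT]
  rw [covEnd_apply, h1, hA.covEnd_φ_eq hF hy, hA.covEnd_φ_eq hF hy,
    fderiv_fun_sub ((dG db dw).fun_smul dξ) ((dG dw dξ).fun_smul db), fderiv_fun_smul (dG db dw) dξ,
    fderiv_fun_smul (dG dw dξ) db]
  simp only [add_apply, sub_apply, smul_apply, ContinuousLinearMap.smulRight_apply, map_add,
    map_sub, map_smul, smul_eq_mul]
  rw [hA.fderiv_inner hy dw dξ, hw, hA.symm y hy (ξ y) z, hz]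
  simp only [fderiv_fun_const, Pi.zero_apply, zero_apply, zero_add, ← covVec_apply]
  rw [hA.symm y hy w]
  have e : G y (covVec (Gam G) ξ y u) z = G y (fderiv ℝ ξ y u) z + G y (Gam G y u (ξ y)) z := by
    rw [covVec_apply, map_add, add_apply]
  rw [e]
  simp only [hb]
  ring

/-- Curvature minus model satisfies the three hypotheses of `sectional_eq_zero`, treated in order:
the Kähler identity from the Ricci identity for φ, zero φ-sectional curvature, and vanishing on ξ
from the nullity condition. -/
theorem sectional (hy : y ∈ U) (u v : E) :
    G y (curv (Gam G) y u v v) u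
      = modelCurv (G y) (φ y) (ξ y) (shapeS G φ ξ y) κ μ c u v v u := by
  have hC := hA.almostContactAt hy
  have hS := hA.shapeS_symm hF hy
  have hSφ := hA.shapeS_φ hF hy
  have hR := hA.curv_isCurvatureLike hy
  have hM := modelCurv_isCurvatureLike (κ := κ) (μ := μ) (c := c) hC hS hSφ
  have hB : ∀ u, covVec (Gam G) ξ y u = shapeS G φ ξ y u - φ y u := fun u => by
    simp [shapeS]
  refine sub_eq_zero.1 ((hR.sub hM).sectional_eq_zero hC ?_ ?_ ?_ u v)
  · intro u v w z hu hv hw hz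
    have h1 := modelCurv_φ (S := shapeS G φ ξ y) (κ := κ) (μ := μ) (c := c) hC hu hv hw hz
    have h2 := congrArg (fun t => G y t z) (covEnd_covEnd_comm (hA.differentiableAt_Gam hy)
      (hA.smooth_φ y hy) u v w)
    simp only [map_sub, sub_apply] at h2
    rw [hA.covEnd_covEnd_φ hF hy hw hz, hA.covEnd_covEnd_φ hF hy hw hz] at h2
    have h3 := hC.skew (curv (Gam G) y u v w) z
    simp only [hB] at h2
    linarith
  · intro u hu
    rw [modelCurv_φ_sectional hC hSφ hu]
    -- The φ-sectional hypothesis concerns unit vectors; homogeneity of degree four extends it.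
    by_cases h0 : u = 0
    · subst h0
      simp [curv]
    have hp := hC.pos u h0
    set r := Real.sqrt (G y u u) with hr
    have hr2 : r * r = G y u u := Real.mul_self_sqrt hp.le
    have hr0 : r ≠ 0 := by
      intro h
      rw [h] at hr2
      simp at hr2
      exact hp.ne hr2
    have h1 := hF.phi_sectional y hy (r⁻¹ • u) (by
      simp only [map_smul, smul_apply, smul_eq_mul, ← hr2]
      field_simp) (by simp [hu])
    rw [hA.curvatureAt_christoffel hy, (φ y).map_smul] at h1
    have h2 : r⁻¹ * (r⁻¹ * (r⁻¹ * (r⁻¹ * G y (curv (Gam G) y u (φ y u) (φ y u)) u))) = c := by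
      have e := hR.smul r⁻¹ u (r⁻¹ • φ y u) (r⁻¹ • φ y u) (r⁻¹ • u)
      rw [h1, hR.smul₂, hR.smul₃, hR.smul₄] at e
      exact e.symm
    rw [← hr2, ← h2]
    field_simp
    ring
  · intro u v w
    rw [modelCurv_ξ hC hS (hA.shapeS_ξ hF hy), ← hA.curvatureAt_christoffel hy, hF.nullity y hy,
      hA.hPrime_eq hF hy, hA.hPrime_eq hF hy, sub_self]

end IsAlmostContactOn

end SpaceForm

end ContactChen

namespace ContactChen

/-! ### Immersions, the induced connection and its coefficients. -/

section Gauss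

variable {E E' : Type*} [NormedAddCommGroup E] [NormedSpace ℝ E]
  [NormedAddCommGroup E'] [NormedSpace ℝ E']

/-- The map `F : V → U` is an immersion into a domain `U` with a metric and a vector field `P`. -/
structure IsImmersionOn (V : Set E') (U : Set E) (D : ChartData E' E) : Prop
    extends IsMetricOn U D.G where
  isOpen_dom : IsOpen V
  smooth_P : ∀ y ∈ U, ContDiffAt ℝ ∞ D.P y
  smooth_F : ∀ s ∈ V, ContDiffAt ℝ ∞ D.F s
  mapsTo : ∀ s ∈ V, D.F s ∈ U
  inj : ∀ s ∈ V, Function.Injective (D.d s)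

namespace IsImmersionOn

variable {V : Set E'} {U : Set E} {D : ChartData E' E} (hD : IsImmersionOn V U D) {s : E'}
include hD

theorem gInd_symm (hs : s ∈ V) (u v : E') : D.gInd s u v = D.gInd s v u :=
  hD.symm _ (hD.mapsTo s hs) _ _

theorem gInd_pos (hs : s ∈ V) (u : E') (hu : u ≠ 0) : 0 < D.gInd s u u :=
  hD.pos _ (hD.mapsTo s hs) _ fun h => hu (hD.inj s hs ((show D.d s u = 0 from h).trans (map_zero _).symm))

theorem smooth_d (hs : s ∈ V) : ContDiffAt ℝ ∞ D.d s := contDiffAt_fderiv (hD.smooth_F s hs)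

theorem diff_d (hs : s ∈ V) : DifferentiableAt ℝ D.d s :=
  (hD.smooth_d hs).differentiableAt (by simp)

theorem fderiv_d_comm (hs : s ∈ V) (u v : E') : fderiv ℝ D.d s u v = fderiv ℝ D.d s v u :=
  fderiv_fderiv_comm (hD.smooth_F s hs) u v

theorem smooth_G_comp (hs : s ∈ V) : ContDiffAt ℝ ∞ (fun t => D.G (D.F t)) s :=
  (hD.smooth _ (hD.mapsTo s hs)).comp s (hD.smooth_F s hs)

theorem gInd_ext (hs : s ∈ V) {u v : E'} (h : ∀ w, D.gInd s u w = D.gInd s v w) : u = v := by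
  by_contra hne
  have := hD.gInd_pos hs (u - v) (sub_ne_zero.2 hne)
  have h' := h (u - v)
  rw [map_sub (D.gInd s)] at this
  change 0 < D.gInd s u (u - v) - D.gInd s v (u - v) at this
  linarith

theorem smooth_P_comp (hs : s ∈ V) : ContDiffAt ℝ ∞ (fun t => D.P (D.F t)) s :=
  (hD.smooth_P _ (hD.mapsTo s hs)).comp s (hD.smooth_F s hs)

theorem smooth_inner (hs : s ∈ V) {X Y : E' → E} (hX : ContDiffAt ℝ ∞ X s)
    (hY : ContDiffAt ℝ ∞ Y s) : ContDiffAt ℝ ∞ (fun t => D.G (D.F t) (X t) (Y t)) s :=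
  ((hD.smooth_G_comp hs).clm_apply hX).clm_apply hY

theorem smooth_d_apply (hs : s ∈ V) (u : E') : ContDiffAt ℝ ∞ (fun t => D.d t u) s :=
  (hD.smooth_d hs).clm_apply contDiffAt_const

variable [FiniteDimensional ℝ E']

theorem smooth_gInd (hs : s ∈ V) : ContDiffAt ℝ ∞ D.gInd s := by
  refine contDiffAt_clm_of_apply fun u => contDiffAt_clm_of_apply fun v => ?_
  exact ((hD.smooth_G_comp hs).clm_apply ((hD.smooth_d hs).clm_apply contDiffAt_const)).clm_apply
    ((hD.smooth_d hs).clm_apply contDiffAt_const)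

theorem gInd_tan (hs : s ∈ V) (z : E) (w : E') :
    D.gInd s (D.tan s z) w = D.G (D.F s) z (D.d s w) := by
  rw [ChartData.tan, (isInvertible_of_pos (hD.gInd_pos hs)).self_apply_inverse]
  rfl

theorem tan_d (hs : s ∈ V) (u : E') : D.tan s (D.d s u) = u :=
  hD.gInd_ext hs fun w => hD.gInd_tan hs _ w

theorem G_nor (hs : s ∈ V) (z : E) (w : E') : D.G (D.F s) (D.nor s z) (D.d s w) = 0 := by
  rw [ChartData.nor, map_sub, sub_apply, sub_eq_zero]
  exact (hD.gInd_tan hs z w).symm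

end IsImmersionOn

namespace ChartData

variable (D : ChartData E' E)

theorem tan_add (s : E') (z z' : E) : D.tan s (z + z') = D.tan s z + D.tan s z' := by
  simp [tan, ContinuousLinearMap.add_comp]

theorem tan_smul (s : E') (a : ℝ) (z : E) : D.tan s (a • z) = a • D.tan s z := by
  simp [tan, ContinuousLinearMap.smul_comp]

variable [FiniteDimensional ℝ E]

/-- The second covariant derivative of `F` for the Levi-Civita connection. -/
noncomputable def hess (s u v : E') : E :=
  fderiv ℝ D.d s u v + Gam D.G (D.F s) (D.d s u) (D.d s v)

/-- The second covariant derivative of `F` for the connection `∇̄`. -/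
noncomputable def hessBar (s u v : E') : E :=
  D.hess s u v + (D.l₁ * D.π s (D.d s v)) • D.d s u - (D.l₂ * D.gInd s u v) • D.P (D.F s)

theorem hess_add_left (s u u' v : E') : D.hess s (u + u') v = D.hess s u v + D.hess s u' v := by
  simp only [hess, map_add, add_apply]
  abel

theorem hess_smul_left (a : ℝ) (s u v : E') : D.hess s (a • u) v = a • D.hess s u v := by
  simp only [hess, map_smul, smul_apply, smul_add]

theorem hess_add_right (s u v v' : E') : D.hess s u (v + v') = D.hess s u v + D.hess s u v' := by
  simp only [hess, map_add]
  abel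

theorem hess_smul_right (a : ℝ) (s u v : E') : D.hess s u (a • v) = a • D.hess s u v := by
  simp only [hess, map_smul, smul_add]

theorem hessBar_add_left (s u u' v : E') :
    D.hessBar s (u + u') v = D.hessBar s u v + D.hessBar s u' v := by
  simp only [hessBar, hess_add_left, map_add, add_apply]
  module

theorem hessBar_smul_left (a : ℝ) (s u v : E') : D.hessBar s (a • u) v = a • D.hessBar s u v := by
  simp only [hessBar, hess_smul_left, map_smul, smul_apply, smul_eq_mul]
  module

theorem hessBar_add_right (s u v v' : E') :
    D.hessBar s u (v + v') = D.hessBar s u v + D.hessBar s u v' := by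
  simp only [hessBar, hess_add_right, map_add, π]
  module

theorem hessBar_smul_right (a : ℝ) (s u v : E') : D.hessBar s u (a • v) = a • D.hessBar s u v := by
  simp only [hessBar, hess_smul_right, map_smul, smul_eq_mul, π]
  module

/-- The coefficients of the induced connection. -/
noncomputable def indCoeff [FiniteDimensional ℝ E'] (s : E') : E' →L[ℝ] E' →L[ℝ] E' :=
  LinearMap.toContinuousLinearMap
    { toFun := fun u => LinearMap.toContinuousLinearMap
        { toFun := fun v => D.tan s (D.hessBar s u v)
          map_add' := fun v v' => by rw [hessBar_add_right, tan_add]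
          map_smul' := fun a v => by rw [hessBar_smul_right, tan_smul]; rfl }
      map_add' := fun u u' => by
        ext v
        change D.tan s (D.hessBar s (u + u') v) = D.tan s (D.hessBar s u v)
          + D.tan s (D.hessBar s u' v)
        rw [hessBar_add_left, tan_add]
      map_smul' := fun a u => by
        ext v
        change D.tan s (D.hessBar s (a • u) v) = a • D.tan s (D.hessBar s u v)
        rw [hessBar_smul_left, tan_smul] }

theorem indCoeff_apply [FiniteDimensional ℝ E'] (s u v : E') :
    D.indCoeff s u v = D.tan s (D.hessBar s u v) := rfl

end ChartData

namespace IsImmersionOn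

variable {V : Set E'} {U : Set E} {D : ChartData E' E} (hD : IsImmersionOn V U D) {s : E'}
  [FiniteDimensional ℝ E]
include hD

/-- This splits ∇̄_X dF(Y) into the derivative of Y, which is tangent, and a part bilinear in X and
Y; hence the induced connection is given by coefficients and `h` is a tensor. -/
theorem covDerivAlong_eq (hs : s ∈ V) {X Y : E' → E'} (hY : DifferentiableAt ℝ Y s) :
    covDerivAlong D.ambientCoeff D.F X (fun t => D.d t (Y t)) s
      = D.d s (fderiv ℝ Y s (X s)) + D.hessBar s (X s) (Y s) := by
  have hd : fderiv ℝ D.F s = D.d s := rfl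
  rw [covDerivAlong, fderiv_clm_apply_apply (hD.diff_d hs) hY, ChartData.ambientCoeff,
    ChartData.hessBar, ChartData.hess, hd]
  change _ + (Gam D.G (D.F s) (D.d s (X s)) (D.d s (Y s)) + (D.l₁ * D.π s (D.d s (Y s))) • D.d s (X s)
    - (D.l₂ * D.gInd s (X s) (Y s)) • D.P (D.F s)) = _
  abel

theorem h_eq (hs : s ∈ V) (u v : E') : D.h s u v = D.nor s (D.hessBar s u v) := by
  rw [ChartData.h, hD.covDerivAlong_eq hs (Y := fun _ => v) (differentiableAt_const v)]
  simp

theorem hess_symm (hs : s ∈ V) (u v : E') : D.hess s u v = D.hess s v u := by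
  rw [ChartData.hess, ChartData.hess, hD.fderiv_d_comm hs, hD.Gam_symm (hD.mapsTo s hs)]

theorem smooth_hess (hs : s ∈ V) (u v : E') : ContDiffAt ℝ ∞ (fun t => D.hess t u v) s := by
  have hd := hD.smooth_d hs
  have hΓ : ContDiffAt ℝ ∞ (fun t => Gam D.G (D.F t)) s :=
    (hD.contDiffAt_Gam (hD.mapsTo s hs)).comp s (hD.smooth_F s hs)
  exact (((contDiffAt_fderiv hd).clm_apply contDiffAt_const).clm_apply contDiffAt_const).add
    ((hΓ.clm_apply (hd.clm_apply contDiffAt_const)).clm_apply (hd.clm_apply contDiffAt_const))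

theorem smooth_hessBar (hs : s ∈ V) (u v : E') : ContDiffAt ℝ ∞ (fun t => D.hessBar t u v) s :=
  ((hD.smooth_hess hs u v).add ((contDiffAt_const.mul (hD.smooth_inner hs (hD.smooth_P_comp hs)
    (hD.smooth_d_apply hs v))).smul (hD.smooth_d_apply hs u))).sub
    ((contDiffAt_const.mul (hD.smooth_inner hs (hD.smooth_d_apply hs u)
      (hD.smooth_d_apply hs v))).smul (hD.smooth_P_comp hs))

/-- The commutator of second covariant derivatives along `F` is the ambient curvature. -/
theorem hess_comm (hs : s ∈ V) (u v w : E') :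
    (fderiv ℝ (fun t => D.hess t v w) s u + Gam D.G (D.F s) (D.d s u) (D.hess s v w))
      - (fderiv ℝ (fun t => D.hess t u w) s v + Gam D.G (D.F s) (D.d s v) (D.hess s u w))
      = curv (Gam D.G) (D.F s) (D.d s u) (D.d s v) (D.d s w) := by
  have hd := hD.diff_d hs
  have hd2 : DifferentiableAt ℝ (fderiv ℝ D.d) s :=
    (contDiffAt_fderiv (hD.smooth_d hs)).differentiableAt (by simp)
  have hF : HasFDerivAt D.F (D.d s) s := ((hD.smooth_F s hs).differentiableAt (by simp)).hasFDerivAt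
  have hΓ : HasFDerivAt (fun t => Gam D.G (D.F t))
      ((fderiv ℝ (Gam D.G) (D.F s)).comp (D.d s)) s :=
    (hD.differentiableAt_Gam (hD.mapsTo s hs)).hasFDerivAt.comp s hF
  have key : ∀ u v w, fderiv ℝ (fun t => D.hess t v w) s u
      = fderiv ℝ (fderiv ℝ D.d) s u v w
        + (fderiv ℝ (Gam D.G) (D.F s) (D.d s u) (D.d s v) (D.d s w)
          + Gam D.G (D.F s) (fderiv ℝ D.d s u v) (D.d s w)
          + Gam D.G (D.F s) (D.d s v) (fderiv ℝ D.d s u w)) := by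
    intro u v w
    have hdv := hd.clm_apply (differentiableAt_const v)
    have hdw := hd.clm_apply (differentiableAt_const w)
    have d1 : DifferentiableAt ℝ (fun t => fderiv ℝ D.d t v w) s :=
      (hd2.clm_apply (differentiableAt_const v)).clm_apply (differentiableAt_const w)
    have d2 : DifferentiableAt ℝ (fun t => Gam D.G (D.F t) (D.d t v) (D.d t w)) s :=
      (hΓ.differentiableAt.clm_apply hdv).clm_apply hdw
    simp only [ChartData.hess]
    rw [fderiv_fun_add d1 d2, add_apply,
      fderiv_bilin_apply (A := fun t => Gam D.G (D.F t)) hΓ.differentiableAt hdv hdw, hΓ.fderiv,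
      fderiv_bilin_apply hd2 (differentiableAt_const v) (differentiableAt_const w),
      fderiv_clm_apply_const hd, fderiv_clm_apply_const hd]
    simp
  rw [key, key, fderiv_fderiv_comm (hD.smooth_d hs) u v, hD.fderiv_d_comm hs u v]
  simp only [ChartData.hess, map_add, curv]
  abel

/-- The covariant derivative of `P` along `F`, paired with a tangent vector. -/
theorem fderiv_π (hs : s ∈ V) (u w : E') :
    fderiv ℝ (fun t => D.G (D.F t) (D.P (D.F t)) (D.d t w)) s u
      = D.G (D.F s) (covVec (Gam D.G) D.P (D.F s) (D.d s u)) (D.d s w)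
        + D.G (D.F s) (D.P (D.F s)) (D.hess s u w) := by
  have hF : HasFDerivAt D.F (D.d s) s := ((hD.smooth_F s hs).differentiableAt (by simp)).hasFDerivAt
  have hP : HasFDerivAt (fun t => D.P (D.F t)) ((fderiv ℝ D.P (D.F s)).comp (D.d s)) s :=
    ((hD.smooth_P _ (hD.mapsTo s hs)).differentiableAt (by simp)).hasFDerivAt.comp s hF
  rw [hD.fderiv_inner_along (hD.mapsTo s hs) hF.differentiableAt hP.differentiableAt
    ((hD.smooth_d_apply hs w).differentiableAt (by simp)), hP.fderiv, hF.fderiv,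
    fderiv_clm_apply_const (hD.diff_d hs)]
  rfl

variable [FiniteDimensional ℝ E']

theorem smooth_indCoeff (hs : s ∈ V) : ContDiffAt ℝ ∞ D.indCoeff s := by
  refine contDiffAt_clm_of_apply fun u => contDiffAt_clm_of_apply fun v => ?_
  have hinv : ContDiffAt ℝ ∞ (fun t => (D.gInd t).inverse) s :=
    (isInvertible_of_pos (hD.gInd_pos hs)).contDiffAt_map_inverse.comp s (hD.smooth_gInd hs)
  exact hinv.clm_apply (((hD.smooth_G_comp hs).clm_apply (hD.smooth_hessBar hs u v)).clm_comp
    (hD.smooth_d hs))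

theorem inducedNabla_eq (hs : s ∈ V) {X Y : E' → E'} (hY : DifferentiableAt ℝ Y s) :
    D.inducedNabla X Y s = fderiv ℝ Y s (X s) + D.indCoeff s (X s) (Y s) := by
  rw [ChartData.inducedNabla, hD.covDerivAlong_eq hs hY, ChartData.tan_add, hD.tan_d hs]
  rfl

theorem curvatureAt_inducedNabla (hs : s ∈ V) (u v w : E') :
    curvatureAt D.inducedNabla s u v w = curv D.indCoeff s u v w := by
  have hC : DifferentiableAt ℝ D.indCoeff s := (hD.smooth_indCoeff hs).differentiableAt (by simp)
  have h0 : ∀ t ∈ V, ∀ v w, D.inducedNabla (fun _ => v) (fun _ => w) t = D.indCoeff t v w :=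
    fun t ht v w => by
      rw [hD.inducedNabla_eq ht (differentiableAt_const w)]
      simp
  have h1 : ∀ u v w : E', D.inducedNabla (fun _ => u) (D.inducedNabla (fun _ => v) (fun _ => w)) s
      = fderiv ℝ D.indCoeff s u v w + D.indCoeff s u (D.indCoeff s v w) := fun u v w => by
    -- The coefficient formula is available on the open set V, which suffices to differentiate it at
    -- s.
    have he : D.inducedNabla (fun _ => v) (fun _ => w) =ᶠ[nhds s] fun t => D.indCoeff t v w :=
      Filter.eventually_of_mem (hD.isOpen_dom.mem_nhds hs) fun t ht => h0 t ht v w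
    have hd : DifferentiableAt ℝ (fun t => D.indCoeff t v w) s :=
      (hC.clm_apply (differentiableAt_const v)).clm_apply (differentiableAt_const w)
    rw [hD.inducedNabla_eq hs (he.differentiableAt_iff.2 hd), he.fderiv_eq, h0 s hs,
      fderiv_bilin_apply hC (differentiableAt_const v) (differentiableAt_const w)]
    simp
  have hb : VectorField.lieBracket ℝ (fun _ : E' => u) (fun _ => v) = fun _ => 0 := by
    funext z
    simp [VectorField.lieBracket]
  rw [curvatureAt, curvature, h1, h1, hb, h0 s hs, curv]
  simp only [map_zero, zero_apply]
  abel

end IsImmersionOn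

end Gauss

end ContactChen

namespace ContactChen

/-! ### The Gauss equation for the connection ∇̄. -/

section GaussEquation

variable {E E' : Type*} [NormedAddCommGroup E] [NormedSpace ℝ E] [FiniteDimensional ℝ E]
  [NormedAddCommGroup E'] [NormedSpace ℝ E']

namespace IsImmersionOn

variable {V : Set E'} {U : Set E} {D : ChartData E' E} (hD : IsImmersionOn V U D) {s : E'}
include hD

/-- The Levi-Civita derivative of `hessBar` is that of `hess` plus the contribution of the two terms
carrying l₁ and l₂; these bring in ∇P, which later becomes α. -/
theorem fderiv_hessBar (hs : s ∈ V) (u v w z : E') :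
    D.G (D.F s) (fderiv ℝ (fun t => D.hessBar t v w) s u
        + Gam D.G (D.F s) (D.d s u) (D.hessBar s v w)) (D.d s z)
      = D.G (D.F s) (fderiv ℝ (fun t => D.hess t v w) s u
        + Gam D.G (D.F s) (D.d s u) (D.hess s v w)) (D.d s z)
      + D.l₁ * (D.G (D.F s) (covVec (Gam D.G) D.P (D.F s) (D.d s u)) (D.d s w)
        + D.π s (D.hess s u w)) * D.gInd s v z
      + D.l₁ * D.π s (D.d s w) * D.G (D.F s) (D.hess s u v) (D.d s z)
      - D.l₂ * (D.G (D.F s) (D.hess s u v) (D.d s w) + D.G (D.F s) (D.d s v) (D.hess s u w))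
        * D.π s (D.d s z)
      - D.l₂ * D.gInd s v w * D.G (D.F s) (covVec (Gam D.G) D.P (D.F s) (D.d s u)) (D.d s z) := by
  have hFs := hD.mapsTo s hs
  have hF : HasFDerivAt D.F (D.d s) s := ((hD.smooth_F s hs).differentiableAt (by simp)).hasFDerivAt
  have dd : ∀ v, DifferentiableAt ℝ (fun t => D.d t v) s := fun v =>
    (hD.smooth_d_apply hs v).differentiableAt (by simp)
  have dP : HasFDerivAt (fun t => D.P (D.F t)) ((fderiv ℝ D.P (D.F s)).comp (D.d s)) s :=
    ((hD.smooth_P _ hFs).differentiableAt (by simp)).hasFDerivAt.comp s hF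
  have dH : DifferentiableAt ℝ (fun t => D.hess t v w) s :=
    (hD.smooth_hess hs v w).differentiableAt (by simp)
  have dπ : DifferentiableAt ℝ (fun t => D.G (D.F t) (D.P (D.F t)) (D.d t w)) s :=
    (hD.smooth_inner hs (hD.smooth_P_comp hs) (hD.smooth_d_apply hs w)).differentiableAt (by simp)
  have dg : DifferentiableAt ℝ (fun t => D.G (D.F t) (D.d t v) (D.d t w)) s :=
    (hD.smooth_inner hs (hD.smooth_d_apply hs v) (hD.smooth_d_apply hs w)).differentiableAt (by simp)
  have h3 : ∀ u z, fderiv ℝ D.d s u z + Gam D.G (D.F s) (D.d s u) (D.d s z) = D.hess s u z :=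
    fun u z => rfl
  have hg : fderiv ℝ (fun t => D.G (D.F t) (D.d t v) (D.d t w)) s u
      = D.G (D.F s) (D.hess s u v) (D.d s w) + D.G (D.F s) (D.d s v) (D.hess s u w) := by
    rw [hD.fderiv_inner_along hFs hF.differentiableAt (dd v) (dd w), hF.fderiv,
      fderiv_clm_apply_const (hD.diff_d hs), fderiv_clm_apply_const (hD.diff_d hs), h3, h3]
  have hZ : fderiv ℝ (fun t => D.hessBar t v w) s u
      = fderiv ℝ (fun t => D.hess t v w) s u
        + ((D.l₁ * D.π s (D.d s w)) • fderiv ℝ D.d s u v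
          + (D.l₁ * (D.G (D.F s) (covVec (Gam D.G) D.P (D.F s) (D.d s u)) (D.d s w)
            + D.π s (D.hess s u w))) • D.d s v)
        - ((D.l₂ * D.gInd s v w) • fderiv ℝ D.P (D.F s) (D.d s u)
          + (D.l₂ * (D.G (D.F s) (D.hess s u v) (D.d s w)
            + D.G (D.F s) (D.d s v) (D.hess s u w))) • D.P (D.F s)) := by
    change fderiv ℝ (fun t => D.hess t v w
      + (D.l₁ * D.G (D.F t) (D.P (D.F t)) (D.d t w)) • D.d t v
      - (D.l₂ * D.G (D.F t) (D.d t v) (D.d t w)) • D.P (D.F t)) s u = _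
    have d1 := (dπ.const_mul D.l₁).fun_smul (dd v)
    have d2 := (dg.const_mul D.l₂).fun_smul dP.differentiableAt
    rw [fderiv_fun_sub (dH.fun_add d1) d2, fderiv_fun_add dH d1,
      fderiv_fun_smul (dπ.const_mul D.l₁) (dd v),
      fderiv_fun_smul (dg.const_mul D.l₂) dP.differentiableAt]
    simp only [add_apply, sub_apply, smul_apply, ContinuousLinearMap.smulRight_apply,
      fderiv_const_mul dπ, fderiv_const_mul dg, smul_eq_mul, hg, hD.fderiv_π hs, dP.fderiv,
      fderiv_clm_apply_const (hD.diff_d hs)]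
    rfl
  have h7 : ∀ x y, D.gInd s x y = D.G (D.F s) (D.d s x) (D.d s y) := fun x y => rfl
  rw [hZ]
  simp only [ChartData.hessBar, ← h3 u v, covVec_apply, map_add, map_sub, map_smul, add_apply,
    sub_apply, smul_apply, smul_eq_mul, h7, ChartData.π]
  ring

variable [FiniteDimensional ℝ E']

/-- Differentiation of the defining relation of the induced connection. -/
theorem gInd_nabla_nabla (hs : s ∈ V) (u v w z : E') :
    D.gInd s (fderiv ℝ D.indCoeff s u v w + D.indCoeff s u (D.indCoeff s v w)) z
      = D.G (D.F s) (fderiv ℝ (fun t => D.hessBar t v w) s u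
          + Gam D.G (D.F s) (D.d s u) (D.hessBar s v w)) (D.d s z)
        + D.G (D.F s) (D.h s v w) (D.hess s u z)
        + D.l₁ * D.π s (D.d s (D.indCoeff s v w)) * D.gInd s u z
        - D.l₂ * D.gInd s u (D.indCoeff s v w) * D.π s (D.d s z) := by
  have hFs := hD.mapsTo s hs
  have hF : DifferentiableAt ℝ D.F s := (hD.smooth_F s hs).differentiableAt (by simp)
  have hdF : fderiv ℝ D.F s = D.d s := rfl
  have hC : DifferentiableAt ℝ D.indCoeff s := (hD.smooth_indCoeff hs).differentiableAt (by simp)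
  have hc : DifferentiableAt ℝ (fun t => D.indCoeff t v w) s :=
    (hC.clm_apply (differentiableAt_const v)).clm_apply (differentiableAt_const w)
  have hdz : DifferentiableAt ℝ (fun t => D.d t z) s :=
    (hD.smooth_d_apply hs z).differentiableAt (by simp)
  have hZ : DifferentiableAt ℝ (fun t => D.hessBar t v w) s :=
    (hD.smooth_hessBar hs v w).differentiableAt (by simp)
  -- On V the tangential part of `hessBar` and `hessBar` itself have the same inner product with
  -- dF(z); this identity is differentiated in direction u.
  have h1 := congrArg (fun L => L u) (fderiv_congr_on hD.isOpen_dom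
    (A := fun t => D.G (D.F t) (D.d t (D.indCoeff t v w)) (D.d t z))
    (B := fun t => D.G (D.F t) (D.hessBar t v w) (D.d t z))
    (fun t ht => hD.gInd_tan ht (D.hessBar t v w) z) hs)
  have h2 : fderiv ℝ (fun t => D.indCoeff t v w) s u = fderiv ℝ D.indCoeff s u v w := by
    rw [fderiv_bilin_apply hC (differentiableAt_const v) (differentiableAt_const w)]
    simp
  rw [hD.fderiv_inner_along hFs hF ((hD.diff_d hs).clm_apply hc) hdz,
    hD.fderiv_inner_along hFs hF hZ hdz, hdF, fderiv_clm_apply_apply (hD.diff_d hs) hc,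
    fderiv_clm_apply_const (hD.diff_d hs), h2] at h1
  have h3 : fderiv ℝ D.d s u z + Gam D.G (D.F s) (D.d s u) (D.d s z) = D.hess s u z := rfl
  have h4 : D.h s v w = D.hessBar s v w - D.d s (D.indCoeff s v w) := by
    rw [hD.h_eq hs]; rfl
  have h5 : fderiv ℝ D.d s u (D.indCoeff s v w) + D.d s (fderiv ℝ D.indCoeff s u v w)
      + Gam D.G (D.F s) (D.d s u) (D.d s (D.indCoeff s v w))
      = D.d s (fderiv ℝ D.indCoeff s u v w) + D.hess s u (D.indCoeff s v w) := by
    rw [ChartData.hess]; abel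
  have h6 := hD.gInd_tan hs (D.hessBar s u (D.indCoeff s v w)) z
  rw [← ChartData.indCoeff_apply] at h6
  have h7 : ∀ x y, D.gInd s x y = D.G (D.F s) (D.d s x) (D.d s y) := fun x y => rfl
  rw [h3, h5] at h1
  rw [map_add (D.gInd s), add_apply, h6, h4, h7 (fderiv ℝ D.indCoeff s u v w)]
  simp only [ChartData.hessBar, map_add, map_sub, map_smul, add_apply, sub_apply, smul_apply,
    smul_eq_mul, h7, ChartData.π] at h1 ⊢
  linarith

/-- The Gauss equation for the connection `∇̄`. -/
theorem gauss (hs : s ∈ V) (u v w z : E') :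
    D.R s u v w z = D.G (D.F s) (curv (Gam D.G) (D.F s) (D.d s u) (D.d s v) (D.d s w)) (D.d s z)
      + (D.G (D.F s) (D.h s v w) (D.h s u z) - D.G (D.F s) (D.h s u w) (D.h s v z))
      - (D.l₁ - D.l₂) * (D.π s (D.h s v w) * D.gInd s u z - D.π s (D.h s u w) * D.gInd s v z)
      + D.l₁ * (D.α (D.F s) (D.d s u) (D.d s w) * D.gInd s v z
        - D.α (D.F s) (D.d s v) (D.d s w) * D.gInd s u z)
      + D.l₂ * (D.gInd s u w * D.α (D.F s) (D.d s v) (D.d s z)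
        - D.gInd s v w * D.α (D.F s) (D.d s u) (D.d s z))
      + D.l₂ * (D.l₁ - D.l₂) * (D.gInd s u w * D.β (D.F s) (D.d s v) (D.d s z)
        - D.gInd s v w * D.β (D.F s) (D.d s u) (D.d s z)) := by
  have hFs := hD.mapsTo s hs
  -- Metric compatibility turns (∇̂_x π)(y) into g(∇̂_x P, y).
  have hα : ∀ x y, D.α (D.F s) x y = D.G (D.F s) (covVec (Gam D.G) D.P (D.F s) x) y
      - D.l₁ * (D.G (D.F s) (D.P (D.F s)) x * D.G (D.F s) (D.P (D.F s)) y)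
      + D.l₂ / 2 * (D.G (D.F s) x y * D.G (D.F s) (D.P (D.F s)) (D.P (D.F s))) := by
    intro x y
    rw [ChartData.α, hD.fderiv_inner hFs ((hD.smooth_P _ hFs).differentiableAt (by simp))
      (differentiableAt_const y)]
    simp [covDeriv, covVec_apply, Gam_apply]
  have h7 : ∀ x y, D.gInd s x y = D.G (D.F s) (D.d s x) (D.d s y) := fun x y => rfl
  have hN : ∀ x y w, D.G (D.F s) (D.h s x y) (D.d s w) = 0 := fun x y w => by
    rw [hD.h_eq hs, hD.G_nor hs]
  have hdc : ∀ v w, D.d s (D.indCoeff s v w) = D.hessBar s v w - D.h s v w := fun v w => by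
    rw [hD.h_eq hs, ChartData.nor, ChartData.indCoeff_apply, sub_sub_cancel]
  have hH : ∀ x y, D.hess s x y = D.hessBar s x y
      - (D.l₁ * D.π s (D.d s y)) • D.d s x + (D.l₂ * D.gInd s x y) • D.P (D.F s) := fun x y => by
    rw [ChartData.hessBar]; abel
  -- `h` is normal, so it sees only the normal part of `hess`, which is `h` plus a multiple of the
  -- normal part of P; this feeds the terms in π(h).
  have hn : ∀ v w u z, D.G (D.F s) (D.h s v w) (D.hess s u z) = D.G (D.F s) (D.h s v w) (D.h s u z)
      + D.l₂ * D.gInd s u z * D.π s (D.h s v w) := fun v w u z => by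
    have : D.hessBar s u z = D.d s (D.indCoeff s u z) + D.h s u z := by rw [hdc]; abel
    have hP : D.π s (D.h s v w) = D.G (D.F s) (D.h s v w) (D.P (D.F s)) := hD.symm _ hFs _ _
    rw [hH, this, hP]
    simp only [map_add, map_sub, map_smul, hN, smul_eq_mul]
    ring
  have hcurv : D.R s u v w z
      = D.gInd s (fderiv ℝ D.indCoeff s u v w + D.indCoeff s u (D.indCoeff s v w)) z
        - D.gInd s (fderiv ℝ D.indCoeff s v u w + D.indCoeff s v (D.indCoeff s u w)) z := by
    rw [ChartData.R, hD.curvatureAt_inducedNabla hs, curv]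
    simp only [map_add, map_sub, add_apply, sub_apply]
    ring
  have hcomm := congrArg (fun t => D.G (D.F s) t (D.d s z)) (hD.hess_comm hs u v w)
  simp only [map_sub, sub_apply] at hcomm
  rw [hcurv, hD.gInd_nabla_nabla hs, hD.gInd_nabla_nabla hs, hD.fderiv_hessBar hs,
    hD.fderiv_hessBar hs, ← hcomm, hn, hn, hD.hess_symm hs v u, h7 u (D.indCoeff s v w),
    h7 v (D.indCoeff s u w), hdc, hdc]
  simp only [hα, ChartData.β, ChartData.hessBar, ChartData.π, h7, map_add, map_sub, map_smul,
    add_apply, smul_eq_mul]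
  rw [hD.symm _ hFs (D.d s u) (D.h s v w), hD.symm _ hFs (D.d s v) (D.h s u w), hN, hN]
  rw [hD.symm _ hFs (D.d s u) (D.P (D.F s)), hD.symm _ hFs (D.d s v) (D.P (D.F s)),
    hD.symm _ hFs (D.d s v) (D.d s u)]
  rw [hD.symm _ hFs (D.d s u) (D.hess s v w), hD.symm _ hFs (D.d s v) (D.hess s u w)]
  ring

/-- The only part of `hessBar` that is not symmetric is l₁ π(v) dF(u), which is tangent and so has
no normal component. -/
theorem h_symm (hs : s ∈ V) (u v : E') : D.h s u v = D.h s v u := by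
  have h1 : ∀ (z : E) (a : ℝ) (u : E'), D.nor s (z + a • D.d s u) = D.nor s z := fun z a u => by
    simp only [ChartData.nor, ChartData.tan_add, ChartData.tan_smul, hD.tan_d hs, map_add, map_smul]
    abel
  have key : ∀ u v, D.h s u v
      = D.nor s (D.hess s u v - (D.l₂ * D.gInd s u v) • D.P (D.F s)) := fun u v => by
    rw [hD.h_eq hs, ChartData.hessBar, add_sub_right_comm, h1]
  rw [key, key, hD.hess_symm hs, hD.gInd_symm hs]

end IsImmersionOn

end GaussEquation

end ContactChen

namespace ContactChen

/-! ### Orthonormal frames, independence of traces from the frame, and extension of a pair. -/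

section OrthonormalFrames

variable {E W : Type*} [NormedAddCommGroup E] [NormedSpace ℝ E] [FiniteDimensional ℝ E]
  [AddCommGroup W] [Module ℝ W] {n : ℕ}

/-- `e` is an orthonormal basis for the inner product `g`. -/
structure IsFrame (g : E →L[ℝ] E →L[ℝ] ℝ) (e : Fin n → E) : Prop where
  symm : ∀ u v, g u v = g v u
  pos : ∀ u, u ≠ 0 → 0 < g u u
  ortho : ∀ i j, g (e i) (e j) = if i = j then 1 else 0
  dim : Module.finrank ℝ E = n

namespace IsFrame

variable {g : E →L[ℝ] E →L[ℝ] ℝ} {e e' : Fin n → E} (he : IsFrame g e)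
include he

theorem span_eq_top : Submodule.span ℝ (Set.range e) = ⊤ := by
  have hli : LinearIndependent ℝ e := by
    rw [Fintype.linearIndependent_iff]
    intro a ha i
    have h1 := congrArg (fun x => g x (e i)) ha
    simpa [map_sum, sum_apply, he.ortho] using h1
  exact hli.span_eq_top_of_card_eq_finrank' (by rw [Fintype.card_fin, he.dim])

theorem expand (x : E) : ∑ i, g x (e i) • e i = x := by
  set y := ∑ i, g x (e i) • e i - x with hy
  have h0 : ∀ j, g y (e j) = 0 := fun j => by
    simp [hy, map_sum, sum_apply, he.ortho]
  have h1 : ∀ z ∈ Submodule.span ℝ (Set.range e), g y z = 0 := by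
    intro z hz
    induction hz using Submodule.span_induction with
    | mem z hz => obtain ⟨j, rfl⟩ := hz; exact h0 j
    | zero => exact map_zero _
    | add a b _ _ ha hb => rw [map_add, ha, hb, add_zero]
    | smul c a _ ha => rw [map_smul, ha, smul_zero]
  have h2 : y = 0 := by
    by_contra hne
    exact (he.pos y hne).ne' (h1 y (by rw [he.span_eq_top]; trivial))
  exact sub_eq_zero.1 h2

theorem parseval (x y : E) : ∑ i, g x (e i) * g y (e i) = g x y := by
  conv_rhs => rw [← he.expand y]
  simp [map_sum, mul_comm]

theorem sum_diag_eq (he' : IsFrame g e') (T : E → E → W)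
    (add₁ : ∀ u u' v, T (u + u') v = T u v + T u' v) (smul₁ : ∀ (a : ℝ) u v, T (a • u) v = a • T u v)
    (add₂ : ∀ u v v', T u (v + v') = T u v + T u v') (smul₂ : ∀ (a : ℝ) u v, T u (a • v) = a • T u v) :
    ∑ i, T (e' i) (e' i) = ∑ i, T (e i) (e i) := by
  let L : E →ₗ[ℝ] E →ₗ[ℝ] W := LinearMap.mk₂ ℝ T add₁ smul₁ add₂ smul₂
  change ∑ i, L (e' i) (e' i) = ∑ i, L (e i) (e i)
  have h₁ : ∀ x y, L x y = ∑ k, g x (e k) • L (e k) y := fun x y => by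
    conv_lhs => rw [← he.expand x]
    simp
  have h₂ : ∀ x y, L y x = ∑ k, g x (e' k) • L y (e' k) := fun x y => by
    conv_lhs => rw [← he'.expand x]
    simp
  calc ∑ i, L (e' i) (e' i) = ∑ i, ∑ k, g (e' i) (e k) • L (e k) (e' i) :=
        Finset.sum_congr rfl fun i _ => h₁ _ _
    _ = ∑ i, L (e i) (e i) := by
        rw [Finset.sum_comm]
        refine Finset.sum_congr rfl fun k _ => ?_
        rw [h₂ (e k) (e k)]
        exact Finset.sum_congr rfl fun i _ => by rw [he.symm]

/-- The coordinates in the given frame are an isometry onto Euclidean space, where an orthonormal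
pair extends to an orthonormal basis. -/
theorem exists_frame_extending {p : Fin 2 → E} (hn : 2 ≤ n)
    (hp : ∀ i j, g (p i) (p j) = if i = j then 1 else 0) :
    ∃ q : Fin n → E, IsFrame g q ∧ q ⟨0, by omega⟩ = p 0 ∧ q ⟨1, by omega⟩ = p 1 := by
  let L : E → EuclideanSpace ℝ (Fin n) := fun x => WithLp.toLp 2 fun i => g x (e i)
  let M : EuclideanSpace ℝ (Fin n) → E := fun v => ∑ i, v i • e i
  have hML : ∀ x, M (L x) = x := he.expand
  have hL : ∀ x y, inner ℝ (L x) (L y) = g x y := fun x y => by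
    rw [← he.parseval x y]
    simp [L, PiLp.inner_apply, mul_comm]
  have hM : ∀ v w, g (M v) (M w) = inner ℝ v w := fun v w => by
    simp [M, map_sum, sum_apply, he.ortho, PiLp.inner_apply, mul_comm]
  let i₀ : Fin n := ⟨0, by omega⟩
  let i₁ : Fin n := ⟨1, by omega⟩
  have h01 : i₀ ≠ i₁ := by simp [i₀, i₁]
  -- Only the values at `i₀` and `i₁` matter; the others are placeholders replaced by the extension.
  let v : Fin n → EuclideanSpace ℝ (Fin n) := fun i => if i = i₀ then L (p 0) else L (p 1)
  have hv : Orthonormal ℝ (({i₀, i₁} : Set (Fin n)).domRestrict v) := by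
    rw [orthonormal_iff_ite]
    rintro ⟨i, hi⟩ ⟨j, hj⟩
    change inner ℝ (v i) (v j) = _
    have v0 : v i₀ = L (p 0) := if_pos rfl
    have v1 : v i₁ = L (p 1) := if_neg h01.symm
    rcases hi with rfl | rfl <;> rcases hj with rfl | rfl <;> simp only [v0, v1, hL, hp] <;>
      simp [Subtype.ext_iff, h01, h01.symm]
  obtain ⟨b, hb⟩ := hv.exists_orthonormalBasis_extension_of_card_eq (by simp)
  refine ⟨fun i => M (b i), ⟨he.symm, he.pos, fun i j => ?_, he.dim⟩, ?_, ?_⟩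
  · rw [hM, orthonormal_iff_ite.1 b.orthonormal]
  · change M (b i₀) = _
    rw [hb i₀ (by simp)]
    simp [v, hML]
  · change M (b i₁) = _
    rw [hb i₁ (by simp)]
    simp [v, hML, h01.symm]

end IsFrame

end OrthonormalFrames

/-! ### The algebraic inequality of Chen. -/

section ChenInequality

variable {E F : Type*} [NormedAddCommGroup E] [NormedSpace ℝ E] [FiniteDimensional ℝ E]
  [NormedAddCommGroup F] [NormedSpace ℝ F] {n : ℕ}

theorem sum_eq_pair_add {W : Type*} [AddCommGroup W] (f : Fin n → W) {i j : Fin n} (hij : i ≠ j) :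
    ∑ k, f k = f i + f j + ∑ k ∈ (Finset.univ.erase i).erase j, f k := by
  rw [← Finset.add_sum_erase _ _ (Finset.mem_univ i),
    ← Finset.add_sum_erase _ _ (Finset.mem_erase.2 ⟨hij.symm, Finset.mem_univ j⟩), add_assoc]

/-- Cauchy–Schwarz for the n - 1 vectors a_i + a_j and a_k with k different from i and j, in the
form that the sum of squared deviations from their mean is nonnegative. -/
theorem chen_diagonal {G : F →L[ℝ] F →L[ℝ] ℝ} (hs : ∀ u v, G u v = G v u) (hG : ∀ u, 0 ≤ G u u)
    (hn : 2 ≤ n) (a : Fin n → F) {i j : Fin n} (hij : i ≠ j) :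
    G (∑ k, a k) (∑ k, a k) / (n - 1) ≤ ∑ k, G (a k) (a k) + 2 * G (a i) (a j) := by
  set r := ∑ k, a k with hr
  have hN : (0 : ℝ) < n - 1 := by
    have : (2 : ℝ) ≤ n := by exact_mod_cast hn
    linarith
  -- The mean of the n - 1 vectors, since a_i + a_j counts as one.
  set m := ((n : ℝ) - 1)⁻¹ • r with hm
  let S : Finset (Fin n) := (Finset.univ.erase i).erase j
  have h1 : 0 ≤ G (a i + a j - m) (a i + a j - m) + ∑ k ∈ S, G (a k - m) (a k - m) :=
    add_nonneg (hG _) (Finset.sum_nonneg fun k _ => hG _)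
  have hcard : (S.card : ℝ) = n - 2 := by
    rw [Finset.card_erase_of_mem (Finset.mem_erase.2 ⟨hij.symm, Finset.mem_univ j⟩),
      Finset.card_erase_of_mem (Finset.mem_univ i), Finset.card_univ, Fintype.card_fin,
      Nat.sub_sub, Nat.cast_sub hn]
    norm_num
  have h2 : ∑ k ∈ S, G (a k - m) (a k - m)
      = ∑ k ∈ S, G (a k) (a k) - 2 * G m (∑ k ∈ S, a k) + (n - 2) * G m m := by
    have : ∀ k, G (a k - m) (a k - m) = G (a k) (a k) - 2 * G m (a k) + G m m := fun k => by
      simp only [map_sub, sub_apply]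
      rw [hs (a k) m]
      ring
    simp only [this, Finset.sum_add_distrib, Finset.sum_sub_distrib, Finset.sum_const, nsmul_eq_mul,
      hcard, map_sum, Finset.mul_sum]
  have h3 : r = a i + a j + ∑ k ∈ S, a k := sum_eq_pair_add a hij
  have h4 : G m r = G r r / (n - 1) := by
    rw [hm, map_smul, smul_apply, smul_eq_mul]
    field_simp
  have h5 : (n - 1) * G m m = G r r / (n - 1) := by
    rw [← h4]
    conv_rhs => rw [show r = ((n : ℝ) - 1) • m by rw [hm, smul_inv_smul₀ hN.ne']]
    simp
  rw [h2] at h1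
  rw [← h4, sum_eq_pair_add (fun k => G (a k) (a k)) hij]
  have h6 : G m r = G m (a i + a j) + G m (∑ k ∈ S, a k) := by rw [h3, map_add]
  simp only [map_sub, map_add, sub_apply, add_apply] at h1 h6
  rw [hs (a i) m, hs (a j) m, hs (a j) (a i)] at h1
  linarith

theorem chen_off_diagonal (f : Fin n → Fin n → ℝ) (hf : ∀ i j, 0 ≤ f i j) {i j : Fin n} (hij : i ≠ j) :
    ∑ k, f k k + f i j + f j i ≤ ∑ k, ∑ l, f k l := by
  have h1 : ∀ k, 0 ≤ ∑ l, f k l - f k k := fun k => by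
    have := Finset.single_le_sum (f := f k) (fun l _ => hf k l) (Finset.mem_univ k)
    linarith
  have h2 : ∀ k l, k ≠ l → f k l ≤ ∑ l, f k l - f k k := fun k l hkl => by
    rw [← Finset.add_sum_erase _ _ (Finset.mem_univ k), add_sub_cancel_left]
    exact Finset.single_le_sum (f := f k) (fun l _ => hf k l)
      (Finset.mem_erase.2 ⟨hkl.symm, Finset.mem_univ l⟩)
  have h3 : ∑ k, (∑ l, f k l - f k k) ≥ (∑ l, f i l - f i i) + (∑ l, f j l - f j j) := by
    rw [← Finset.add_sum_erase _ _ (Finset.mem_univ i)]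
    exact add_le_add_right (Finset.single_le_sum (f := fun k => ∑ l, f k l - f k k)
      (fun l _ => h1 l) (Finset.mem_erase.2 ⟨hij.symm, Finset.mem_univ j⟩)) _
  rw [Finset.sum_sub_distrib] at h3
  linarith [h2 i j hij, h2 j i hij.symm]

/-- Chen's inequality for a symmetric vector-valued bilinear form. -/
theorem IsFrame.chen {g : E →L[ℝ] E →L[ℝ] ℝ} {e : Fin n → E} (he : IsFrame g e)
    {G : F →L[ℝ] F →L[ℝ] ℝ} (hs : ∀ u v, G u v = G v u) (hG : ∀ u, 0 ≤ G u u) (hn : 3 ≤ n)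
    {B : E → E → F} (hBs : ∀ u v, B u v = B v u) (hadd : ∀ u u' v, B (u + u') v = B u v + B u' v)
    (hsmul : ∀ (a : ℝ) u v, B (a • u) v = a • B u v)
    {p : Fin 2 → E} (hp : ∀ i j, g (p i) (p j) = if i = j then 1 else 0) :
    1 / 2 * (G (∑ i, B (e i) (e i)) (∑ i, B (e i) (e i)) - ∑ i, ∑ j, G (B (e i) (e j)) (B (e i) (e j)))
      - (G (B (p 0) (p 0)) (B (p 1) (p 1)) - G (B (p 0) (p 1)) (B (p 0) (p 1)))
      ≤ (n - 2) / (2 * (n - 1)) * G (∑ i, B (e i) (e i)) (∑ i, B (e i) (e i)) := by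
  have hadd' : ∀ u v v', B u (v + v') = B u v + B u v' := fun u v v' => by
    rw [hBs, hadd, hBs v, hBs v']
  have hsmul' : ∀ (a : ℝ) u v, B u (a • v) = a • B u v := fun a u v => by
    rw [hBs, hsmul, hBs v]
  obtain ⟨q, hq, h0, h1⟩ := he.exists_frame_extending (by omega) hp
  have t1 := he.sum_diag_eq hq B hadd hsmul hadd' hsmul'
  have t2 : ∑ i, ∑ j, G (B (e i) (e j)) (B (e i) (e j))
      = ∑ i, ∑ j, G (B (q i) (q j)) (B (q i) (q j)) := by
    have a1 : ∀ x, ∑ j, G (B x (q j)) (B x (q j)) = ∑ j, G (B x (e j)) (B x (e j)) := fun x =>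
      he.sum_diag_eq hq (fun u v => G (B x u) (B x v)) (by simp [hadd']) (by simp [hsmul'])
        (by simp [hadd']) (by simp [hsmul'])
    simp only [a1]
    exact (he.sum_diag_eq hq (fun u v => ∑ j, G (B u (e j)) (B v (e j)))
      (by simp [hadd, Finset.sum_add_distrib]) (by simp [hsmul, Finset.mul_sum])
      (by simp [hadd, Finset.sum_add_distrib]) (by simp [hsmul, Finset.mul_sum])).symm
  rw [t2, ← t1, ← h0, ← h1]
  have hne : (⟨0, by omega⟩ : Fin n) ≠ ⟨1, by omega⟩ := by simp
  -- The two bounds add up: the first controls the diagonal entries h_kk, the second discards every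
  -- off-diagonal entry other than (0, 1) and (1, 0).
  have c1 := chen_diagonal hs hG (by omega) (fun i => B (q i) (q i)) hne
  have c2 := chen_off_diagonal (fun i j => G (B (q i) (q j)) (B (q i) (q j))) (fun i j => hG _) hne
  simp only [hBs (q ⟨1, _⟩) (q ⟨0, _⟩)] at c2
  have hN : (0 : ℝ) < n - 1 := by
    have : (3 : ℝ) ≤ n := by exact_mod_cast hn
    linarith
  set r := G (∑ i, B (q i) (q i)) (∑ i, B (q i) (q i))
  have e1 : ((n : ℝ) - 2) / (2 * (n - 1)) * r = 1 / 2 * (r - r / (n - 1)) := by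
    field_simp
    ring
  rw [e1]
  linarith

theorem sum_Ioi_eq (X : Fin n → Fin n → ℝ) (hX : ∀ i j, X i j = X j i) :
    ∑ i, ∑ j ∈ Finset.Ioi i, X i j = 1 / 2 * (∑ i, ∑ j, X i j - ∑ i, X i i) := by
  have h1 : ∀ i, ∑ j, X i j = ∑ j ∈ Finset.Ioi i, X i j + X i i + ∑ j ∈ Finset.Iio i, X i j := by
    intro i
    have : (Finset.univ : Finset (Fin n)) = (Finset.Ioi i ∪ {i}) ∪ Finset.Iio i := by
      ext j
      simp only [Finset.mem_univ, Finset.mem_union, Finset.mem_Ioi, Finset.mem_singleton,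
        Finset.mem_Iio, true_iff]
      omega
    rw [this, Finset.sum_union, Finset.sum_union, Finset.sum_singleton]
    · simp
    · rw [Finset.disjoint_left]
      intro j
      simp only [Finset.mem_union, Finset.mem_Ioi, Finset.mem_singleton, Finset.mem_Iio]
      omega
  have h2 : ∑ i, ∑ j ∈ Finset.Iio i, X i j = ∑ i, ∑ j ∈ Finset.Ioi i, X i j := by
    rw [Finset.sum_comm' (t' := Finset.univ) (s' := fun j => Finset.Ioi j) (by simp)]
    exact Finset.sum_congr rfl fun i _ => Finset.sum_congr rfl fun j _ => hX j i
  simp only [h1, Finset.sum_add_distrib, h2]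
  ring

end ChenInequality

end ContactChen

/-! ### Chen's inequality for an immersion between coordinate domains. -/

namespace ContactChen

/-- The summand is symmetric in i and j, so the sum over i < j is half of the full double sum minus
the diagonal; on the diagonal everything cancels except c₁ + 2 b_i, whence the factors n(n - 1) and
n - 1. -/
theorem sum_Ioi_sectional {n : ℕ} (f H K N M : Fin n → Fin n → ℝ) (a b : Fin n → ℝ) (c₁ c₂ m : ℝ)
    (hf : ∀ i j, f i j = - f j i) (hH : ∀ i j, H i j = H j i) (hK : ∀ i j, K i j = K j i)
    (hN : ∀ i j, N i j = N j i) (hM : ∀ i j, M i j = M j i) (hNM : ∀ i, M i i = N i i) :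
    ∑ i, ∑ j ∈ Finset.Ioi i, (c₁ + c₂ * f i j ^ 2 + (b i + b j)
        + 1 / 2 * (H j j * H i i - H i j ^ 2 + K i j ^ 2 - K j j * K i i)
        + m * (2 * (a i * a j * H i j) - a j ^ 2 * H i i - a i ^ 2 * H j j) + (M i j - N i j))
      = c₁ * (n * (n - 1)) / 2 + c₂ / 2 * ∑ i, ∑ j, f i j ^ 2 + (n - 1) * ∑ i, b i
        + 1 / 4 * ((∑ i, H i i) ^ 2 - ∑ i, ∑ j, H i j ^ 2 + ∑ i, ∑ j, K i j ^ 2 - (∑ i, K i i) ^ 2)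
        + m * (∑ i, ∑ j, a i * a j * H i j - (∑ i, a i ^ 2) * ∑ i, H i i)
        + 1 / 2 * (∑ i, ∑ j, M i j - ∑ i, ∑ j, N i j) := by
  rw [sum_Ioi_eq]
  · have hf0 : ∀ i, f i i = 0 := fun i => by linarith [hf i i]
    have d : ∀ i, (c₁ + c₂ * f i i ^ 2 + (b i + b i)
        + 1 / 2 * (H i i * H i i - H i i ^ 2 + K i i ^ 2 - K i i * K i i)
        + m * (2 * (a i * a i * H i i) - a i ^ 2 * H i i - a i ^ 2 * H i i) + (M i i - N i i))
        = c₁ + 2 * b i := fun i => by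
      rw [hf0, hNM]; ring
    simp only [d, Finset.sum_add_distrib, Finset.sum_sub_distrib, ← Finset.mul_sum,
      ← Finset.sum_mul, Finset.sum_const, Finset.card_univ, Fintype.card_fin, nsmul_eq_mul]
    ring
  · intro i j
    rw [hf i j, hH i j, hK i j, hN i j, hM i j]
    ring

section LocalInequality

variable {E E' : Type*} [NormedAddCommGroup E] [NormedSpace ℝ E]
  [NormedAddCommGroup E'] [NormedSpace ℝ E']
  {V : Set E'} {U : Set E} {D : ChartData E' E} {κ μ c : ℝ} {s : E'}

namespace IsImmersionOn

variable (hD : IsImmersionOn V U D)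
include hD

section

variable [FiniteDimensional ℝ E]

theorem h_add_left (hs : s ∈ V) (u u' v : E') : D.h s (u + u') v = D.h s u v + D.h s u' v := by
  rw [hD.h_eq hs, hD.h_eq hs, hD.h_eq hs, ChartData.hessBar_add_left]
  simp only [ChartData.nor, ChartData.tan_add, map_add]
  abel

theorem h_smul_left (hs : s ∈ V) (a : ℝ) (u v : E') : D.h s (a • u) v = a • D.h s u v := by
  rw [hD.h_eq hs, hD.h_eq hs, ChartData.hessBar_smul_left]
  simp only [ChartData.nor, ChartData.tan_smul, map_smul, smul_sub]

end

variable [FiniteDimensional ℝ E']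

theorem gInd_Phat (hs : s ∈ V) (u v : E') :
    D.gInd s u (D.Phat s v) = D.G (D.F s) (D.d s u) (D.φ (D.F s) (D.d s v)) := by
  rw [hD.gInd_symm hs, ChartData.Phat, hD.gInd_tan hs, hD.symm _ (hD.mapsTo s hs)]

variable (hA : IsAlmostContactOn U D.G D.φ D.ξ D.η)
include hA

theorem ηM_eq (hs : s ∈ V) (u : E') : D.ηM s u = D.gInd s (D.ξT s) u := by
  rw [ChartData.ξT, hD.gInd_tan hs, ChartData.ηM, ← hA.g_ξ _ (hD.mapsTo s hs),
    hD.symm _ (hD.mapsTo s hs)]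

variable [FiniteDimensional ℝ E]

variable (hF : IsKappaMuSpaceFormOn U D.G D.φ D.ξ D.η κ μ c)
include hF

theorem gInd_h'T (hs : s ∈ V) (u v : E') : D.gInd s (D.h'T s u) v
    = D.G (D.F s) (D.φ (D.F s) (shapeS D.G D.φ D.ξ (D.F s) (D.d s u))) (D.d s v) := by
  rw [ChartData.h'T, hD.gInd_tan hs, ChartData.h', hA.hPrime_eq hF (hD.mapsTo s hs)]

theorem gInd_φh'T (hs : s ∈ V) (u v : E') : D.gInd s (D.φh'T s u) v
    = - D.G (D.F s) (shapeS D.G D.φ D.ξ (D.F s) (D.d s u)) (D.d s v) := by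
  have hFs := hD.mapsTo s hs
  rw [ChartData.φh'T, hD.gInd_tan hs, ChartData.h', hA.hPrime_eq hF hFs,
    (hA.almostContactAt hFs).φ_sq_of_perp]
  · simp
  · rw [hA.shapeS_symm hF hFs, hA.shapeS_ξ hF hFs, map_zero]

theorem h'T_symm (hs : s ∈ V) (u v : E') : D.gInd s (D.h'T s u) v = D.gInd s (D.h'T s v) u := by
  have hFs := hD.mapsTo s hs
  rw [hD.gInd_h'T hA hF hs, hD.gInd_h'T hA hF hs]
  exact φS_symm (hA.almostContactAt hFs) (hA.shapeS_symm hF hFs) (hA.shapeS_φ hF hFs) _ _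

theorem φh'T_symm (hs : s ∈ V) (u v : E') :
    D.gInd s (D.φh'T s u) v = D.gInd s (D.φh'T s v) u := by
  have hFs := hD.mapsTo s hs
  rw [hD.gInd_φh'T hA hF hs, hD.gInd_φh'T hA hF hs, hA.shapeS_symm hF hFs, hA.symm _ hFs]

/-- The sectional curvature of the induced connection. -/
theorem K_eq (hs : s ∈ V) {u v : E'} (hu : D.gInd s u u = 1) (hv : D.gInd s v v = 1)
    (huv : D.gInd s u v = 0) {b : E' → ℝ}
    (hb : ∀ u, b u = -((c + 3 - 4 * κ) / 4 * D.ηM s u ^ 2) + D.gInd s (D.h'T s u) u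
      - (D.l₁ + D.l₂) / 2 * D.α (D.F s) (D.d s u) (D.d s u)
      - D.l₂ * (D.l₁ - D.l₂) / 2 * D.β (D.F s) (D.d s u) (D.d s u)
      - (D.l₁ - D.l₂) / 2 * D.π s (D.h s u u)) :
    D.K s u v = (c + 3) / 4 + 3 * (c - 1) / 4 * D.gInd s u (D.Phat s v) ^ 2 + (b u + b v)
      + 1 / 2 * (D.gInd s (D.h'T s v) v * D.gInd s (D.h'T s u) u - D.gInd s (D.h'T s u) v ^ 2
        + D.gInd s (D.φh'T s u) v ^ 2 - D.gInd s (D.φh'T s v) v * D.gInd s (D.φh'T s u) u)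
      + (1 - μ) * (2 * (D.ηM s u * D.ηM s v * D.gInd s (D.h'T s u) v)
        - D.ηM s v ^ 2 * D.gInd s (D.h'T s u) u - D.ηM s u ^ 2 * D.gInd s (D.h'T s v) v)
      + (D.G (D.F s) (D.h s u u) (D.h s v v) - D.G (D.F s) (D.h s u v) (D.h s u v)) := by
  have hFs := hD.mapsTo s hs
  have hvu : D.gInd s v u = 0 := by rw [hD.gInd_symm hs, huv]
  have hC := hA.almostContactAt hFs
  -- The Gauss equation at (v, u) and at (u, v) in the last two slots places l₁ and l₂ on opposite
  -- vectors; the mean in `K` gives the symmetric factor (l₁ + l₂)/2.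
  have g1 := hD.gauss hs u v v u
  have g2 := hD.gauss hs u v u v
  rw [hu, hv, huv, hvu, hD.h_symm hs v u] at g1
  rw [hu, hv, huv, hvu, hD.h_symm hs v u, hA.curv_skew hFs, hA.symm _ hFs (D.d s u)] at g2
  have hsec := hA.sectional hF hFs (D.d s u) (D.d s v)
  have e1 := hD.gInd_Phat hs u v
  have a1 : ∀ x, D.ηM s x = D.G (D.F s) (D.d s x) (D.ξ (D.F s)) := fun x =>
    (hA.g_ξ _ hFs _).symm
  have h7 : ∀ x y, D.G (D.F s) (D.d s x) (D.d s y) = D.gInd s x y := fun x y => rfl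
  have sS : ∀ x y, D.G (D.F s) (shapeS D.G D.φ D.ξ (D.F s) (D.d s x)) (D.d s y)
      = - D.gInd s (D.φh'T s x) y := fun x y => by rw [hD.gInd_φh'T hA hF hs, neg_neg]
  have sφ : D.G (D.F s) (D.φ (D.F s) (D.d s v)) (D.d s u) = D.gInd s u (D.Phat s v) := by
    rw [e1, hA.symm _ hFs]
  have z : ∀ x, D.G (D.F s) x (D.φ (D.F s) x) = 0 := fun x => by
    have h1 := hC.skew x x
    rw [hC.symm (D.φ (D.F s) x)] at h1
    linarith
  simp only [modelCurv, ← a1, h7, hu, hv, huv, hvu, ← hD.gInd_h'T hA hF hs, sS, sφ, ← e1, z] at hsec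
  rw [hD.h'T_symm hA hF hs v u, hD.φh'T_symm hA hF hs v u] at hsec
  rw [ChartData.K, g1, g2, hsec, hb, hb, hA.symm _ hFs (D.h s v v)]
  ring

/-- Chen's inequality in a coordinate domain. -/
theorem tau_sub_K_le (hs : s ∈ V) {n : ℕ} (hn : 3 ≤ n) {e : Fin n → E'} {p : Fin 2 → E'}
    (he : IsFrame (D.gInd s) e)
    (hp : ∀ i j, D.gInd s (p i) (p j) = if i = j then 1 else 0) :
    D.τ s e - D.K s (p 0) (p 1) ≤
      ((n : ℝ) + 1) * ((n : ℝ) - 2) / 2 * ((c + 3) / 4)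
      + (c + 3 - 4 * κ) / 4 * (-((n : ℝ) - 1) * D.gInd s (D.ξT s) (D.ξT s) + D.γ s p)
      + (c - 1) / 8 * (3 * D.normSq s e (D.Phat s) - 6 * D.βPlane s p)
      + 1 / 4 * (D.normSq s e (D.φh'T s) - D.normSq s e (D.h'T s)
          + |D.tr s e (D.h'T s)| ^ 2 - |D.tr s e (D.φh'T s)| ^ 2)
      - 1 / 2 * (D.det₂ s p (D.h'T s) - D.det₂ s p (D.φh'T s))
      + ((n : ℝ) - 1) * D.tr s e (D.h'T s) - D.tr s p (D.h'T s)
      + (1 - μ) * (D.gInd s (D.ξT s) (D.h'T s (D.ξT s))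
          - D.tr s e (D.h'T s) * D.gInd s (D.ξT s) (D.ξT s) + D.θ s p)
      - (D.l₁ + D.l₂) / 2 * ((n : ℝ) - 1) * D.trForm s e D.α
      - D.l₂ / 2 * (D.l₁ - D.l₂) * ((n : ℝ) - 1) * D.trForm s e D.β
      - (D.l₁ - D.l₂) / 2 * ((n : ℝ) - 1) * n * D.π s (D.H s e)
      + (D.l₁ + D.l₂) / 2 * D.trForm s p D.α
      + D.l₂ * (D.l₁ - D.l₂) / 2 * D.trForm s p D.β
      + (D.l₁ - D.l₂) / 2 * D.π s (∑ i, D.h s (p i) (p i))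
      + (n : ℝ) ^ 2 * ((n : ℝ) - 2) / (2 * ((n : ℝ) - 1))
          * D.G (D.F s) (D.H s e) (D.H s e) := by
  have hFs := hD.mapsTo s hs
  have hC := hA.almostContactAt hFs
  have hn0 : (n : ℝ) ≠ 0 := by
    have : n ≠ 0 := by omega
    exact_mod_cast this
  set b : E' → ℝ := fun u => -((c + 3 - 4 * κ) / 4 * D.ηM s u ^ 2) + D.gInd s (D.h'T s u) u
      - (D.l₁ + D.l₂) / 2 * D.α (D.F s) (D.d s u) (D.d s u)
      - D.l₂ * (D.l₁ - D.l₂) / 2 * D.β (D.F s) (D.d s u) (D.d s u)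
      - (D.l₁ - D.l₂) / 2 * D.π s (D.h s u u) with hb
  have hPhat : ∀ u v, D.gInd s u (D.Phat s v) = - D.gInd s v (D.Phat s u) := fun u v => by
    rw [hD.gInd_Phat hs, hD.gInd_Phat hs, hA.skew _ hFs, hA.symm _ hFs]
  have hτ : D.τ s e = _ := (Finset.sum_congr rfl fun i _ => Finset.sum_congr rfl fun j hj =>
    hD.K_eq hA hF hs (b := b) (by rw [he.ortho]; simp) (by rw [he.ortho]; simp)
      (by rw [he.ortho, if_neg (Finset.mem_Ioi.1 hj).ne]) fun u => rfl).trans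
    (sum_Ioi_sectional (fun i j => D.gInd s (e i) (D.Phat s (e j)))
      (fun i j => D.gInd s (D.h'T s (e i)) (e j)) (fun i j => D.gInd s (D.φh'T s (e i)) (e j))
      (fun i j => D.G (D.F s) (D.h s (e i) (e j)) (D.h s (e i) (e j)))
      (fun i j => D.G (D.F s) (D.h s (e i) (e i)) (D.h s (e j) (e j)))
      (fun i => D.ηM s (e i)) (fun i => b (e i)) ((c + 3) / 4) (3 * (c - 1) / 4) (1 - μ)
      (fun i j => hPhat _ _) (fun i j => hD.h'T_symm hA hF hs _ _)
      (fun i j => hD.φh'T_symm hA hF hs _ _) (fun i j => by rw [hD.h_symm hs])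
      (fun i j => hA.symm _ hFs _ _) (fun i => rfl))
  have hK := hD.K_eq hA hF hs (b := b) (u := p 0) (v := p 1) (by rw [hp]; simp) (by rw [hp]; simp)
    (by rw [hp]; simp) fun u => rfl
  -- The estimate uses only that the ambient metric is nonnegative and that `h` is a symmetric
  -- bilinear form; this is the one inequality in the proof.
  have hchen := he.chen (G := D.G (D.F s)) (hA.symm _ hFs)
    (fun u => by
      by_cases h : u = 0
      · simp [h]
      · exact (hA.pos _ hFs u h).le) hn (hD.h_symm hs) (hD.h_add_left hs) (hD.h_smul_left hs) hp
  have hξ : ∑ i, D.ηM s (e i) ^ 2 = D.gInd s (D.ξT s) (D.ξT s) := by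
    rw [← he.parseval]
    exact Finset.sum_congr rfl fun i _ => by rw [hD.ηM_eq hA hs, sq]
  have hξe : ∑ i, D.ηM s (e i) • e i = D.ξT s := by
    simp only [hD.ηM_eq hA hs, he.expand]
  have hξh : ∑ i, ∑ j, D.ηM s (e i) * D.ηM s (e j) * D.gInd s (D.h'T s (e i)) (e j)
      = D.gInd s (D.ξT s) (D.h'T s (D.ξT s)) := by
    rw [hD.gInd_symm hs (D.ξT s)]
    simp only [hD.gInd_h'T hA hF hs]
    rw [← hξe]
    simp only [map_sum, map_smul, sum_apply, smul_apply, smul_eq_mul, Finset.mul_sum]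
    rw [Finset.sum_comm]
    exact Finset.sum_congr rfl fun i _ => Finset.sum_congr rfl fun j _ => by ring
  have n1 : D.normSq s e (D.Phat s) = ∑ i, ∑ j, D.gInd s (e i) (D.Phat s (e j)) ^ 2 := rfl
  have n2 : D.normSq s e (D.h'T s) = ∑ i, ∑ j, D.gInd s (D.h'T s (e i)) (e j) ^ 2 := by
    simp only [ChartData.normSq]
    exact Finset.sum_congr rfl fun i _ => Finset.sum_congr rfl fun j _ => by
      rw [hD.gInd_symm hs, hD.h'T_symm hA hF hs]
  have n3 : D.normSq s e (D.φh'T s) = ∑ i, ∑ j, D.gInd s (D.φh'T s (e i)) (e j) ^ 2 := by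
    simp only [ChartData.normSq]
    exact Finset.sum_congr rfl fun i _ => Finset.sum_congr rfl fun j _ => by
      rw [hD.gInd_symm hs, hD.φh'T_symm hA hF hs]
  have t1 : D.tr s e (D.h'T s) = ∑ i, D.gInd s (D.h'T s (e i)) (e i) := rfl
  have t2 : D.tr s e (D.φh'T s) = ∑ i, D.gInd s (D.φh'T s (e i)) (e i) := rfl
  have hbs : ∑ i, b (e i) = -((c + 3 - 4 * κ) / 4 * D.gInd s (D.ξT s) (D.ξT s))
      + D.tr s e (D.h'T s) - (D.l₁ + D.l₂) / 2 * D.trForm s e D.α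
      - D.l₂ * (D.l₁ - D.l₂) / 2 * D.trForm s e D.β
      - (D.l₁ - D.l₂) / 2 * (n * D.π s (D.H s e)) := by
    have hπ : n * D.π s (D.H s e) = ∑ i, D.π s (D.h s (e i) (e i)) := by
      simp only [ChartData.π, ChartData.H, map_smul, map_sum, smul_eq_mul]
      field_simp
    rw [hπ, ← hξ, t1]
    simp only [hb, Finset.sum_add_distrib, Finset.sum_sub_distrib, Finset.sum_neg_distrib,
      ← Finset.mul_sum, ChartData.trForm]
  -- The factor n² is absorbed by n H, the trace of `h`.
  have hH : (n : ℝ) ^ 2 * ((n : ℝ) - 2) / (2 * ((n : ℝ) - 1)) * D.G (D.F s) (D.H s e) (D.H s e)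
      = (n - 2) / (2 * (n - 1)) * D.G (D.F s) (∑ i, D.h s (e i) (e i)) (∑ i, D.h s (e i) (e i)) := by
    simp only [ChartData.H, map_smul, smul_apply, smul_eq_mul]
    field_simp
  have hM : ∑ i, ∑ j, D.G (D.F s) (D.h s (e i) (e i)) (D.h s (e j) (e j))
      = D.G (D.F s) (∑ i, D.h s (e i) (e i)) (∑ i, D.h s (e i) (e i)) := by
    simp only [map_sum, sum_apply]
    rw [Finset.sum_comm]
  rw [hH, hτ, hK, hbs, hξ, hξh, hM, ← n1, ← n2, ← n3, ← t1, ← t2, sq_abs, sq_abs]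
  have q1 : D.βPlane s p = D.gInd s (p 0) (D.Phat s (p 1)) ^ 2 := by
    rw [ChartData.βPlane, hD.gInd_symm hs, hPhat, neg_sq]
  have q2 : D.det₂ s p (D.h'T s) = D.gInd s (D.h'T s (p 1)) (p 1) * D.gInd s (D.h'T s (p 0)) (p 0)
      - D.gInd s (D.h'T s (p 0)) (p 1) ^ 2 := by
    rw [ChartData.det₂, Matrix.det_fin_two]
    simp only [Matrix.of_apply]
    rw [hD.h'T_symm hA hF hs (p 1) (p 0)]
    ring
  have q3 : D.det₂ s p (D.φh'T s) = D.gInd s (D.φh'T s (p 1)) (p 1) * D.gInd s (D.φh'T s (p 0)) (p 0)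
      - D.gInd s (D.φh'T s (p 0)) (p 1) ^ 2 := by
    rw [ChartData.det₂, Matrix.det_fin_two]
    simp only [Matrix.of_apply]
    rw [hD.φh'T_symm hA hF hs (p 1) (p 0)]
    ring
  have q4 : D.π s (∑ i, D.h s (p i) (p i)) = D.π s (D.h s (p 0) (p 0)) + D.π s (D.h s (p 1) (p 1)) := by
    rw [Fin.sum_univ_two, ChartData.π, map_add]
    rfl
  rw [q1, q2, q3, q4]
  -- Subtracting K(Π) from the sum turns the constant n(n - 1)/2 into n(n - 1)/2 - 1 = (n + 1)(n -
  -- 2)/2 and produces all the terms in p; `hchen` bounds the remaining part in `h`.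
  simp only [ChartData.trForm, ChartData.tr, Fin.sum_univ_two, ChartData.γ, ChartData.θ, hb] at hchen ⊢
  linarith

end IsImmersionOn

end LocalInequality

end ContactChen

namespace ContactChen

/-! ### Smoothness of tensor fields read in a chart. -/

section Chart

variable {d : ℕ} {N : Type*} [TopologicalSpace N] [ChartedSpace (Model d) N]
  [IsManifold (𝓡 d) ∞ N] {x₀ : N} {y : Model d}

theorem coord_frame (hy : y ∈ (chartAt (Model d) x₀).target) (u : Model d) :
    coord (chartAt (Model d) x₀) ((chartAt (Model d) x₀).symm y)
      (frame (chartAt (Model d) x₀) y u) = u :=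
  DFunLike.congr_fun
    ((mdifferentiable_chart (I := 𝓡 d) x₀).comp_symm_deriv hy) u

theorem frame_coord (hy : y ∈ (chartAt (Model d) x₀).target)
    (v : TangentSpace (𝓡 d) ((chartAt (Model d) x₀).symm y)) :
    frame (chartAt (Model d) x₀) y
      (coord (chartAt (Model d) x₀) ((chartAt (Model d) x₀).symm y) v) = v := by
  have h := DFunLike.congr_fun ((mdifferentiable_chart (I := 𝓡 d) x₀).symm_comp_deriv
    ((chartAt (Model d) x₀).map_target hy)) v
  rw [(chartAt (Model d) x₀).right_inv hy] at h
  exact h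

/-- Bundle smoothness is stated through trivializations; on a chart domain the tangent
trivialization is the differential of the chart, so its fibre coordinates are those of `coord`. -/
theorem trivializationAt_snd {p : N} (hp : p ∈ (chartAt (Model d) x₀).source)
    (v : TangentSpace (𝓡 d) p) :
    (trivializationAt (Model d) (TangentSpace (𝓡 d)) x₀ ⟨p, v⟩).2
      = coord (chartAt (Model d) x₀) p v := by
  have : IsManifold (𝓡 d) 1 N := IsManifold.of_le (n := ∞) (by simp)
  have h := TangentBundle.continuousLinearMapAt_trivializationAt (I := 𝓡 d) (𝕜 := ℝ) hp
  have h' := DFunLike.congr_fun h v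
  rw [Bundle.Trivialization.continuousLinearMapAt_apply,
    Bundle.Trivialization.coe_linearMapAt_of_mem _ (by simpa using hp)] at h'
  exact h'

theorem contMDiffAt_chart_symm (hy : y ∈ (chartAt (Model d) x₀).target) :
    ContMDiffAt (𝓡 d) (𝓡 d) ∞ (chartAt (Model d) x₀).symm y :=
  (contMDiffOn_chart_symm (I := 𝓡 d) (n := ∞) (x := x₀)).contMDiffAt
    ((chartAt (Model d) x₀).open_target.mem_nhds hy)

/-- A vector field along the inverse of a chart is smooth iff its coordinates are. -/
theorem contMDiffAt_along_symm_iff (hy : y ∈ (chartAt (Model d) x₀).target)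
    (σ : ∀ z : Model d, TangentSpace (𝓡 d) ((chartAt (Model d) x₀).symm z)) :
    ContMDiffAt (𝓡 d) (𝓡 d).tangent ∞
        (fun z => (⟨(chartAt (Model d) x₀).symm z, σ z⟩ : TangentBundle (𝓡 d) N)) y ↔
      ContDiffAt ℝ ∞ (fun z => coord (chartAt (Model d) x₀)
        ((chartAt (Model d) x₀).symm z) (σ z)) y := by
  have hsrc := (chartAt (Model d) x₀).map_target hy
  rw [(trivializationAt (Model d) (TangentSpace (𝓡 d)) x₀).contMDiffAt_iff (by
    rw [Bundle.Trivialization.mem_source]; simpa using hsrc), ← contMDiffAt_iff_contDiffAt]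
  refine (and_iff_right (contMDiffAt_chart_symm hy)).trans (Filter.EventuallyEq.contMDiffAt_iff ?_)
  filter_upwards [(chartAt (Model d) x₀).open_target.mem_nhds hy] with z hz
  exact trivializationAt_snd ((chartAt (Model d) x₀).map_target hz) _

theorem contMDiffAt_frame (hy : y ∈ (chartAt (Model d) x₀).target) (u : Model d) :
    ContMDiffAt (𝓡 d) (𝓡 d).tangent ∞
      (fun z => (⟨(chartAt (Model d) x₀).symm z, frame (chartAt (Model d) x₀) z u⟩ :
        TangentBundle (𝓡 d) N)) y := by
  rw [contMDiffAt_along_symm_iff hy]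
  refine (contDiffAt_const (c := u)).congr_of_eventuallyEq ?_
  filter_upwards [(chartAt (Model d) x₀).open_target.mem_nhds hy] with z hz
  exact coord_frame hz u

theorem contDiffAt_vectorIn {X : ∀ p : N, TangentSpace (𝓡 d) p}
    (hX : ContMDiff (𝓡 d) (𝓡 d).tangent ∞ (fun p => (⟨p, X p⟩ : TangentBundle (𝓡 d) N)))
    (hy : y ∈ (chartAt (Model d) x₀).target) :
    ContDiffAt ℝ ∞ (vectorIn (chartAt (Model d) x₀) X) y :=
  (contMDiffAt_along_symm_iff hy _).1
    (hX.contMDiffAt.comp y (contMDiffAt_chart_symm hy))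

/-- In finite dimension smoothness may be tested on constant vectors, and applying the field to the
smooth coordinate frame gives a smooth vector field along the inverse chart. One-forms and metrics
are treated in the same way. -/
theorem contDiffAt_endoIn
    {A : ∀ p : N, TangentSpace (𝓡 d) p →L[ℝ] TangentSpace (𝓡 d) p}
    (hA : ContMDiff (𝓡 d) ((𝓡 d).prod 𝓘(ℝ, Model d →L[ℝ] Model d)) ∞
      (fun p => Bundle.TotalSpace.mk' (Model d →L[ℝ] Model d)
        (E := fun p : N => TangentSpace (𝓡 d) p →L[ℝ] TangentSpace (𝓡 d) p) p (A p)))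
    (hy : y ∈ (chartAt (Model d) x₀).target) :
    ContDiffAt ℝ ∞ (endoIn (chartAt (Model d) x₀) A) y := by
  refine contDiffAt_clm_of_apply fun u => ?_
  refine (contMDiffAt_along_symm_iff hy
    (fun z => A ((chartAt (Model d) x₀).symm z) (frame (chartAt (Model d) x₀) z u))).1 ?_
  exact ContMDiffAt.clm_bundle_apply (F₁ := Model d) (F₂ := Model d)
    (E₁ := fun p : N => TangentSpace (𝓡 d) p) (E₂ := fun p : N => TangentSpace (𝓡 d) p)
    (b := (chartAt (Model d) x₀).symm)
    (hA.contMDiffAt.comp y (contMDiffAt_chart_symm hy)) (contMDiffAt_frame hy u)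

theorem contDiffAt_oneFormIn {a : ∀ p : N, TangentSpace (𝓡 d) p →L[ℝ] ℝ}
    (ha : ContMDiff (𝓡 d) ((𝓡 d).prod 𝓘(ℝ, Model d →L[ℝ] ℝ)) ∞
      (fun p => Bundle.TotalSpace.mk' (Model d →L[ℝ] ℝ)
        (E := fun p : N => TangentSpace (𝓡 d) p →L[ℝ] ℝ) p (a p)))
    (hy : y ∈ (chartAt (Model d) x₀).target) :
    ContDiffAt ℝ ∞ (oneFormIn (chartAt (Model d) x₀) a) y := by
  refine contDiffAt_clm_of_apply fun u => ?_
  have h : ContMDiffAt (𝓡 d) ((𝓡 d).prod 𝓘(ℝ, ℝ)) ∞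
      (fun z => Bundle.TotalSpace.mk' ℝ (E := Bundle.Trivial N ℝ) ((chartAt (Model d) x₀).symm z)
        (a ((chartAt (Model d) x₀).symm z) (frame (chartAt (Model d) x₀) z u))) y :=
    ContMDiffAt.clm_bundle_apply (F₁ := Model d) (F₂ := ℝ)
      (E₁ := fun p : N => TangentSpace (𝓡 d) p) (E₂ := Bundle.Trivial N ℝ)
      (b := (chartAt (Model d) x₀).symm)
      (ha.contMDiffAt.comp y (contMDiffAt_chart_symm hy)) (contMDiffAt_frame hy u)
  rw [Bundle.contMDiffAt_totalSpace] at h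
  exact h.2.contDiffAt

theorem contDiffAt_metricIn
    (g : Bundle.ContMDiffRiemannianMetric (𝓡 d) ∞ (Model d)
      (fun p : N => TangentSpace (𝓡 d) p))
    (hy : y ∈ (chartAt (Model d) x₀).target) :
    ContDiffAt ℝ ∞ (metricIn (chartAt (Model d) x₀) g.inner) y := by
  refine contDiffAt_clm_of_apply fun u => contDiffAt_clm_of_apply fun v => ?_
  have h : ContMDiffAt (𝓡 d) ((𝓡 d).prod 𝓘(ℝ, ℝ)) ∞
      (fun z => Bundle.TotalSpace.mk' ℝ (E := Bundle.Trivial N ℝ) ((chartAt (Model d) x₀).symm z)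
        (g.inner ((chartAt (Model d) x₀).symm z) (frame (chartAt (Model d) x₀) z u)
          (frame (chartAt (Model d) x₀) z v))) y :=
    ContMDiffAt.clm_bundle_apply₂ (F₁ := Model d) (F₂ := Model d) (F₃ := ℝ)
      (E₁ := fun p : N => TangentSpace (𝓡 d) p) (E₂ := fun p : N => TangentSpace (𝓡 d) p)
      (E₃ := Bundle.Trivial N ℝ) (b := (chartAt (Model d) x₀).symm)
      (g.contMDiff.contMDiffAt.comp y (contMDiffAt_chart_symm hy)) (contMDiffAt_frame hy u)
      (contMDiffAt_frame hy v)
  rw [Bundle.contMDiffAt_totalSpace] at h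
  exact h.2.contDiffAt

end Chart

/-! ### The ambient structure in the preferred chart. -/

section Ambient

variable {m : ℕ} {N : Type*} [TopologicalSpace N] [ChartedSpace (Model (2 * m + 1)) N]
  [IsManifold (𝓡 (2 * m + 1)) ∞ N] (S : AlmostContactMetric m N)

theorem isMetricOn_metricIn (x₀ : N) :
    IsMetricOn (chartAt (Model (2 * m + 1)) x₀).target
      (metricIn (chartAt (Model (2 * m + 1)) x₀) S.g.inner) where
  isOpen := (chartAt (Model (2 * m + 1)) x₀).open_target
  smooth _ hy := contDiffAt_metricIn S.g hy
  symm _ _ _ _ := S.g.symm _ _ _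
  pos y hy u hu := by
    refine S.g.pos _ _ fun h => hu ?_
    have h' := coord_frame hy u
    erw [h, map_zero] at h'
    exact h'.symm

theorem isAlmostContactOn_chart (x₀ : N) :
    IsAlmostContactOn (chartAt (Model (2 * m + 1)) x₀).target
      (metricIn (chartAt (Model (2 * m + 1)) x₀) S.g.inner)
      (endoIn (chartAt (Model (2 * m + 1)) x₀) S.φ)
      (vectorIn (chartAt (Model (2 * m + 1)) x₀) S.ξ)
      (oneFormIn (chartAt (Model (2 * m + 1)) x₀) S.η) where
  toIsMetricOn := isMetricOn_metricIn S x₀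
  smooth_φ _ hy := contDiffAt_endoIn S.smooth_φ hy
  smooth_ξ _ hy := contDiffAt_vectorIn S.smooth_ξ hy
  smooth_η _ hy := contDiffAt_oneFormIn S.smooth_η hy
  φ_sq y hy v := by
    simp only [endoIn, oneFormIn, vectorIn, ContinuousLinearMap.comp_apply, frame_coord hy,
      S.φ_sq, map_add, map_neg, map_smul, coord_frame hy]
  η_ξ y hy := by
    simp only [oneFormIn, vectorIn, ContinuousLinearMap.comp_apply, frame_coord hy, S.η_ξ]
  φ_ξ y hy := by
    simp only [endoIn, vectorIn, ContinuousLinearMap.comp_apply, frame_coord hy, S.φ_ξ, map_zero]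
  skew y hy u v := by
    change S.g.inner _ (frame _ y u) (frame _ y (coord _ _ (S.φ _ (frame _ y v))))
      = - S.g.inner _ (frame _ y (coord _ _ (S.φ _ (frame _ y u)))) (frame _ y v)
    rw [frame_coord hy, frame_coord hy, S.skew]
  g_ξ y hy v := by
    change S.g.inner _ (frame _ y v) (frame _ y (coord _ _ (S.ξ _))) = S.η _ (frame _ y v)
    rw [frame_coord hy, S.g_ξ]

end Ambient

/-! ### The immersion in the preferred charts. -/

section Domain

variable {m n : ℕ} {N : Type*} [TopologicalSpace N] [ChartedSpace (Model (2 * m + 1)) N]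
  {M : Type*} [TopologicalSpace M] [ChartedSpace (Model n) M] {f : M → N}

/-- The part of the range of the chart at `x` that `f` maps into the domain of the chart at
`f x`. -/
def chartDomain (m n : ℕ) {N : Type*} [TopologicalSpace N] [ChartedSpace (Model (2 * m + 1)) N]
    {M : Type*} [TopologicalSpace M] [ChartedSpace (Model n) M] (f : M → N) (x : M) :
    Set (Model n) :=
  (chartAt (Model n) x).target ∩
    (chartAt (Model n) x).symm ⁻¹' (f ⁻¹' (chartAt (Model (2 * m + 1)) (f x)).source)

theorem chartAt_mem_chartDomain (x : M) : chartAt (Model n) x x ∈ chartDomain m n f x := by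
  refine ⟨(chartAt (Model n) x).map_source (mem_chart_source _ x), ?_⟩
  rw [Set.mem_preimage, (chartAt (Model n) x).left_inv (mem_chart_source _ x)]
  exact mem_chart_source _ (f x)

end Domain

section Immersion

variable {m n : ℕ} {N : Type*} [TopologicalSpace N] [ChartedSpace (Model (2 * m + 1)) N]
  [IsManifold (𝓡 (2 * m + 1)) ∞ N] {S : AlmostContactMetric m N}
  {P : ∀ p : N, TangentSpace (𝓡 (2 * m + 1)) p} {l₁ l₂ : ℝ}
  {M : Type*} [TopologicalSpace M] [ChartedSpace (Model n) M] [IsManifold (𝓡 n) ∞ M] {f : M → N}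

theorem contMDiffAt_chartData_F (hf : ContMDiff (𝓡 n) (𝓡 (2 * m + 1)) ∞ f) {x : M} {t : Model n}
    (ht : t ∈ chartDomain m n f x) :
    ContMDiffAt (𝓡 n) (𝓡 (2 * m + 1)) ∞ (chartData S P l₁ l₂ f x).F t :=
  ContMDiffAt.comp (g := chartAt (Model (2 * m + 1)) (f x))
    (f := f ∘ (chartAt (Model n) x).symm) t
    ((contMDiffOn_chart (I := 𝓡 (2 * m + 1)) (n := ∞)).contMDiffAt
      ((chartAt (Model (2 * m + 1)) (f x)).open_source.mem_nhds ht.2))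
    (hf.contMDiffAt.comp t (contMDiffAt_chart_symm ht.1))

theorem chartData_d (hf : ContMDiff (𝓡 n) (𝓡 (2 * m + 1)) ∞ f) {x : M} {t : Model n}
    (ht : t ∈ chartDomain m n f x) (u : Model n) :
    (chartData S P l₁ l₂ f x).d t u
      = coord (chartAt (Model (2 * m + 1)) (f x)) (f ((chartAt (Model n) x).symm t))
        (mfderiv (𝓡 n) (𝓡 (2 * m + 1)) f ((chartAt (Model n) x).symm t)
          (frame (chartAt (Model n) x) t u)) := by
  have h₁ : MDifferentiableAt (𝓡 n) (𝓡 n) (chartAt (Model n) x).symm t :=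
    (mdifferentiable_chart (I := 𝓡 n) x).mdifferentiableAt_symm ht.1
  have h₂ : MDifferentiableAt (𝓡 n) (𝓡 (2 * m + 1)) f ((chartAt (Model n) x).symm t) :=
    hf.contMDiffAt.mdifferentiableAt (by simp)
  have h₃ : MDifferentiableAt (𝓡 (2 * m + 1)) (𝓡 (2 * m + 1))
      (chartAt (Model (2 * m + 1)) (f x)) (f ((chartAt (Model n) x).symm t)) :=
    (mdifferentiable_chart (I := 𝓡 (2 * m + 1)) (f x)).mdifferentiableAt ht.2
  have h : mfderiv (𝓡 n) (𝓡 (2 * m + 1))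
      (chartAt (Model (2 * m + 1)) (f x) ∘ f ∘ (chartAt (Model n) x).symm) t u
      = coord (chartAt (Model (2 * m + 1)) (f x)) (f ((chartAt (Model n) x).symm t))
        (mfderiv (𝓡 n) (𝓡 (2 * m + 1)) f ((chartAt (Model n) x).symm t)
          (frame (chartAt (Model n) x) t u)) := by
    rw [mfderiv_comp t h₃ (h₂.comp t h₁), mfderiv_comp t h₂ h₁]
    rfl
  rw [mfderiv_eq_fderiv] at h
  exact h

theorem isImmersionOn_chartData
    (hP : ContMDiff (𝓡 (2 * m + 1)) (𝓡 (2 * m + 1)).tangent ∞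
      (fun p => (⟨p, P p⟩ : TangentBundle (𝓡 (2 * m + 1)) N)))
    (hf : ContMDiff (𝓡 n) (𝓡 (2 * m + 1)) ∞ f)
    (himm : ∀ x, Function.Injective (mfderiv (𝓡 n) (𝓡 (2 * m + 1)) f x)) (x : M) :
    IsImmersionOn (chartDomain m n f x) (chartAt (Model (2 * m + 1)) (f x)).target
      (chartData S P l₁ l₂ f x) where
  toIsMetricOn := isMetricOn_metricIn S (f x)
  isOpen_dom := (chartAt (Model n) x).isOpen_inter_preimage_symm
    ((chartAt (Model (2 * m + 1)) (f x)).open_source.preimage hf.continuous)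
  smooth_P _ hy := contDiffAt_vectorIn hP hy
  smooth_F _ ht := (contMDiffAt_chartData_F hf ht).contDiffAt
  mapsTo _ ht := (chartAt (Model (2 * m + 1)) (f x)).map_source ht.2
  inj t ht u v h := by
    rw [chartData_d hf ht, chartData_d hf ht] at h
    have h' := himm _ ((mdifferentiable_chart (I := 𝓡 (2 * m + 1)) (f x)).mfderiv_injective ht.2 h)
    rw [← coord_frame ht.1 u, h', coord_frame ht.1]

/-- This carries orthonormality in T_xM over to the coordinate vectors of the chart. -/
theorem chartData_gInd (hf : ContMDiff (𝓡 n) (𝓡 (2 * m + 1)) ∞ f) (x : M)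
    (u v : TangentSpace (𝓡 n) x) :
    (chartData S P l₁ l₂ f x).gInd (chartAt (Model n) x x) (coord (chartAt (Model n) x) x u)
        (coord (chartAt (Model n) x) x v)
      = S.g.inner (f x) (mfderiv (𝓡 n) (𝓡 (2 * m + 1)) f x u)
        (mfderiv (𝓡 n) (𝓡 (2 * m + 1)) f x v) := by
  have hx := (chartAt (Model n) x).left_inv (mem_chart_source _ x)
  -- The points reached through the charts and their inverses equal x and f x only propositionally,
  -- so the tangent spaces differ as types; the base points are generalized and then substituted.
  have hpull : ∀ q : M, q = x → ∀ p : N, p = f q → ∀ a b : Model n,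
      S.g.inner p (mfderiv (𝓡 n) (𝓡 (2 * m + 1)) f q a) (mfderiv (𝓡 n) (𝓡 (2 * m + 1)) f q b)
        = S.g.inner (f x) (mfderiv (𝓡 n) (𝓡 (2 * m + 1)) f x a)
          (mfderiv (𝓡 n) (𝓡 (2 * m + 1)) f x b) := by
    rintro _ rfl _ rfl a b
    rfl
  have hs : chartAt (Model n) x x ∈ chartDomain m n f x := chartAt_mem_chartDomain x
  have hframe : ∀ w : TangentSpace (𝓡 n) x,
      frame (chartAt (Model n) x) (chartAt (Model n) x x) (coord (chartAt (Model n) x) x w) = w :=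
    DFunLike.congr_fun ((mdifferentiable_chart (I := 𝓡 n) x).symm_comp_deriv
      (mem_chart_source _ x))
  have hd : ∀ w : TangentSpace (𝓡 n) x,
      frame (chartAt (Model (2 * m + 1)) (f x))
        ((chartData S P l₁ l₂ f x).F (chartAt (Model n) x x))
        ((chartData S P l₁ l₂ f x).d (chartAt (Model n) x x) (coord (chartAt (Model n) x) x w))
      = mfderiv (𝓡 n) (𝓡 (2 * m + 1)) f ((chartAt (Model n) x).symm (chartAt (Model n) x x)) w := by
    intro w
    rw [chartData_d hf hs, hframe]
    exact DFunLike.congr_fun ((mdifferentiable_chart (I := 𝓡 (2 * m + 1)) (f x)).symm_comp_deriv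
      hs.2) _
  have h := hpull _ hx _ ((chartAt (Model (2 * m + 1)) (f x)).left_inv hs.2) u v
  rw [← hd, ← hd] at h
  exact h

end Immersion

end ContactChen

theorem theorem3p1 {m n : ℕ} (hn : 3 ≤ n)
    {N : Type*} [TopologicalSpace N] [ChartedSpace (ContactChen.Model (2 * m + 1)) N]
    [IsManifold (𝓡 (2 * m + 1)) ∞ N]
    (S : ContactChen.AlmostContactMetric m N) (κ μ c : ℝ)
    (hS : ContactChen.IsKappaMuSpaceForm S κ μ c)
    (P : ∀ p : N, TangentSpace (𝓡 (2 * m + 1)) p)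
    (hP : ContMDiff (𝓡 (2 * m + 1)) (𝓡 (2 * m + 1)).tangent ∞
      (fun p => (⟨p, P p⟩ : TangentBundle (𝓡 (2 * m + 1)) N)))
    (l₁ l₂ : ℝ)
    {M : Type*} [TopologicalSpace M] [ChartedSpace (ContactChen.Model n) M]
    [IsManifold (𝓡 n) ∞ M]
    (f : M → N) (hf : ContMDiff (𝓡 n) (𝓡 (2 * m + 1)) ∞ f)
    (himm : ∀ x, Function.Injective (mfderiv (𝓡 n) (𝓡 (2 * m + 1)) f x))
    (x : M) (plane : Submodule ℝ (TangentSpace (𝓡 n) x))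
    (e' : Fin n → TangentSpace (𝓡 n) x) (he' : ContactChen.IsOrthonormal S f x e')
    (p' : Fin 2 → TangentSpace (𝓡 n) x) (hp' : ContactChen.IsOrthonormal S f x p')
    (hplane : Submodule.span ℝ (Set.range p') = plane) :
    let D := ContactChen.chartData S P l₁ l₂ f x
    let s := chartAt (ContactChen.Model n) x x
    let e := fun i => ContactChen.coord (chartAt (ContactChen.Model n) x) x (e' i)
    let p := fun i => ContactChen.coord (chartAt (ContactChen.Model n) x) x (p' i)
    D.τ s e - D.K s (p 0) (p 1) ≤
      ((n : ℝ) + 1) * ((n : ℝ) - 2) / 2 * ((c + 3) / 4)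
      + (c + 3 - 4 * κ) / 4 * (-((n : ℝ) - 1) * D.gInd s (D.ξT s) (D.ξT s) + D.γ s p)
      + (c - 1) / 8 * (3 * D.normSq s e (D.Phat s) - 6 * D.βPlane s p)
      + 1 / 4 * (D.normSq s e (D.φh'T s) - D.normSq s e (D.h'T s)
          + |D.tr s e (D.h'T s)| ^ 2 - |D.tr s e (D.φh'T s)| ^ 2)
      - 1 / 2 * (D.det₂ s p (D.h'T s) - D.det₂ s p (D.φh'T s))
      + ((n : ℝ) - 1) * D.tr s e (D.h'T s) - D.tr s p (D.h'T s)
      + (1 - μ) * (D.gInd s (D.ξT s) (D.h'T s (D.ξT s))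
          - D.tr s e (D.h'T s) * D.gInd s (D.ξT s) (D.ξT s) + D.θ s p)
      - (l₁ + l₂) / 2 * ((n : ℝ) - 1) * D.trForm s e D.α
      - l₂ / 2 * (l₁ - l₂) * ((n : ℝ) - 1) * D.trForm s e D.β
      - (l₁ - l₂) / 2 * ((n : ℝ) - 1) * n * D.π s (D.H s e)
      + (l₁ + l₂) / 2 * D.trForm s p D.α
      + l₂ * (l₁ - l₂) / 2 * D.trForm s p D.β
      + (l₁ - l₂) / 2 * D.π s (∑ i, D.h s (p i) (p i))
      + (n : ℝ) ^ 2 * ((n : ℝ) - 2) / (2 * ((n : ℝ) - 1))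
          * D.G (D.F s) (D.H s e) (D.H s e) := by
  intro D s e p
  -- An orthonormal family of n vectors in the n-dimensional model space is a frame of the induced
  -- metric.
  have he : ContactChen.IsFrame (D.gInd s) e :=
    have hD := ContactChen.isImmersionOn_chartData (S := S) (l₁ := l₁) (l₂ := l₂) hP hf himm x
    { symm := hD.gInd_symm (ContactChen.chartAt_mem_chartDomain x)
      pos := hD.gInd_pos (ContactChen.chartAt_mem_chartDomain x)
      ortho := fun i j => (ContactChen.chartData_gInd hf x _ _).trans (he' i j)
      dim := finrank_euclideanSpace_fin }
  exact (ContactChen.isImmersionOn_chartData (S := S) hP hf himm x).tau_sub_K_le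
    (ContactChen.isAlmostContactOn_chart S (f x)) (hS _ (chart_mem_atlas _ _))
    (ContactChen.chartAt_mem_chartDomain x) hn he
    fun i j => (ContactChen.chartData_gInd hf x _ _).trans (hp' i j)
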